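/- Notation. Functions on $(0,\infty)$ are extended by $0$ to $\mathbb R$; $B(0,\infty)$ is the set of bounded Borel functions on $(0,\infty)$, $C^1(0,\infty)$ the set of bounded continuously differentiable functions on $(0,\infty)$ with bounded derivative, and a superscript $+$ denotes nonnegative elements. $\mathfrak N(0,\infty)$ is the set of integer-valued finite Borel measures on $(0,\infty)$ with the topology of weak convergence; $\langle\nu,f\rangle=\int f\,d\nu$. Let $\alpha\in C^1(0,\infty)^+$; for each $x>0$ let $(p(x,i))_{i\ge0}$ be a probability distribution on $\mathbb N$ with $p(\cdot,i)\in C^1(0,\infty)^+$ for every $i$; write $g(x,z)=\sum_i p(x,i)z^i$, $g'(x,1-)=\sum_i i\,p(x,i)$, $g''(x,1-)=\sum_i i(i-1)p(x,i)$ and assume $\sup_{x>0} g'(x,1-)<\infty$. Let $G$ be a probability measure without atoms on $(0,\infty)$, $G(t)=G(0,t]$, and let $L$ be a finite measure on $\mathfrak N(0,\infty)^\circ=\mathfrak N(0,\infty)\setminus\{0\}$, with $\psi(f)=\int(1-e^{-\langle\nu,f\rangle})L(d\nu)$. For $f\in B(0,\infty)^+$ let $u_tf(x)$ be the unique locally bounded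 (that is, bounded on $[0,T]\times(0,\infty)$ for every $T$) nonnegative Borel solution of $$u_tf(x)=f(x-t)+\int_0^t\alpha(x-s)\bigl[1-g(x-s,\langle G,e^{-u_{t-s}f}\rangle)\bigr]ds .$$ An $(\alpha,g,G,\psi)$-process is a Markov process in $\mathfrak N(0,\infty)$ with transition semigroup $(P_t)$ given by $$\int e^{-\langle\nu,f\rangle}P_t(\sigma,d\nu)=\exp\Bigl\{-\langle\sigma,u_tf\rangle-\int_0^t\psi(u_sf)\,ds\Bigr\},\qquad f\in B(0,\infty)^+ .$$ Assume: (a) $\int_0^\infty ds\int_{(s,\infty)}\alpha(x-s)g'(x-s,1-)\,G(dx)<1$; (b) $\alpha_1\in(0,\infty)$ is such that $t\mapsto e^{\alpha_1t}[1-G(t)]$ is directly Riemann integrable over $[0,\infty)$ and $\int_0^\infty e^{\alpha_1s}ds\int_{(s,\infty)}\alpha(x-s)g'(x-s,1-)\,G(dx)=1$; (c) $\int L(d\nu)\int_0^\infty e^{\alpha_1x}\,\nu(dx)<\infty$; (d) $\int_0^\infty e^{2\alpha_1x}\,G(dx)<\infty$ and $\sup_{x>0}g''(x,1-)<\infty$.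 Theorem. Let $f\in B(0,\infty)$. There is a unique locally bounded Borel solution $(t,x)\mapsto\pi_tf(x)$ of $$\pi_tf(x)=f(x-t)+\int_0^t\alpha(x-s)g'(x-s,1-)\langle G,\pi_{t-s}f\rangle\,ds ,$$ the integral $\Pi_\infty f(x)=\int_0^\infty\pi_sf(x)\,ds$ converges absolutely for every $x>0$, $\Pi_\infty f$ is $\nu$-integrable for $L$-almost every $\nu$, and $\nu\mapsto\langle\nu,\Pi_\infty f\rangle$ is $L$-integrable. Let $\sigma\in\mathfrak N(0,\infty)$ and let $Y=(Y_t)_{t\ge0}$ be an $(\alpha,g,G,\psi)$-process with $Y_0=\sigma$ a.s. and with right-continuous paths in $\mathfrak N(0,\infty)$. Then almost surely $s\mapsto\langle Y_s,f\rangle$ is integrable over $[0,t]$ for every $t\ge 0$, and the occupation time process $\langle Z_t,f\rangle=\int_0^t\langle Y_s,f\rangle\,ds$ satisfies $$\frac1t\langle Z_t,f\rangle\longrightarrow\int_{\mathfrak N(0,\infty)^\circ}\langle\nu,\Pi_\infty f\rangle\,L(d\nu)\qquad\text{in probability as }t\to\infty .$$ -/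

import Mathlib

open MeasureTheory ProbabilityTheory Filter Topology
open scoped NNReal ENNReal

namespace AgeBranching

/-- The open half line `(0,∞)`, in which remaining lifetimes live. -/
abbrev PosReal : Type := ↥(Set.Ioi (0 : ℝ))

/-- A function on `(0,∞)` is understood to vanish on the rest of the real line. -/
noncomputable def zeroExt (h : PosReal → ℝ) (y : ℝ) : ℝ :=
  open Classical in if hy : 0 < y then h ⟨y, hy⟩ else 0

/-- `C¹(0,∞)`: bounded continuously differentiable functions on `(0,∞)` with bounded derivative. -/
def IsC1b (h : PosReal → ℝ) : Prop :=
  ContDiffOn ℝ 1 (zeroExt h) (Set.Ioi 0) ∧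
  (∃ C : ℝ, ∀ x, |h x| ≤ C) ∧
  (∃ C : ℝ, ∀ x : ℝ, 0 < x → |deriv (zeroExt h) x| ≤ C)

/-- `B(0,∞)`: bounded Borel functions on `(0,∞)`. -/
def IsBddBorel (f : PosReal → ℝ) : Prop :=
  Measurable f ∧ ∃ C : ℝ, ∀ x, |f x| ≤ C

/-- `𝔑(0,∞)`: integer-valued finite Borel measures on `(0,∞)`, with the topology of weak convergence
and the σ-algebra generated by the evaluations `ν ↦ ν B`, both inherited from `FiniteMeasure`. -/
abbrev CountMeas : Type :=
  {ν : FiniteMeasure PosReal //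
    ∀ B : Set PosReal, MeasurableSet B → ∃ n : ℕ, (ν : Measure PosReal) B = n}

/-- The measure on `(0,∞)` underlying an element of `𝔑(0,∞)`. -/
def CountMeas.toMeas (ν : CountMeas) : Measure PosReal := (ν.1 : Measure PosReal)

/-- The pairing `⟨ν, f⟩ = ∫ f dν`. -/
noncomputable def pairing (ν : CountMeas) (f : PosReal → ℝ) : ℝ := ∫ x, f x ∂ν.toMeas

/-! ### Parameters -/

/-- The birth rate: `α ∈ C¹(0,∞)⁺`. -/
def IsBirthRate (α : PosReal → ℝ) : Prop := IsC1b α ∧ ∀ x, 0 ≤ α x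

/-- The offspring laws: for each `x`, `(p x i)_i` is a probability distribution on `ℕ`; each
`p · i` is in `C¹(0,∞)⁺`; and `sup_x ∑ i, i * p x i < ∞`. -/
structure IsOffspringLaw (p : PosReal → ℕ → ℝ) : Prop where
  nonneg : ∀ x i, 0 ≤ p x i
  hasSum_one : ∀ x, HasSum (p x) 1
  smooth : ∀ i, IsC1b (fun x => p x i)
  mean_bdd : ∃ C : ℝ, ∀ x, Summable (fun i : ℕ => p x i * i) ∧ ∑' i : ℕ, p x i * i ≤ C

/-- The generating function `g(x,z) = ∑ p(x,i) zⁱ`. -/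
noncomputable def genFun (p : PosReal → ℕ → ℝ) (x : PosReal) (z : ℝ) : ℝ := ∑' i : ℕ, p x i * z ^ i

/-- `g'(x,1-) = ∑ i p(x,i)`. -/
noncomputable def genFunDeriv (p : PosReal → ℕ → ℝ) (x : PosReal) : ℝ := ∑' i : ℕ, p x i * i

/-- `‖g''(·,1-)‖ < ∞`, where `g''(x,1-) = ∑ i (i-1) p(x,i)`. -/
def SecondDerivBdd (p : PosReal → ℕ → ℝ) : Prop :=
  ∃ C : ℝ, ∀ x, Summable (fun i : ℕ => p x i * ((i : ℝ) * ((i : ℝ) - 1))) ∧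
    ∑' i : ℕ, p x i * ((i : ℝ) * ((i : ℝ) - 1)) ≤ C

/-! ### Cumulant and mean equations -/

/-- `u` is the bounded-on-compact-time-intervals nonnegative Borel solution `(t,x) ↦ u_t f(x)` of
`u_t f(x) = f(x-t) + ∫₀ᵗ α(x-s) [1 - g(x-s, ⟨G, exp(-u_{t-s} f)⟩)] ds`. -/
structure IsCumulant (α : PosReal → ℝ) (p : PosReal → ℕ → ℝ) (G : Measure PosReal)
    (f : PosReal → ℝ) (u : ℝ≥0 → PosReal → ℝ) : Prop where
  measurable : Measurable (Function.uncurry u)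
  nonneg : ∀ t x, 0 ≤ u t x
  locBdd : ∀ T : ℝ≥0, ∃ C : ℝ, ∀ t ≤ T, ∀ x, u t x ≤ C
  eqn : ∀ (t : ℝ≥0) (x : PosReal), u t x = zeroExt f ((x : ℝ) - t) +
    ∫ s in (0 : ℝ)..t,
      zeroExt (fun y => α y * (1 - genFun p y (∫ z, Real.exp (-u (t - s.toNNReal) z) ∂G)))
        ((x : ℝ) - s)

/-- `π` is the locally bounded Borel solution `(t,x) ↦ π_t f(x)` of
`π_t f(x) = f(x-t) + ∫₀ᵗ α(x-s) g'(x-s,1-) ⟨G, π_{t-s} f⟩ ds`. -/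
structure IsMeanSolution (α : PosReal → ℝ) (p : PosReal → ℕ → ℝ) (G : Measure PosReal)
    (f : PosReal → ℝ) (π : ℝ≥0 → PosReal → ℝ) : Prop where
  measurable : Measurable (Function.uncurry π)
  locBdd : ∀ T : ℝ≥0, ∃ C : ℝ, ∀ t ≤ T, ∀ x, |π t x| ≤ C
  eqn : ∀ (t : ℝ≥0) (x : PosReal), π t x = zeroExt f ((x : ℝ) - t) +
    ∫ s in (0 : ℝ)..t,
      zeroExt (fun y => α y * genFunDeriv p y) ((x : ℝ) - s) *
        ∫ z, π (t - s.toNNReal) z ∂G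

/-- `Π_∞ f(x) = ∫₀^∞ π_s f(x) ds`. -/
noncomputable def totalMean (π : ℝ≥0 → PosReal → ℝ) (x : PosReal) : ℝ :=
  ∫ s in Set.Ioi (0 : ℝ), π s.toNNReal x

/-! ### The process with immigration -/

/-- `ψ(f) = ∫ (1 - exp(-⟨ν,f⟩)) L(dν)`. -/
noncomputable def immExponent (L : Measure CountMeas) (f : PosReal → ℝ) : ℝ :=
  ∫ ν, (1 - Real.exp (-pairing ν f)) ∂L

/-- `(P_t)` is the transition semigroup of the `(α,g,G,ψ)`-process: probability kernels on
`𝔑(0,∞)` with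
`∫ exp(-⟨ν,f⟩) P_t(σ,dν) = exp(-⟨σ,u_t f⟩ - ∫₀ᵗ ψ(u_s f) ds)` for all `f ∈ B(0,∞)⁺`. -/
structure IsImmigrationSemigroup (α : PosReal → ℝ) (p : PosReal → ℕ → ℝ) (G : Measure PosReal)
    (L : Measure CountMeas) (P : ℝ≥0 → Kernel CountMeas CountMeas) : Prop where
  markov : ∀ t, IsMarkovKernel (P t)
  laplace : ∀ f : PosReal → ℝ, IsBddBorel f → (∀ x, 0 ≤ f x) →
    ∀ u : ℝ≥0 → PosReal → ℝ, IsCumulant α p G f u →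
    ∀ (t : ℝ≥0) (σ : CountMeas),
      ∫ ν, Real.exp (-pairing ν f) ∂(P t σ) =
        Real.exp (-pairing σ (u t) - ∫ s in (0 : ℝ)..t, immExponent L (u s.toNNReal))

/-- `Y`, started from `σ`, is a Markov process relative to `𝓕` with transition semigroup `(P_t)`
and with right-continuous paths in `𝔑(0,∞)`. -/
structure IsRightContMarkov {Ω : Type*} [mΩ : MeasurableSpace Ω] (μ : Measure Ω)
    (𝓕 : Filtration ℝ≥0 mΩ) (P : ℝ≥0 → Kernel CountMeas CountMeas) (σ : CountMeas)
    (Y : ℝ≥0 → Ω → CountMeas) : Prop where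
  adapted : ∀ t, Measurable[𝓕 t] (Y t)
  initial : ∀ᵐ ω ∂μ, Y 0 ω = σ
  rightCont : ∀ ω t, ContinuousWithinAt (fun s => Y s ω) (Set.Ici t) t
  markov : ∀ s t : ℝ≥0, s ≤ t → ∀ h : CountMeas → ℝ, Measurable h → (∃ C : ℝ, ∀ ν, |h ν| ≤ C) →
    μ[fun ω => h (Y t ω) | 𝓕 s] =ᵐ[μ] fun ω => ∫ ν, h ν ∂(P (t - s) (Y s ω))

/-- The occupation time process `⟨Z_t, f⟩ = ∫₀ᵗ ⟨Y_s, f⟩ ds`. -/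
noncomputable def occupation {Ω : Type*} (Y : ℝ≥0 → Ω → CountMeas) (f : PosReal → ℝ)
    (t : ℝ) (ω : Ω) : ℝ :=
  ∫ s in (0 : ℝ)..t, pairing (Y s.toNNReal ω) f

/-! ### Subcriticality and the Malthusian condition -/

/-- Direct Riemann integrability over `[0,∞)` of a nonnegative function: upper sums are finite for
every mesh, and upper and lower sums have the same limit as the mesh tends to `0`. -/
def DirectlyRiemannIntegrable (f : ℝ → ℝ) : Prop :=
  (∀ a : ℝ, 0 < a →
    ∑' n : ℕ, ENNReal.ofReal a * (⨆ x ∈ Set.Icc (n * a) ((n + 1) * a), ENNReal.ofReal (f x)) < ∞) ∧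
  ∃ l : ℝ≥0∞,
    Tendsto (fun a : ℝ => ∑' n : ℕ, ENNReal.ofReal a *
      (⨆ x ∈ Set.Icc (n * a) ((n + 1) * a), ENNReal.ofReal (f x))) (𝓝[>] 0) (𝓝 l) ∧
    Tendsto (fun a : ℝ => ∑' n : ℕ, ENNReal.ofReal a *
      (⨅ x ∈ Set.Icc (n * a) ((n + 1) * a), ENNReal.ofReal (f x))) (𝓝[>] 0) (𝓝 l)

/-- `∫_{(s,∞)} α(x-s) g'(x-s,1-) G(dx)`, as an extended nonnegative number. -/
noncomputable def renewalDensity (α : PosReal → ℝ) (p : PosReal → ℕ → ℝ) (G : Measure PosReal)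
    (s : ℝ) : ℝ≥0∞ :=
  ∫⁻ x, ENNReal.ofReal (zeroExt (fun y => α y * genFunDeriv p y) ((x : ℝ) - s)) ∂G

/-- The process is subcritical, and `α₁ > 0` is its Malthusian parameter, for which moreover
`t ↦ exp(α₁ t) (1 - G(t))` is directly Riemann integrable. -/
structure SubcriticalMalthusian (α : PosReal → ℝ) (p : PosReal → ℕ → ℝ) (G : Measure PosReal)
    (α₁ : ℝ) : Prop where
  subcritical : ∫⁻ s in Set.Ioi (0 : ℝ), renewalDensity α p G s < 1
  pos : 0 < α₁
  dri : DirectlyRiemannIntegrable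
    (fun t => Real.exp (α₁ * t) * (1 - G.real {x : PosReal | (x : ℝ) ≤ t}))
  malthus : ∫⁻ s in Set.Ioi (0 : ℝ), ENNReal.ofReal (Real.exp (α₁ * s)) * renewalDensity α p G s = 1

end AgeBranching

open AgeBranching

namespace AgeBranching

set_option linter.unusedSectionVars false

/-! ### Extension by zero -/

/-! Splitting `f` into positive and negative parts reduces everything to `f ≥ 0`. Let `W_t` be the
time average of `⟨Y_s, f⟩` over `[0,t]` and let `c = ∫ ⟨ν, Π_∞ f⟩ L(dν)`. Two one-sided estimates
suffice, and no variance is computed: an upper bound `E W_t ≤ c + O(1/t)`, and the single Laplace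
bound `limsup E exp(-W_t) ≤ exp(-c)`. The function `e⁻ᶻ - 1 + z` is nonnegative, convex and zero
only at `0`; its mean at `z = W_t - c` equals `e^c E exp(-W_t) - 1 + E W_t - c`, whose limsup is
then at most `0`, so Markov's inequality gives convergence in probability
(`tendstoInMeasure_of_laplace_le`).

First moment. The mean path `π` solves the linear equation and dominates the cumulant. Expanding the
Laplace functional at small arguments gives `E⟨Y_s, f⟩ ≤ ⟨σ, π_s f⟩ + ∫₀ˢ ∫ ⟨ν, π_r f⟩ L(dν) dr`.
The second term is at most `c`, and the first is integrable in `s`, since `Π_∞ f` grows at most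
linearly in `x`.

Laplace bound. Jensen's inequality over a phase `θ ∈ (0,1]` replaces the time integral by sums over
the grids `θ, θ+1, …`. Iterating the Markov property along such a grid feeds one impulse `f/t` per
unit time into the cumulant equation; the functional is then at most the exponential of minus a sum
of integrals of `ψ` (`integral_exp_sum_aux`). The nonlinear equation driven by small impulses `ε f`
differs from the superposition of mean paths by at most `ε² B x`, uniformly in the number of
impulses (`exists_le_trainSol`). Keeping the last `J+1` impulses and expanding `ψ` to first order
gives a limit `exp(-c_J)`, where `c_J` is the integral over `[0, J+1]` that increases to `c`.

Both the control of `Π_∞` and the quadratic error rest on `Subcrit.comparison`: since the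
reproduction mean `⟨G, K⟩` is below `1`, a feedback inequality for `⟨G, d_r⟩` can be absorbed. The
exponential moments enter through the second moment of `G` and the `L`-integrability of `⟨ν,1⟩` and
`⟨ν,x⟩`. -/

lemma zeroExt_of_pos (h : PosReal → ℝ) {y : ℝ} (hy : 0 < y) : zeroExt h y = h ⟨y, hy⟩ := by
  simp [zeroExt, hy]

lemma zeroExt_of_nonpos (h : PosReal → ℝ) {y : ℝ} (hy : y ≤ 0) : zeroExt h y = 0 := by
  simp [zeroExt, not_lt.2 hy]

@[simp] lemma zeroExt_coe (h : PosReal → ℝ) (x : PosReal) : zeroExt h x = h x :=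
  zeroExt_of_pos h x.2

lemma zeroExt_nonneg {h : PosReal → ℝ} (hh : ∀ x, 0 ≤ h x) (y : ℝ) : 0 ≤ zeroExt h y := by
  rcases lt_or_ge 0 y with hy | hy
  · rw [zeroExt_of_pos h hy]; exact hh _
  · rw [zeroExt_of_nonpos h hy]

lemma zeroExt_mono {h k : PosReal → ℝ} (hh : ∀ x, h x ≤ k x) (y : ℝ) :
    zeroExt h y ≤ zeroExt k y := by
  rcases lt_or_ge 0 y with hy | hy
  · rw [zeroExt_of_pos h hy, zeroExt_of_pos k hy]; exact hh _
  · rw [zeroExt_of_nonpos h hy, zeroExt_of_nonpos k hy]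

lemma zeroExt_le {h : PosReal → ℝ} {C : ℝ} (hC : 0 ≤ C) (hh : ∀ x, h x ≤ C) (y : ℝ) :
    zeroExt h y ≤ C := by
  rcases lt_or_ge 0 y with hy | hy
  · rw [zeroExt_of_pos h hy]; exact hh _
  · rw [zeroExt_of_nonpos h hy]; exact hC

lemma zeroExt_sub (h k : PosReal → ℝ) (y : ℝ) :
    zeroExt (fun x => h x - k x) y = zeroExt h y - zeroExt k y := by
  rcases lt_or_ge 0 y with hy | hy
  · simp [zeroExt_of_pos _ hy]
  · simp [zeroExt_of_nonpos _ hy]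

lemma zeroExt_const_mul (c : ℝ) (h : PosReal → ℝ) (y : ℝ) :
    zeroExt (fun x => c * h x) y = c * zeroExt h y := by
  rcases lt_or_ge 0 y with hy | hy
  · simp [zeroExt_of_pos _ hy]
  · simp [zeroExt_of_nonpos _ hy]

lemma zeroExt_mul_const (h : PosReal → ℝ) (c : ℝ) (y : ℝ) :
    zeroExt (fun x => h x * c) y = zeroExt h y * c := by
  rcases lt_or_ge 0 y with hy | hy
  · simp [zeroExt_of_pos _ hy]
  · simp [zeroExt_of_nonpos _ hy]

lemma measurable_zeroExt_uncurry {β : Type*} [MeasurableSpace β] {h : β → PosReal → ℝ}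
    (hh : Measurable (Function.uncurry h)) :
    Measurable (fun q : β × ℝ => zeroExt (h q.1) q.2) := by
  -- Nonpositive reals are sent to the arbitrary point `1`, which makes the retraction onto the half
  -- line total; the outer `if` discards that value.
  have hr : Measurable (fun y : ℝ => (⟨if 0 < y then y else 1, by
      show (0 : ℝ) < _
      split_ifs with h
      · exact h
      · exact one_pos⟩ : PosReal)) :=
    Measurable.subtype_mk (Measurable.ite measurableSet_Ioi measurable_id measurable_const)
  have : (fun q : β × ℝ => zeroExt (h q.1) q.2) = fun q : β × ℝ =>
      if 0 < q.2 then h q.1 ⟨if 0 < q.2 then q.2 else 1, by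
        show (0 : ℝ) < _
        split_ifs with h
        · exact h
        · exact one_pos⟩ else 0 := by
    funext q
    rcases lt_or_ge 0 q.2 with hy | hy
    · simp [zeroExt_of_pos _ hy, hy]
    · simp [zeroExt_of_nonpos _ hy, not_lt.2 hy]
  rw [this]
  refine Measurable.ite (measurableSet_Ioi.preimage measurable_snd) ?_ measurable_const
  exact hh.comp (measurable_fst.prodMk (hr.comp measurable_snd))

lemma measurable_zeroExt {h : PosReal → ℝ} (hh : Measurable h) : Measurable (zeroExt h) := by
  have := measurable_zeroExt_uncurry (β := Unit) (h := fun _ => h) (hh.comp measurable_snd)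
  exact this.comp (measurable_const (a := ()).prodMk measurable_id)

lemma IsC1b.measurable {h : PosReal → ℝ} (hh : IsC1b h) : Measurable h := by
  have h1 : ContinuousOn (zeroExt h) (Set.Ioi 0) := hh.1.continuousOn
  have h2 : Continuous (fun x : PosReal => zeroExt h x) :=
    continuousOn_iff_continuous_domRestrict.1 h1
  simpa using h2.measurable

/-! ### The generating function -/

section GenFun

variable {p : PosReal → ℕ → ℝ}

lemma IsOffspringLaw.summable_mean (hp : IsOffspringLaw p) (x : PosReal) :
    Summable (fun i : ℕ => p x i * i) := by
  obtain ⟨C, hC⟩ := hp.mean_bdd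
  exact (hC x).1

lemma IsOffspringLaw.summable_genFun (hp : IsOffspringLaw p) (x : PosReal) {z : ℝ}
    (h0 : 0 ≤ z) (h1 : z ≤ 1) : Summable (fun i : ℕ => p x i * z ^ i) :=
  Summable.of_nonneg_of_le (fun i => mul_nonneg (hp.nonneg x i) (pow_nonneg h0 i))
    (fun i => mul_le_of_le_one_right (hp.nonneg x i) (pow_le_one₀ h0 h1)) (hp.hasSum_one x).summable

lemma IsOffspringLaw.genFunDeriv_nonneg (hp : IsOffspringLaw p) (x : PosReal) :
    0 ≤ genFunDeriv p x :=
  tsum_nonneg fun i => mul_nonneg (hp.nonneg x i) (Nat.cast_nonneg i)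

lemma IsOffspringLaw.genFun_one (hp : IsOffspringLaw p) (x : PosReal) : genFun p x 1 = 1 := by
  simpa [genFun] using (hp.hasSum_one x).tsum_eq

lemma pow_sub_pow_le_mul_sub {z w : ℝ} (h0 : 0 ≤ z) (hzw : z ≤ w) (h1 : w ≤ 1) (i : ℕ) :
    w ^ i - z ^ i ≤ i * (w - z) := by
  have h := abs_pow_sub_pow_le w z i
  have hw : 0 ≤ w := h0.trans hzw
  rw [abs_of_nonneg (sub_nonneg.2 (pow_le_pow_left₀ h0 hzw i)), abs_of_nonneg (sub_nonneg.2 hzw),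
    abs_of_nonneg hw, abs_of_nonneg h0, max_eq_left hzw] at h
  refine h.trans ?_
  have h3 : w ^ (i - 1) ≤ 1 := pow_le_one₀ hw h1
  have h4 : 0 ≤ (w - z) * i := mul_nonneg (sub_nonneg.2 hzw) (Nat.cast_nonneg i)
  nlinarith

lemma IsOffspringLaw.genFun_mono (hp : IsOffspringLaw p) (x : PosReal) {z w : ℝ}
    (h0 : 0 ≤ z) (hzw : z ≤ w) (h1 : w ≤ 1) : genFun p x z ≤ genFun p x w :=
  Summable.tsum_le_tsum
    (fun i => mul_le_mul_of_nonneg_left (pow_le_pow_left₀ h0 hzw i) (hp.nonneg x i))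
    (hp.summable_genFun x h0 (hzw.trans h1)) (hp.summable_genFun x (h0.trans hzw) h1)

/-- Each power has slope at most `i` on `[0,1]`, so `g'(x,1-)` is a Lipschitz constant there. -/
lemma IsOffspringLaw.genFun_sub_le (hp : IsOffspringLaw p) (x : PosReal) {z w : ℝ}
    (h0 : 0 ≤ z) (hzw : z ≤ w) (h1 : w ≤ 1) :
    genFun p x w - genFun p x z ≤ genFunDeriv p x * (w - z) := by
  rw [genFun, genFun, genFunDeriv, ← Summable.tsum_sub (hp.summable_genFun x (h0.trans hzw) h1)
    (hp.summable_genFun x h0 (hzw.trans h1)), ← tsum_mul_right]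
  refine Summable.tsum_le_tsum (fun i => ?_) ((hp.summable_genFun x (h0.trans hzw) h1).sub
    (hp.summable_genFun x h0 (hzw.trans h1))) ((hp.summable_mean x).mul_right _)
  have := mul_le_mul_of_nonneg_left (pow_sub_pow_le_mul_sub h0 hzw h1 i) (hp.nonneg x i)
  linarith

/-- Induction on `i`: the increment is `q(1-q)^i ≥ q - i q²`. The constant is twice the sharp one,
which is harmless and matches the summand of `g''(x,1-)`. -/
lemma one_sub_one_sub_pow_ge {q : ℝ} (h0 : 0 ≤ q) (h1 : q ≤ 1) (i : ℕ) :
    i * q - i * ((i : ℝ) - 1) * q ^ 2 ≤ 1 - (1 - q) ^ i := by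
  induction i with
  | zero => simp
  | succ i ih =>
    have hB : 1 - (1 - q) ^ i ≤ i * q := by
      have := pow_sub_pow_le_mul_sub (z := 1 - q) (w := 1) (by linarith) (by linarith) le_rfl i
      simpa using this
    have hq := mul_le_mul_of_nonneg_left hB h0
    rw [pow_succ (1 - q) i]
    push_cast
    have hi : (0 : ℝ) ≤ i := Nat.cast_nonneg i
    nlinarith [mul_nonneg hi (sq_nonneg q)]

lemma IsOffspringLaw.one_sub_genFun_ge (hp : IsOffspringLaw p) {C : ℝ} {x : PosReal}
    (hs : Summable (fun i : ℕ => p x i * ((i : ℝ) * ((i : ℝ) - 1))))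
    (hC : ∑' i : ℕ, p x i * ((i : ℝ) * ((i : ℝ) - 1)) ≤ C) {q : ℝ} (h0 : 0 ≤ q) (h1 : q ≤ 1) :
    genFunDeriv p x * q - C * q ^ 2 ≤ 1 - genFun p x (1 - q) := by
  have hg := hp.summable_genFun x (z := 1 - q) (by linarith) (by linarith)
  have h2 : genFunDeriv p x * q - (∑' i : ℕ, p x i * ((i : ℝ) * ((i : ℝ) - 1))) * q ^ 2 ≤
      1 - genFun p x (1 - q) := by
    have e : 1 - genFun p x (1 - q) = ∑' i : ℕ, (p x i - p x i * (1 - q) ^ i) := by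
      rw [Summable.tsum_sub (hp.hasSum_one x).summable hg, (hp.hasSum_one x).tsum_eq, genFun]
    rw [e, genFunDeriv, ← tsum_mul_right, ← tsum_mul_right,
      ← Summable.tsum_sub ((hp.summable_mean x).mul_right _) (hs.mul_right _)]
    refine Summable.tsum_le_tsum (fun i => ?_) (((hp.summable_mean x).mul_right _).sub
      (hs.mul_right _)) ((hp.hasSum_one x).summable.sub hg)
    have := mul_le_mul_of_nonneg_left (one_sub_one_sub_pow_ge h0 h1 i) (hp.nonneg x i)
    linarith
  have := mul_le_mul_of_nonneg_right hC (sq_nonneg q)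
  linarith

lemma IsOffspringLaw.measurable_genFun (hp : IsOffspringLaw p) {β : Type*} [MeasurableSpace β]
    {h : β → PosReal} {z : β → ℝ} (hh : Measurable h) (hz : Measurable z)
    (h0 : ∀ b, 0 ≤ z b) (h1 : ∀ b, z b ≤ 1) : Measurable (fun b => genFun p (h b) (z b)) := by
  refine measurable_of_tendsto_metrizable
    (f := fun n b => ∑ i ∈ Finset.range n, p (h b) i * z b ^ i) (fun n => ?_) ?_
  · exact Finset.measurable_sum _ fun i _ => ((hp.smooth i).measurable.comp hh).mul (hz.pow_const i)
  · rw [tendsto_pi_nhds]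
    intro b
    exact (hp.summable_genFun (h b) (h0 b) (h1 b)).hasSum.tendsto_sum_nat

lemma IsOffspringLaw.measurable_genFunDeriv (hp : IsOffspringLaw p) :
    Measurable (genFunDeriv p) := by
  refine measurable_of_tendsto_metrizable
    (f := fun n x => ∑ i ∈ Finset.range n, p x i * i) (fun n => ?_) ?_
  · exact Finset.measurable_sum _ fun i _ => (hp.smooth i).measurable.mul_const _
  · rw [tendsto_pi_nhds]
    intro b
    exact (hp.summable_mean b).hasSum.tendsto_sum_nat

end GenFun

/-! ### Evolution equations -/

/-- A time-dependent function on `(0,∞)`, extended by `0` to negative times, which is Borel and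
bounded on bounded time intervals. -/
structure IsPath (φ : ℝ → PosReal → ℝ) : Prop where
  measurable : Measurable (Function.uncurry φ)
  zero_of_neg : ∀ t < 0, ∀ x, φ t x = 0
  locBdd : ∀ T : ℝ, ∃ C : ℝ, ∀ t ≤ T, ∀ x, |φ t x| ≤ C

/-- A branching mechanism `H y φ` that is monotone, continuous under bounded pointwise limits and
dominated by a multiple of the mean of `φ`. -/
structure Admissible (G : Measure PosReal) (κ : ℝ) (H : ℝ → (PosReal → ℝ) → ℝ) : Prop where
  zero_of_nonpos : ∀ y ≤ 0, ∀ φ, H y φ = 0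
  nonneg : ∀ y φ, (∀ x, 0 ≤ φ x) → 0 ≤ H y φ
  mono : ∀ y φ ψ, Measurable φ → Measurable ψ → (∀ x, 0 ≤ φ x) → (∀ x, φ x ≤ ψ x) →
    (∃ C, ∀ x, ψ x ≤ C) → H y φ ≤ H y ψ
  le : ∀ y φ C, Measurable φ → (∀ x, 0 ≤ φ x) → (∀ x, φ x ≤ C) → H y φ ≤ κ * C
  tendsto : ∀ y (φ : ℕ → PosReal → ℝ) ψ C, (∀ n, Measurable (φ n)) →
    (∀ n x, 0 ≤ φ n x) → (∀ n x, φ n x ≤ C) → (∀ x, Tendsto (fun n => φ n x) atTop (𝓝 (ψ x))) →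
    Tendsto (fun n => H y (φ n)) atTop (𝓝 (H y ψ))
  meas : ∀ φ : ℝ → PosReal → ℝ, Measurable (Function.uncurry φ) → (∀ t x, 0 ≤ φ t x) →
    Measurable (fun q : ℝ × ℝ => H q.1 (φ q.2))

/-- `(t,x) ↦ ∫_{s>0} H(x-s, φ_{t-s}) ds`. -/
noncomputable def evol (H : ℝ → (PosReal → ℝ) → ℝ) (φ : ℝ → PosReal → ℝ) (t : ℝ) (x : PosReal) : ℝ :=
  ∫ s in Set.Ioi (0 : ℝ), H (x - s) (φ (t - s))

/-- Picard iterates of `U = F + evol H U`. -/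
noncomputable def picard (H : ℝ → (PosReal → ℝ) → ℝ) (F : ℝ → PosReal → ℝ) :
    ℕ → ℝ → PosReal → ℝ
  | 0 => fun _ _ => 0
  | n + 1 => fun t x => F t x + evol H (picard H F n) t x

/-- The least nonnegative solution of `U = F + evol H U`. -/
noncomputable def minSol (H : ℝ → (PosReal → ℝ) → ℝ) (F : ℝ → PosReal → ℝ) (t : ℝ) (x : PosReal) : ℝ :=
  ⨆ n, picard H F n t x

lemma IsPath.slice {φ : ℝ → PosReal → ℝ} (hφ : IsPath φ) (t : ℝ) : Measurable (φ t) :=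
  hφ.measurable.comp (measurable_const.prodMk measurable_id)

section Evolution

variable {G : Measure PosReal} {κ : ℝ} {H : ℝ → (PosReal → ℝ) → ℝ}

lemma Admissible.zero (hH : Admissible G κ H) {y : ℝ} {φ : PosReal → ℝ} (hφ : ∀ x, φ x = 0) :
    H y φ = 0 := by
  have hφ' : φ = fun _ => 0 := funext hφ
  refine le_antisymm ?_ (hH.nonneg y φ fun x => (hφ x).ge)
  have := hH.le y φ 0 (by rw [hφ']; exact measurable_const) (fun x => (hφ x).ge)
    (fun x => (hφ x).le)
  simpa using this

lemma Admissible.measurable_integrand (hH : Admissible G κ H) {φ : ℝ → PosReal → ℝ}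
    (hφ : IsPath φ) (h0 : ∀ t x, 0 ≤ φ t x) (t : ℝ) (y : ℝ) :
    Measurable (fun s : ℝ => H (y - s) (φ (t - s))) :=
  (hH.meas φ hφ.measurable h0).comp
    ((measurable_const.sub measurable_id).prodMk (measurable_const.sub measurable_id))

/-- The mechanism vanishes at nonpositive arguments, so an individual with remaining life `y`
contributes only for `s < y`. This bounded support makes the integral over all `s > 0` converge and
serves as the dominating function for the Picard limit. -/
lemma Admissible.integrand_le_indicator (hH : Admissible G κ H) {φ : ℝ → PosReal → ℝ}
    (hφ : IsPath φ) (h0 : ∀ t x, 0 ≤ φ t x) {t B : ℝ} (hB : ∀ r ≤ t, ∀ x, φ r x ≤ B) (y : ℝ)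
    {s : ℝ} (hs : 0 ≤ s) :
    H (y - s) (φ (t - s)) ≤ (Set.Ico 0 y).indicator (fun _ => κ * B) s := by
  by_cases hsy : s < y
  · rw [Set.indicator_of_mem (Set.mem_Ico.2 ⟨hs, hsy⟩)]
    exact hH.le _ _ _ (hφ.slice _) (h0 _) (hB _ (by linarith))
  · rw [hH.zero_of_nonpos _ (by linarith), Set.indicator_of_notMem (by simp [hsy])]

lemma integrableOn_indicator_const (y c : ℝ) :
    IntegrableOn (fun s => (Set.Ico 0 y).indicator (fun _ => c) s) (Set.Ioi (0 : ℝ)) := by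
  refine Integrable.integrableOn ?_
  rw [integrable_indicator_iff measurableSet_Ico]
  exact integrableOn_const (by simp)

lemma Admissible.integrableOn (hH : Admissible G κ H) {φ : ℝ → PosReal → ℝ} (hφ : IsPath φ)
    (h0 : ∀ t x, 0 ≤ φ t x) (t y : ℝ) :
    IntegrableOn (fun s : ℝ => H (y - s) (φ (t - s))) (Set.Ioi 0) := by
  obtain ⟨B, hB⟩ := hφ.locBdd t
  refine Integrable.mono' (integrableOn_indicator_const y (κ * B))
    (hH.measurable_integrand hφ h0 t y).aestronglyMeasurable ?_
  refine (ae_restrict_iff' measurableSet_Ioi).2 (ae_of_all _ fun s hs => ?_)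
  rw [Real.norm_of_nonneg (hH.nonneg _ _ (h0 _))]
  exact hH.integrand_le_indicator hφ h0 (fun r hr x => (le_abs_self _).trans (hB r hr x)) y
    (le_of_lt hs)

lemma Admissible.evol_nonneg (hH : Admissible G κ H) {φ : ℝ → PosReal → ℝ}
    (h0 : ∀ t x, 0 ≤ φ t x) (t : ℝ) (x : PosReal) : 0 ≤ evol H φ t x :=
  integral_nonneg fun _ => hH.nonneg _ _ (h0 _)

lemma Admissible.evol_of_neg (hH : Admissible G κ H) {φ : ℝ → PosReal → ℝ} (hφ : IsPath φ)
    {t : ℝ} (ht : t < 0) (x : PosReal) : evol H φ t x = 0 := by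
  refine setIntegral_eq_zero_of_forall_eq_zero fun s hs => hH.zero fun z => ?_
  exact hφ.zero_of_neg _ (by have : (0 : ℝ) < s := hs; linarith) z

lemma Admissible.evol_mono (hH : Admissible G κ H) {φ ψ : ℝ → PosReal → ℝ} (hφ : IsPath φ)
    (hψ : IsPath ψ) (h0 : ∀ t x, 0 ≤ φ t x) (hle : ∀ t x, φ t x ≤ ψ t x) (t : ℝ) (x : PosReal) :
    evol H φ t x ≤ evol H ψ t x := by
  have h0' : ∀ t x, 0 ≤ ψ t x := fun t x => (h0 t x).trans (hle t x)
  refine integral_mono (hH.integrableOn hφ h0 t x) (hH.integrableOn hψ h0' t x) fun s => ?_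
  refine hH.mono _ _ _ (hφ.slice _) (hψ.slice _) (h0 _) (hle _) ?_
  obtain ⟨C, hC⟩ := hψ.locBdd (t - s)
  exact ⟨C, fun x => (le_abs_self _).trans (hC _ le_rfl x)⟩

lemma Admissible.measurable_evol (hH : Admissible G κ H) {φ : ℝ → PosReal → ℝ} (hφ : IsPath φ)
    (h0 : ∀ t x, 0 ≤ φ t x) : Measurable (Function.uncurry (evol H φ)) := by
  have h : Measurable (fun q : (ℝ × PosReal) × ℝ => H (q.1.2 - q.2) (φ (q.1.1 - q.2))) :=
    (hH.meas φ hφ.measurable h0).comp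
      (((measurable_subtype_coe.comp (measurable_snd.comp measurable_fst)).sub measurable_snd).prodMk
        ((measurable_fst.comp measurable_fst).sub measurable_snd))
  exact (h.stronglyMeasurable.integral_prod_right'
    (ν := volume.restrict (Set.Ioi (0 : ℝ)))).measurable

/-- This identity says that `C exp(κ t)` solves the scalar equation with constant source `C` and
rate `κ`; it is therefore a supersolution that Picard iteration cannot leave. -/
lemma integral_mul_exp_sub (κ C t : ℝ) :
    ∫ s in (0 : ℝ)..t, κ * (C * Real.exp (κ * (t - s))) = C * Real.exp (κ * t) - C := by
  have h : ∀ s ∈ Set.uIcc 0 t, HasDerivAt (fun s => -(C * Real.exp (κ * (t - s))))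
      (κ * (C * Real.exp (κ * (t - s)))) s := by
    intro s _
    have h1 : HasDerivAt (fun s => κ * (t - s)) (κ * (-1)) s :=
      ((hasDerivAt_id s).const_sub t).const_mul κ
    convert! ((h1.exp.const_mul C).neg) using 1
    ring
  rw [intervalIntegral.integral_eq_sub_of_hasDerivAt h (Continuous.intervalIntegrable (by fun_prop) _ _)]
  simp
  ring

lemma setIntegral_Ioi_split {f : ℝ → ℝ} (hf : IntegrableOn f (Set.Ioi 0)) {t : ℝ} (ht : 0 ≤ t) :
    ∫ s in Set.Ioi (0 : ℝ), f s = (∫ s in (0 : ℝ)..t, f s) + ∫ s in Set.Ioi t, f s := by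
  rw [← Set.Ioc_union_Ioi_eq_Ioi ht,
    setIntegral_union Set.Ioc_disjoint_Ioi_same measurableSet_Ioi
      (hf.mono_set Set.Ioc_subset_Ioi_self) (hf.mono_set (Set.Ioi_subset_Ioi ht)),
    intervalIntegral.integral_of_le ht]

lemma setIntegral_Ioi_shift (f : ℝ → ℝ) (t : ℝ) :
    ∫ s in Set.Ioi t, f s = ∫ s in Set.Ioi (0 : ℝ), f (s + t) := by
  have := (measurePreserving_add_right (volume : Measure ℝ) t).setIntegral_preimage_emb
    (measurableEmbedding_addRight t) f (Set.Ioi t)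
  rw [← this]
  simp

lemma Admissible.evol_le_exp (hH : Admissible G κ H) {φ : ℝ → PosReal → ℝ}
    (hφ : IsPath φ) (h0 : ∀ t x, 0 ≤ φ t x) {C : ℝ}
    (hC : ∀ t x, φ t x ≤ C * Real.exp (κ * t)) {t : ℝ} (ht : 0 ≤ t) (x : PosReal) :
    evol H φ t x ≤ C * Real.exp (κ * t) - C := by
  rw [← integral_mul_exp_sub, evol, setIntegral_Ioi_split (hH.integrableOn hφ h0 t x) ht,
    setIntegral_eq_zero_of_forall_eq_zero (t := Set.Ioi t), add_zero,
    intervalIntegral.integral_of_le ht, intervalIntegral.integral_of_le ht]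
  · refine setIntegral_mono_on ((hH.integrableOn hφ h0 t x).mono_set Set.Ioc_subset_Ioi_self)
      ?_ measurableSet_Ioc fun s _ => ?_
    · exact (Continuous.integrableOn_Icc (by fun_prop)).mono_set Set.Ioc_subset_Icc_self
    · exact hH.le _ _ _ (hφ.slice _) (h0 _) (hC _)
  · intro s hs
    refine hH.zero fun z => hφ.zero_of_neg _ ?_ z
    have : t < s := hs
    linarith

/-- A nonnegative bounded Borel source term, vanishing at negative times. -/
structure IsSource (F : ℝ → PosReal → ℝ) (C : ℝ) : Prop where
  measurable : Measurable (Function.uncurry F)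
  nonneg : ∀ t x, 0 ≤ F t x
  zero_of_neg : ∀ t < 0, ∀ x, F t x = 0
  le : ∀ t x, F t x ≤ C

variable {F : ℝ → PosReal → ℝ} {C : ℝ}

lemma isPath_of_le_exp (hκ : 0 ≤ κ) (hC : 0 ≤ C) {φ : ℝ → PosReal → ℝ}
    (hm : Measurable (Function.uncurry φ)) (h0 : ∀ t x, 0 ≤ φ t x) (hz : ∀ t < 0, ∀ x, φ t x = 0)
    (hle : ∀ t x, φ t x ≤ C * Real.exp (κ * t)) : IsPath φ where
  measurable := hm
  zero_of_neg := hz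
  locBdd T := ⟨C * Real.exp (κ * T), fun t ht x => by
    rw [abs_of_nonneg (h0 t x)]
    exact (hle t x).trans (by gcongr)⟩

lemma IsSource.const_nonneg (hF : IsSource F C) : 0 ≤ C :=
  (hF.nonneg 0 ⟨1, Set.mem_Ioi.2 one_pos⟩).trans (hF.le 0 _)

/-- Measurability, sign, vanishing at negative times and the exponential bound have to be carried
through the induction together, because the next iterate is well behaved only when the previous one
is a path. -/
lemma Admissible.picard_spec (hH : Admissible G κ H) (hκ : 0 ≤ κ) (hF : IsSource F C) (n : ℕ) :
    IsPath (picard H F n) ∧ (∀ t x, 0 ≤ picard H F n t x) ∧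
      ∀ t x, picard H F n t x ≤ C * Real.exp (κ * t) := by
  have hC := hF.const_nonneg
  suffices h : Measurable (Function.uncurry (picard H F n)) ∧ (∀ t x, 0 ≤ picard H F n t x) ∧
      (∀ t < 0, ∀ x, picard H F n t x = 0) ∧ ∀ t x, picard H F n t x ≤ C * Real.exp (κ * t) from
    ⟨isPath_of_le_exp hκ hC h.1 h.2.1 h.2.2.1 h.2.2.2, h.2.1, h.2.2.2⟩
  induction n with
  | zero => exact ⟨measurable_const, fun _ _ => le_rfl, fun _ _ _ => rfl, fun _ _ => by
      simp only [picard]; positivity⟩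
  | succ n ih =>
    have hp : IsPath (picard H F n) := isPath_of_le_exp hκ hC ih.1 ih.2.1 ih.2.2.1 ih.2.2.2
    have hz : ∀ t < 0, ∀ x, picard H F (n + 1) t x = 0 := fun t ht x => by
      simp only [picard]
      rw [hF.zero_of_neg t ht, hH.evol_of_neg hp ht, add_zero]
    refine ⟨?_, fun t x => add_nonneg (hF.nonneg t x) (hH.evol_nonneg ih.2.1 t x), hz,
      fun t x => ?_⟩
    · exact hF.measurable.add (hH.measurable_evol hp ih.2.1)
    · rcases lt_or_ge t 0 with ht | ht
      · rw [hz t ht]; positivity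
      · have h1 := hH.evol_le_exp hp ih.2.1 ih.2.2.2 ht x
        have h2 := hF.le t x
        simp only [picard]
        linarith

lemma Admissible.picard_le_succ (hH : Admissible G κ H) (hκ : 0 ≤ κ) (hF : IsSource F C) (n : ℕ)
    (t : ℝ) (x : PosReal) : picard H F n t x ≤ picard H F (n + 1) t x := by
  induction n generalizing t x with
  | zero => exact (hH.picard_spec hκ hF 1).2.1 t x
  | succ n ih =>
    have h1 := hH.picard_spec hκ hF n
    have h2 := hH.picard_spec hκ hF (n + 1)
    have := hH.evol_mono h1.1 h2.1 h1.2.1 ih t x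
    show F t x + evol H (picard H F n) t x ≤ F t x + evol H (picard H F (n + 1)) t x
    linarith

lemma Admissible.tendsto_picard (hH : Admissible G κ H) (hκ : 0 ≤ κ) (hF : IsSource F C)
    (t : ℝ) (x : PosReal) :
    Tendsto (fun n => picard H F n t x) atTop (𝓝 (minSol H F t x)) := by
  refine tendsto_atTop_ciSup (monotone_nat_of_le_succ fun n => hH.picard_le_succ hκ hF n t x) ?_
  refine ⟨C * Real.exp (κ * t), ?_⟩
  rintro _ ⟨n, rfl⟩
  exact (hH.picard_spec hκ hF n).2.2 t x

/-- `U` is a nonnegative path solving `U = F + evol H U`. -/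
structure IsSol (H : ℝ → (PosReal → ℝ) → ℝ) (F U : ℝ → PosReal → ℝ) : Prop where
  path : IsPath U
  nonneg : ∀ t x, 0 ≤ U t x
  eqn : ∀ t x, U t x = F t x + evol H U t x

/-- The iterates increase and stay below `C exp(κ t)`, so they converge pointwise. Bounded
continuity of the mechanism and dominated convergence over the finite range of `s` pass the limit
through `evol`. -/
lemma Admissible.minSol_isSol (hH : Admissible G κ H) (hκ : 0 ≤ κ) (hF : IsSource F C) :
    IsSol H F (minSol H F) := by
  have hC := hF.const_nonneg
  have hlim := hH.tendsto_picard hκ hF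
  have hle : ∀ t x, minSol H F t x ≤ C * Real.exp (κ * t) := fun t x =>
    le_of_tendsto' (hlim t x) fun n => (hH.picard_spec hκ hF n).2.2 t x
  have h0 : ∀ t x, 0 ≤ minSol H F t x := fun t x =>
    ge_of_tendsto' (hlim t x) fun n => (hH.picard_spec hκ hF n).2.1 t x
  have hm : Measurable (Function.uncurry (minSol H F)) := by
    refine measurable_of_tendsto_metrizable
      (f := fun n => Function.uncurry (picard H F n))
      (fun n => (hH.picard_spec hκ hF n).1.measurable) ?_
    rw [tendsto_pi_nhds]
    exact fun q => hlim q.1 q.2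
  have hz : ∀ t < 0, ∀ x, minSol H F t x = 0 := fun t ht x => by
    refine tendsto_nhds_unique (hlim t x) ?_
    simp_rw [(hH.picard_spec hκ hF _).1.zero_of_neg t ht x]
    exact tendsto_const_nhds
  have hp := isPath_of_le_exp hκ hC hm h0 hz hle
  refine ⟨hp, h0, fun t x => ?_⟩
  refine tendsto_nhds_unique ((tendsto_add_atTop_iff_nat 1).2 (hlim t x)) ?_
  refine Tendsto.const_add (F t x) ?_
  refine tendsto_integral_of_dominated_convergence
    (fun s => (Set.Ico 0 (x : ℝ)).indicator (fun _ => κ * (C * Real.exp (κ * t))) s)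
    (fun n => (hH.measurable_integrand (hH.picard_spec hκ hF n).1
      (hH.picard_spec hκ hF n).2.1 t x).aestronglyMeasurable)
    (integrableOn_indicator_const _ _) (fun n => ?_) (ae_of_all _ fun s => ?_)
  · refine (ae_restrict_iff' measurableSet_Ioi).2 (ae_of_all _ fun s hs => ?_)
    have h := hH.picard_spec hκ hF n
    rw [Real.norm_of_nonneg (hH.nonneg _ _ (h.2.1 _))]
    refine hH.integrand_le_indicator h.1 h.2.1 (fun r hr x => (h.2.2 r x).trans ?_) x (le_of_lt hs)
    gcongr
  · exact hH.tendsto _ _ _ _ (fun n => (hH.picard_spec hκ hF n).1.slice _)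
      (fun n => (hH.picard_spec hκ hF n).2.1 _) (fun n => (hH.picard_spec hκ hF n).2.2 _)
      (fun z => hlim _ z)

/-- Causality: `s` ranges over `s > 0`, so `evol` at time `t` sees strictly earlier times only. The
strictness allows an impulse released at time `t` to leave `evol` at `t` unchanged. -/
lemma evol_congr {φ ψ : ℝ → PosReal → ℝ} {t : ℝ} (h : ∀ r < t, φ r = ψ r) (x : PosReal) :
    evol H φ t x = evol H ψ t x := by
  refine setIntegral_congr_fun measurableSet_Ioi fun s hs => ?_
  have : (0 : ℝ) < s := hs
  simp only [h (t - s) (by linarith)]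

lemma picard_congr {F' : ℝ → PosReal → ℝ} {τ : ℝ} (h : ∀ t < τ, F t = F' t) (n : ℕ) :
    ∀ t < τ, picard H F n t = picard H F' n t := by
  induction n with
  | zero => exact fun _ _ => rfl
  | succ n ih =>
    intro t ht
    funext x
    simp only [picard]
    rw [h t ht, evol_congr fun r hr => ih r (hr.trans ht)]

/-- Causality passes to every Picard iterate and hence to their supremum, without any appeal to
uniqueness for the nonlinear equation. -/
lemma minSol_congr {F' : ℝ → PosReal → ℝ} {τ : ℝ} (h : ∀ t < τ, F t = F' t) {t : ℝ} (ht : t < τ) :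
    minSol H F t = minSol H F' t := by
  funext x
  simp only [minSol]
  exact iSup_congr fun n => by rw [picard_congr h n t ht]

/-- Restarting the equation at time `τ`. -/
lemma IsSol.restart (hH : Admissible G κ H) {U : ℝ → PosReal → ℝ} (hU : IsSol H F U) {τ : ℝ}
    (hF : ∀ t, 0 ≤ t → ∀ x : PosReal, F (τ + t) x = zeroExt (F τ) (x - t)) {t : ℝ} (ht : 0 ≤ t)
    (x : PosReal) :
    U (τ + t) x = zeroExt (U τ) (x - t) + ∫ s in (0 : ℝ)..t, H (x - s) (U (τ + t - s)) := by
  have hi := hH.integrableOn hU.path hU.nonneg (τ + t) x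
  rw [hU.eqn, evol, setIntegral_Ioi_split hi ht, hF t ht x]
  -- The part of the history before `τ` is the `evol` term at time `τ` for an individual with
  -- remaining life `x - t`; together with the transported source it rebuilds `U τ` there.
  have hshift : ∫ s in Set.Ioi t, H (x - s) (U (τ + t - s)) =
      ∫ s in Set.Ioi (0 : ℝ), H (x - t - s) (U (τ - s)) := by
    rw [setIntegral_Ioi_shift]
    refine integral_congr_ae (ae_of_all _ fun s => ?_)
    simp only [show (x : ℝ) - (s + t) = x - t - s by ring, show τ + t - (s + t) = τ - s by ring]
  rw [hshift]
  -- If `x ≤ t`, the individual present at time `τ` is dead by `τ + t`, and both the transported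
  -- term and the older history vanish.
  rcases lt_or_ge 0 ((x : ℝ) - t) with hx | hx
  · rw [zeroExt_of_pos _ hx, zeroExt_of_pos _ hx, hU.eqn τ, evol]
    ring
  · rw [zeroExt_of_nonpos _ hx, zeroExt_of_nonpos _ hx, setIntegral_eq_zero_of_forall_eq_zero
      (t := Set.Ioi (0 : ℝ))]
    · ring
    · intro s hs
      have : (0 : ℝ) < s := hs
      exact hH.zero_of_nonpos _ (by linarith) _

end Evolution

/-! ### Paths -/

lemma IsPath.sub {φ ψ : ℝ → PosReal → ℝ} (hφ : IsPath φ) (hψ : IsPath ψ) :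
    IsPath (fun t x => φ t x - ψ t x) where
  measurable := hφ.measurable.sub hψ.measurable
  zero_of_neg t ht x := by rw [hφ.zero_of_neg t ht, hψ.zero_of_neg t ht, sub_zero]
  locBdd T := by
    obtain ⟨C, hC⟩ := hφ.locBdd T
    obtain ⟨D, hD⟩ := hψ.locBdd T
    exact ⟨C + D, fun t ht x => (abs_sub _ _).trans (add_le_add (hC t ht x) (hD t ht x))⟩

lemma IsPath.const_mul {φ : ℝ → PosReal → ℝ} (hφ : IsPath φ) (c : ℝ) :
    IsPath (fun t x => c * φ t x) where
  measurable := hφ.measurable.const_mul c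
  zero_of_neg t ht x := by rw [hφ.zero_of_neg t ht, mul_zero]
  locBdd T := by
    obtain ⟨C, hC⟩ := hφ.locBdd T
    exact ⟨|c| * C, fun t ht x => by
      rw [abs_mul]
      exact mul_le_mul_of_nonneg_left (hC t ht x) (abs_nonneg c)⟩

lemma IsPath.shift {φ : ℝ → PosReal → ℝ} (hφ : IsPath φ) {a : ℝ} (ha : 0 ≤ a) :
    IsPath (fun t x => φ (t - a) x) where
  measurable := hφ.measurable.comp
    ((measurable_fst.sub measurable_const).prodMk measurable_snd)
  zero_of_neg t ht x := hφ.zero_of_neg _ (by linarith) x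
  locBdd T := by
    obtain ⟨C, hC⟩ := hφ.locBdd T
    exact ⟨C, fun t ht x => hC _ (by linarith) x⟩

lemma isPath_zero : IsPath (fun _ _ => 0) where
  measurable := measurable_const
  zero_of_neg _ _ _ := rfl
  locBdd _ := ⟨0, fun _ _ _ => by simp⟩

lemma IsPath.add {φ ψ : ℝ → PosReal → ℝ} (hφ : IsPath φ) (hψ : IsPath ψ) :
    IsPath (fun t x => φ t x + ψ t x) where
  measurable := hφ.measurable.add hψ.measurable
  zero_of_neg t ht x := by rw [hφ.zero_of_neg t ht, hψ.zero_of_neg t ht, add_zero]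
  locBdd T := by
    obtain ⟨C, hC⟩ := hφ.locBdd T
    obtain ⟨D, hD⟩ := hψ.locBdd T
    exact ⟨C + D, fun t ht x => (abs_add_le _ _).trans (add_le_add (hC t ht x) (hD t ht x))⟩

lemma IsPath.finset_sum {ι : Type*} (s : Finset ι) {φ : ι → ℝ → PosReal → ℝ}
    (hφ : ∀ i, IsPath (φ i)) : IsPath (fun t x => ∑ i ∈ s, φ i t x) := by
  classical
  induction s using Finset.induction_on with
  | empty => simpa using isPath_zero
  | insert i s hi ih => simpa [Finset.sum_insert hi] using (hφ i).add ih

lemma IsPath.integrable {φ : ℝ → PosReal → ℝ} (hφ : IsPath φ) (t : ℝ) (ν : Measure PosReal)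
    [IsFiniteMeasure ν] : Integrable (φ t) ν := by
  obtain ⟨C, hC⟩ := hφ.locBdd t
  exact Integrable.of_bound (hφ.slice t).aestronglyMeasurable C (ae_of_all _ fun x => hC t le_rfl x)

/-! ### The linear equation -/

/-- The linear mechanism `k(y)⟨G,φ⟩`. -/
noncomputable def linH (G : Measure PosReal) (k : PosReal → ℝ) (y : ℝ) (φ : PosReal → ℝ) : ℝ :=
  zeroExt k y * ∫ z, φ z ∂G

/-- `K(x) = ∫₀ˣ k(x-s) ds`. -/
noncomputable def potK (k : PosReal → ℝ) (x : PosReal) : ℝ :=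
  ∫ s in Set.Ioi (0 : ℝ), zeroExt k (x - s)

/-- A bounded reproduction rate `k` and a lifetime law `G` with second moment for which the
reproduction mean `⟨G,K⟩` is less than `1`. -/
structure Subcrit (G : Measure PosReal) (k : PosReal → ℝ) (κ : ℝ) : Prop where
  measurable : Measurable k
  nonneg : ∀ x, 0 ≤ k x
  le : ∀ x, k x ≤ κ
  lt_one : ∫⁻ x, (∫⁻ s in Set.Ioi (0 : ℝ), ENNReal.ofReal (zeroExt k (x - s))) ∂G < 1
  sq_integrable : Integrable (fun x : PosReal => (x : ℝ) ^ 2) G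

section Linear

variable {G : Measure PosReal} [IsProbabilityMeasure G] {k : PosReal → ℝ} {κ : ℝ}

lemma Subcrit.bound_nonneg (hk : Subcrit G k κ) : 0 ≤ κ :=
  (hk.nonneg ⟨1, Set.mem_Ioi.2 one_pos⟩).trans (hk.le _)

lemma Subcrit.integrable_coe (hk : Subcrit G k κ) : Integrable (fun x : PosReal => (x : ℝ)) G := by
  refine Integrable.mono' (hk.sq_integrable.add (integrable_const 1))
    measurable_subtype_coe.aestronglyMeasurable (ae_of_all _ fun x => ?_)
  have : (0 : ℝ) < x := x.2
  rw [Real.norm_of_nonneg this.le]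
  simp only [Pi.add_apply]
  nlinarith [sq_nonneg ((x : ℝ) - 1)]

lemma zeroExt_sub_le_indicator {h : PosReal → ℝ} {C : ℝ} (hh : ∀ x, h x ≤ C) (y : ℝ) {s : ℝ}
    (hs : 0 ≤ s) : zeroExt h (y - s) ≤ (Set.Ico 0 y).indicator (fun _ => C) s := by
  by_cases hsy : s < y
  · rw [Set.indicator_of_mem (Set.mem_Ico.2 ⟨hs, hsy⟩), zeroExt_of_pos _ (sub_pos.2 hsy)]
    exact hh _
  · rw [zeroExt_of_nonpos _ (by linarith), Set.indicator_of_notMem (by simp [hsy])]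

lemma abs_zeroExt_sub_le_indicator {h : PosReal → ℝ} {C : ℝ} (hh : ∀ x, |h x| ≤ C) (y : ℝ) {s : ℝ}
    (hs : 0 ≤ s) : |zeroExt h (y - s)| ≤ (Set.Ico 0 y).indicator (fun _ => C) s := by
  by_cases hsy : s < y
  · rw [Set.indicator_of_mem (Set.mem_Ico.2 ⟨hs, hsy⟩), zeroExt_of_pos _ (sub_pos.2 hsy)]
    exact hh _
  · rw [zeroExt_of_nonpos _ (by linarith), Set.indicator_of_notMem (by simp [hsy]), abs_zero]

lemma setIntegral_indicator_Ico {y : ℝ} (hy : 0 ≤ y) (c : ℝ) :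
    ∫ s in Set.Ioi (0 : ℝ), (Set.Ico 0 y).indicator (fun _ => c) s = c * y := by
  rw [setIntegral_indicator measurableSet_Ico]
  have : Set.Ioi (0 : ℝ) ∩ Set.Ico 0 y = Set.Ioo 0 y := by
    ext s; simp only [Set.mem_inter_iff, Set.mem_Ioi, Set.mem_Ico, Set.mem_Ioo]
    constructor
    · exact fun h => ⟨h.1, h.2.2⟩
    · exact fun h => ⟨h.1, h.1.le, h.2⟩
  rw [this]
  simp [hy, mul_comm]

lemma integrableOn_zeroExt_sub {h : PosReal → ℝ} (hm : Measurable h) {C : ℝ}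
    (hh : ∀ x, |h x| ≤ C) (y : ℝ) :
    IntegrableOn (fun s => zeroExt h (y - s)) (Set.Ioi (0 : ℝ)) := by
  refine Integrable.mono' (integrableOn_indicator_const y C)
    ((measurable_zeroExt hm).comp (measurable_const.sub measurable_id)).aestronglyMeasurable ?_
  exact (ae_restrict_iff' measurableSet_Ioi).2 (ae_of_all _ fun s hs =>
    abs_zeroExt_sub_le_indicator hh y (le_of_lt hs))

lemma Subcrit.abs_le (hk : Subcrit G k κ) (x : PosReal) : |k x| ≤ κ := by
  rw [abs_of_nonneg (hk.nonneg x)]; exact hk.le x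

lemma Subcrit.potK_nonneg (hk : Subcrit G k κ) (x : PosReal) : 0 ≤ potK k x :=
  integral_nonneg fun _ => zeroExt_nonneg hk.nonneg _

lemma Subcrit.potK_le (hk : Subcrit G k κ) (x : PosReal) : potK k x ≤ κ * x := by
  have hx : (0 : ℝ) < x := x.2
  rw [← setIntegral_indicator_Ico hx.le κ, potK]
  exact setIntegral_mono_on (integrableOn_zeroExt_sub hk.measurable hk.abs_le x)
    (integrableOn_indicator_const _ _) measurableSet_Ioi fun s hs =>
      zeroExt_sub_le_indicator hk.le x (le_of_lt hs)

lemma measurable_zeroExt_sub (hm : Measurable k) :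
    Measurable (fun q : PosReal × ℝ => zeroExt k (q.1 - q.2)) :=
  (measurable_zeroExt hm).comp ((measurable_subtype_coe.comp measurable_fst).sub measurable_snd)

lemma Subcrit.measurable_potK (hk : Subcrit G k κ) : Measurable (potK k) :=
  ((measurable_zeroExt_sub hk.measurable).stronglyMeasurable.integral_prod_right'
    (ν := volume.restrict (Set.Ioi (0 : ℝ)))).measurable

lemma Subcrit.integrable_potK (hk : Subcrit G k κ) : Integrable (potK k) G := by
  refine Integrable.mono' (hk.integrable_coe.const_mul κ)
    hk.measurable_potK.aestronglyMeasurable (ae_of_all _ fun x => ?_)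
  rw [Real.norm_of_nonneg (hk.potK_nonneg x)]
  exact hk.potK_le x

lemma Subcrit.ofReal_potK (hk : Subcrit G k κ) (x : PosReal) :
    ENNReal.ofReal (potK k x) = ∫⁻ s in Set.Ioi (0 : ℝ), ENNReal.ofReal (zeroExt k (x - s)) :=
  ofReal_integral_eq_lintegral_ofReal (integrableOn_zeroExt_sub hk.measurable hk.abs_le x)
    (ae_of_all _ fun _ => zeroExt_nonneg hk.nonneg _)

lemma Subcrit.integral_potK_nonneg (hk : Subcrit G k κ) : 0 ≤ ∫ x, potK k x ∂G :=
  integral_nonneg hk.potK_nonneg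

lemma Subcrit.integral_potK_lt_one (hk : Subcrit G k κ) : ∫ x, potK k x ∂G < 1 := by
  have h := hk.lt_one
  simp_rw [← hk.ofReal_potK] at h
  rw [← ofReal_integral_eq_lintegral_ofReal hk.integrable_potK (ae_of_all _ hk.potK_nonneg)] at h
  simpa using h

lemma measurable_integral_slice {φ : ℝ → PosReal → ℝ} (hφ : Measurable (Function.uncurry φ)) :
    Measurable (fun t => ∫ z, φ t z ∂G) :=
  (hφ.stronglyMeasurable.integral_prod_right' (ν := G)).measurable

lemma IsPath.abs_integral_le {φ : ℝ → PosReal → ℝ} {t C : ℝ} (hC : ∀ x, |φ t x| ≤ C) :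
    |∫ z, φ t z ∂G| ≤ C := by
  have := norm_integral_le_of_norm_le_const (μ := G) (f := φ t) (C := C) (ae_of_all _ hC)
  simpa using this

lemma Subcrit.admissible (hk : Subcrit G k κ) : Admissible G κ (linH G k) where
  zero_of_nonpos y hy φ := by rw [linH, zeroExt_of_nonpos _ hy, zero_mul]
  nonneg y φ h := mul_nonneg (zeroExt_nonneg hk.nonneg y) (integral_nonneg h)
  mono y φ ψ hφ hψ h0 hle hC := by
    obtain ⟨C, hC⟩ := hC
    refine mul_le_mul_of_nonneg_left ?_ (zeroExt_nonneg hk.nonneg y)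
    refine integral_mono ?_ ?_ hle
    · exact Integrable.of_bound hφ.aestronglyMeasurable C (ae_of_all _ fun x => by
        rw [Real.norm_of_nonneg (h0 x)]; exact (hle x).trans (hC x))
    · exact Integrable.of_bound hψ.aestronglyMeasurable C (ae_of_all _ fun x => by
        rw [Real.norm_of_nonneg ((h0 x).trans (hle x))]; exact hC x)
  le y φ C hφ h0 hC := by
    refine mul_le_mul (zeroExt_le hk.bound_nonneg hk.le y) ?_ (integral_nonneg h0) hk.bound_nonneg
    have := norm_integral_le_of_norm_le_const (μ := G) (f := φ) (C := C) (ae_of_all _ fun x => by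
      rw [Real.norm_of_nonneg (h0 x)]; exact hC x)
    simpa using (le_abs_self _).trans this
  tendsto y φ ψ C hφ h0 hC hlim := by
    refine Tendsto.const_mul _ (tendsto_integral_of_dominated_convergence (fun _ => C)
      (fun n => (hφ n).aestronglyMeasurable) (integrable_const C) (fun n => ae_of_all _ fun x => ?_)
      (ae_of_all _ hlim))
    rw [Real.norm_of_nonneg (h0 n x)]; exact hC n x
  meas φ hφ _ := ((measurable_zeroExt hk.measurable).comp measurable_fst).mul
    ((measurable_integral_slice hφ).comp measurable_snd)

lemma Subcrit.integrableOn_lin (hk : Subcrit G k κ) {φ : ℝ → PosReal → ℝ} (hφ : IsPath φ)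
    (t : ℝ) (x : ℝ) : IntegrableOn (fun s => linH G k (x - s) (φ (t - s))) (Set.Ioi 0) := by
  obtain ⟨C, hC⟩ := hφ.locBdd t
  have hC0 : 0 ≤ C := (abs_nonneg _).trans (hC t le_rfl ⟨1, Set.mem_Ioi.2 one_pos⟩)
  refine Integrable.mono' (integrableOn_indicator_const x (κ * C)) ?_ ?_
  · exact (((measurable_zeroExt hk.measurable).comp (measurable_const.sub measurable_id)).mul
      ((measurable_integral_slice hφ.measurable).comp
        (measurable_const.sub measurable_id))).aestronglyMeasurable
  · refine (ae_restrict_iff' measurableSet_Ioi).2 (ae_of_all _ fun s hs => ?_)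
    have hs' : (0 : ℝ) < s := hs
    rw [linH, norm_mul]
    have h1 := abs_zeroExt_sub_le_indicator hk.abs_le x hs'.le
    have h2 := IsPath.abs_integral_le (G := G) (hC (t - s) (by linarith))
    calc |zeroExt k (x - s)| * |∫ z, φ (t - s) z ∂G|
        ≤ (Set.Ico 0 x).indicator (fun _ => κ) s * C :=
          mul_le_mul h1 h2 (abs_nonneg _) ((abs_nonneg _).trans h1)
      _ = _ := by
          by_cases h : s ∈ Set.Ico 0 x
          · simp [h]
          · simp [h]

lemma Subcrit.evol_sub (hk : Subcrit G k κ) {φ ψ : ℝ → PosReal → ℝ} (hφ : IsPath φ)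
    (hψ : IsPath ψ) (t : ℝ) (x : PosReal) :
    evol (linH G k) (fun t x => φ t x - ψ t x) t x =
      evol (linH G k) φ t x - evol (linH G k) ψ t x := by
  rw [evol, evol, evol, ← integral_sub (hk.integrableOn_lin hφ t x) (hk.integrableOn_lin hψ t x)]
  refine integral_congr_ae (ae_of_all _ fun s => ?_)
  simp only [linH]
  rw [integral_sub (hφ.integrable _ _) (hψ.integrable _ _), mul_sub]

lemma evol_const_mul (φ : ℝ → PosReal → ℝ) (c t : ℝ) (x : PosReal) :
    evol (linH G k) (fun t x => c * φ t x) t x = c * evol (linH G k) φ t x := by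
  rw [evol, evol, ← integral_const_mul]
  refine integral_congr_ae (ae_of_all _ fun s => ?_)
  simp only [linH]
  rw [integral_const_mul]
  ring

lemma evol_shift (H : ℝ → (PosReal → ℝ) → ℝ) (φ : ℝ → PosReal → ℝ) (a t : ℝ) (x : PosReal) :
    evol H (fun t x => φ (t - a) x) t x = evol H φ (t - a) x := by
  rw [evol, evol]
  refine integral_congr_ae (ae_of_all _ fun s => ?_)
  simp only [show t - s - a = t - a - s by ring]

lemma Subcrit.evol_finset_sum (hk : Subcrit G k κ) {ι : Type*} (s : Finset ι)
    {φ : ι → ℝ → PosReal → ℝ} (hφ : ∀ i, IsPath (φ i)) (t : ℝ) (x : PosReal) :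
    evol (linH G k) (fun t x => ∑ i ∈ s, φ i t x) t x = ∑ i ∈ s, evol (linH G k) (φ i) t x := by
  simp only [evol]
  rw [← integral_finsetSum s fun i _ => hk.integrableOn_lin (hφ i) t x]
  refine integral_congr_ae (ae_of_all _ fun r => ?_)
  simp only [linH]
  rw [integral_finsetSum s fun i _ => (hφ i).integrable _ _, Finset.mul_sum]

/-- Comparison principle for the linear equation. -/
lemma Subcrit.comparison (hk : Subcrit G k κ) {d : ℝ → PosReal → ℝ} (hd : IsPath d)
    {c : PosReal → ℝ} (hc : Integrable c G) (hc0 : ∀ x, 0 ≤ c x)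
    (h : ∀ t, 0 ≤ t → ∀ x, d t x ≤ c x + evol (linH G k) d t x) (t : ℝ) (x : PosReal) :
    d t x ≤ c x + potK k x * ((∫ z, c z ∂G) / (1 - ∫ z, potK k z ∂G)) := by
  have hρ := hk.integral_potK_lt_one
  have hcG : 0 ≤ ∫ z, c z ∂G := integral_nonneg hc0
  rcases lt_or_ge t 0 with ht | ht
  · rw [hd.zero_of_neg t ht]
    exact add_nonneg (hc0 x) (mul_nonneg (hk.potK_nonneg x) (div_nonneg hcG (by linarith)))
  obtain ⟨C, hC⟩ := hd.locBdd t
  -- The unknown is reduced to one number, the supremum of `⟨G, d_r⟩` over all `r ≤ t`. It is finite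
  -- because `d` is locally bounded, which is what permits absorption below.
  set S : Set ℝ := {b | ∃ r, r ≤ t ∧ b = ∫ z, d r z ∂G} with hS
  have hbdd : BddAbove S := ⟨C, by
    rintro _ ⟨r, hr, rfl⟩
    exact (le_abs_self _).trans (IsPath.abs_integral_le (hC r hr))⟩
  have hle : ∀ r ≤ t, ∫ z, d r z ∂G ≤ sSup S := fun r hr => le_csSup hbdd ⟨r, hr, rfl⟩
  have hne : S.Nonempty := ⟨_, t, le_rfl, rfl⟩
  have hB0 : 0 ≤ sSup S := by
    -- Negative times belong to the range and give the value `0`, so the supremum is nonnegative.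
    refine le_trans (le_of_eq ?_) (hle (-1) (by linarith))
    simp [hd.zero_of_neg (-1) (by norm_num)]
  have key : ∀ r, 0 ≤ r → r ≤ t → ∀ x, d r x ≤ c x + potK k x * sSup S := by
    intro r hr0 hr x
    refine (h r hr0 x).trans (add_le_add le_rfl ?_)
    rw [potK, ← integral_mul_const, evol]
    refine setIntegral_mono_on (hk.integrableOn_lin hd r x)
      ((integrableOn_zeroExt_sub hk.measurable hk.abs_le x).mul_const _) measurableSet_Ioi
      fun s hs => ?_
    have hs' : (0 : ℝ) < s := hs
    exact mul_le_mul_of_nonneg_left (hle _ (by linarith)) (zeroExt_nonneg hk.nonneg _)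
  -- Integrating the pointwise bound against `G` closes the loop: `sup ≤ ⟨G,c⟩ + ρ sup` with `ρ =
  -- ⟨G,K⟩ < 1`.
  have hsup : sSup S ≤ (∫ z, c z ∂G) + (∫ z, potK k z ∂G) * sSup S := by
    refine csSup_le hne ?_
    rintro _ ⟨r, hr, rfl⟩
    rcases lt_or_ge r 0 with hr0 | hr0
    · simp_rw [hd.zero_of_neg r hr0]
      rw [integral_zero]
      exact add_nonneg hcG (mul_nonneg hk.integral_potK_nonneg hB0)
    · rw [← integral_mul_const, ← integral_add hc (hk.integrable_potK.mul_const _)]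
      exact integral_mono (hd.integrable r G) (hc.add (hk.integrable_potK.mul_const _))
        (key r hr0 hr)
  have hsup' : sSup S ≤ (∫ z, c z ∂G) / (1 - ∫ z, potK k z ∂G) := by
    rw [le_div_iff₀ (by linarith)]
    linarith
  refine (key t ht le_rfl x).trans (add_le_add le_rfl ?_)
  exact mul_le_mul_of_nonneg_left hsup' (hk.potK_nonneg x)

/-- The case `c = 0` of the comparison. Applied to differences of solutions it gives uniqueness and
ordering. -/
lemma Subcrit.nonpos_of_le_evol (hk : Subcrit G k κ) {d : ℝ → PosReal → ℝ} (hd : IsPath d)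
    (h : ∀ t, 0 ≤ t → ∀ x, d t x ≤ evol (linH G k) d t x) (t : ℝ) (x : PosReal) : d t x ≤ 0 := by
  have := hk.comparison hd (c := fun _ => 0) (integrable_zero _ _ _) (fun _ => le_rfl)
    (fun t ht x => by simpa using h t ht x) t x
  simpa using this

end Linear

/-! ### The mean equation -/

/-- The source term `f(x-t)`, switched on at time `0`. -/
noncomputable def impulse (f : PosReal → ℝ) (t : ℝ) (x : PosReal) : ℝ :=
  if 0 ≤ t then zeroExt f (x - t) else 0

/-- Extension by `0` to negative times. -/
noncomputable def extendTime (u : ℝ≥0 → PosReal → ℝ) (t : ℝ) (x : PosReal) : ℝ :=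
  if 0 ≤ t then u t.toNNReal x else 0

lemma impulse_of_nonneg (f : PosReal → ℝ) {t : ℝ} (ht : 0 ≤ t) (x : PosReal) :
    impulse f t x = zeroExt f (x - t) := if_pos ht

lemma impulse_of_neg (f : PosReal → ℝ) {t : ℝ} (ht : t < 0) (x : PosReal) :
    impulse f t x = 0 := if_neg (not_le.2 ht)

lemma impulse_nonneg {f : PosReal → ℝ} (hf : ∀ x, 0 ≤ f x) (t : ℝ) (x : PosReal) :
    0 ≤ impulse f t x := by
  unfold impulse
  split_ifs
  · exact zeroExt_nonneg hf _
  · exact le_rfl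

lemma measurable_impulse {f : PosReal → ℝ} (hf : Measurable f) :
    Measurable (Function.uncurry (impulse f)) :=
  Measurable.ite (measurableSet_Ici.preimage measurable_fst)
    ((measurable_zeroExt hf).comp ((measurable_subtype_coe.comp measurable_snd).sub measurable_fst))
    measurable_const

lemma impulse_isSource {f : PosReal → ℝ} {C : ℝ} (hf : Measurable f) (h0 : ∀ x, 0 ≤ f x)
    (hC : ∀ x, f x ≤ C) : IsSource (impulse f) C where
  measurable := measurable_impulse hf
  nonneg := impulse_nonneg h0
  zero_of_neg t ht x := impulse_of_neg f ht x
  le t x := by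
    have hC0 : 0 ≤ C := (h0 ⟨1, Set.mem_Ioi.2 one_pos⟩).trans (hC _)
    unfold impulse
    split_ifs
    · exact zeroExt_le hC0 hC _
    · exact hC0

lemma extendTime_isPath {u : ℝ≥0 → PosReal → ℝ} (hm : Measurable (Function.uncurry u))
    (hb : ∀ T : ℝ≥0, ∃ C : ℝ, ∀ t ≤ T, ∀ x, |u t x| ≤ C) : IsPath (extendTime u) where
  measurable := Measurable.ite (measurableSet_Ici.preimage measurable_fst)
    (hm.comp ((measurable_real_toNNReal.comp measurable_fst).prodMk measurable_snd))
    measurable_const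
  zero_of_neg t ht x := if_neg (not_le.2 ht)
  locBdd T := by
    obtain ⟨C, hC⟩ := hb T.toNNReal
    refine ⟨C, fun t ht x => ?_⟩
    unfold extendTime
    split_ifs
    · exact hC _ (Real.toNNReal_le_toNNReal ht) x
    · simpa using (abs_nonneg _).trans (hC 0 zero_le x)

lemma sub_toNNReal (t : ℝ≥0) {s : ℝ} (hs : 0 ≤ s) : t - s.toNNReal = ((t : ℝ) - s).toNNReal := by
  rw [NNReal.sub_def, Real.coe_toNNReal _ hs]

lemma evol_eq_intervalIntegral {H : ℝ → (PosReal → ℝ) → ℝ} {φ : ℝ → PosReal → ℝ}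
    (hH : ∀ y φ, (∀ x, φ x = 0) → H y φ = 0) (hφ : ∀ t < 0, ∀ x, φ t x = 0) {t : ℝ} {x : PosReal}
    (hi : IntegrableOn (fun s : ℝ => H (x - s) (φ (t - s))) (Set.Ioi 0)) (ht : 0 ≤ t) :
    evol H φ t x = ∫ s in (0 : ℝ)..t, H (x - s) (φ (t - s)) := by
  rw [evol, setIntegral_Ioi_split hi ht, setIntegral_eq_zero_of_forall_eq_zero (t := Set.Ioi t),
    add_zero]
  intro s hs
  have : t < s := hs
  exact hH _ _ fun z => hφ _ (by linarith) z

lemma linH_zero (G : Measure PosReal) (k : PosReal → ℝ) (y : ℝ) (φ : PosReal → ℝ)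
    (hφ : ∀ x, φ x = 0) : linH G k y φ = 0 := by
  simp [linH, hφ]

/-- A path solving `π_t = f(·-t) + ∫ k(·-s)⟨G,π_{t-s}⟩ ds`. -/
structure IsMeanPath (G : Measure PosReal) (k f : PosReal → ℝ) (π : ℝ → PosReal → ℝ) : Prop where
  path : IsPath π
  eqn : ∀ t x, π t x = impulse f t x + evol (linH G k) π t x

section Mean

variable {G : Measure PosReal} [IsProbabilityMeasure G] {α : PosReal → ℝ} {p : PosReal → ℕ → ℝ}
  {k f : PosReal → ℝ} {κ : ℝ}

lemma IsMeanPath.isMeanSolution (hk : Subcrit G (fun y => α y * genFunDeriv p y) κ)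
    {π : ℝ → PosReal → ℝ} (hπ : IsMeanPath G (fun y => α y * genFunDeriv p y) f π) :
    IsMeanSolution α p G f (fun t => π t) where
  measurable := hπ.path.measurable.comp
    ((measurable_subtype_coe.comp measurable_fst).prodMk measurable_snd)
  locBdd T := by
    obtain ⟨C, hC⟩ := hπ.path.locBdd T
    exact ⟨C, fun t ht x => hC t (by exact_mod_cast ht) x⟩
  eqn t x := by
    rw [hπ.eqn, impulse_of_nonneg f t.coe_nonneg, evol_eq_intervalIntegral (linH_zero _ _)
      hπ.path.zero_of_neg (hk.integrableOn_lin hπ.path t x) t.coe_nonneg]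
    congr 1
    refine intervalIntegral.integral_congr fun s hs => ?_
    rw [Set.uIcc_of_le t.coe_nonneg] at hs
    simp only [linH, sub_toNNReal t hs.1, Real.coe_toNNReal _ (sub_nonneg.2 hs.2)]

/-- Once a solution is extended by `0` to negative times, the integral over `[0,t]` coincides with
the integral over `(0,∞)` used in `evol`. -/
lemma IsMeanSolution.isMeanPath (hk : Subcrit G (fun y => α y * genFunDeriv p y) κ)
    {π : ℝ≥0 → PosReal → ℝ} (hπ : IsMeanSolution α p G f π) :
    IsMeanPath G (fun y => α y * genFunDeriv p y) f (extendTime π) := by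
  have hp := extendTime_isPath hπ.measurable hπ.locBdd
  refine ⟨hp, fun t x => ?_⟩
  rcases lt_or_ge t 0 with ht | ht
  · rw [hp.zero_of_neg t ht, impulse_of_neg f ht, evol, setIntegral_eq_zero_of_forall_eq_zero,
      add_zero]
    intro s hs
    have : (0 : ℝ) < s := hs
    exact linH_zero _ _ _ _ fun z => hp.zero_of_neg _ (by linarith) z
  · rw [impulse_of_nonneg f ht, evol_eq_intervalIntegral (linH_zero _ _) hp.zero_of_neg
      (hk.integrableOn_lin hp t x) ht, extendTime, if_pos ht, hπ.eqn, Real.coe_toNNReal _ ht]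
    congr 1
    refine intervalIntegral.integral_congr fun s hs => ?_
    rw [Set.uIcc_of_le ht] at hs
    simp only [linH, sub_toNNReal _ hs.1, Real.coe_toNNReal _ ht]
    simp only [extendTime, if_pos (sub_nonneg.2 hs.2)]

lemma IsMeanPath.unique (hk : Subcrit G k κ) {π π' : ℝ → PosReal → ℝ} (hπ : IsMeanPath G k f π)
    (hπ' : IsMeanPath G k f π') (t : ℝ) (x : PosReal) : π t x = π' t x := by
  have key : ∀ {π π' : ℝ → PosReal → ℝ}, IsMeanPath G k f π → IsMeanPath G k f π' →
      π t x ≤ π' t x := by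
    intro π π' hπ hπ'
    have := hk.nonpos_of_le_evol (hπ.path.sub hπ'.path) (fun t _ x => by
      rw [hk.evol_sub hπ.path hπ'.path, hπ.eqn t x, hπ'.eqn t x]; linarith) t x
    linarith
  exact le_antisymm (key hπ hπ') (key hπ' hπ)

lemma IsMeanPath.sub (hk : Subcrit G k κ) {f g : PosReal → ℝ} {π π' : ℝ → PosReal → ℝ}
    (hπ : IsMeanPath G k f π) (hπ' : IsMeanPath G k g π') :
    IsMeanPath G k (fun x => f x - g x) (fun t x => π t x - π' t x) := by
  refine ⟨hπ.path.sub hπ'.path, fun t x => ?_⟩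
  rw [hk.evol_sub hπ.path hπ'.path, hπ.eqn t x, hπ'.eqn t x]
  have : impulse (fun x => f x - g x) t x = impulse f t x - impulse g t x := by
    unfold impulse
    split_ifs
    · exact zeroExt_sub _ _ _
    · ring
  rw [this]
  ring

/-- The solution of the mean equation for nonnegative data. -/
noncomputable def meanPath (G : Measure PosReal) (k f : PosReal → ℝ) : ℝ → PosReal → ℝ :=
  minSol (linH G k) (impulse f)

variable {C : ℝ}

lemma meanPath_isSol (hk : Subcrit G k κ) (hf : Measurable f) (h0 : ∀ x, 0 ≤ f x)
    (hC : ∀ x, f x ≤ C) : IsSol (linH G k) (impulse f) (meanPath G k f) :=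
  hk.admissible.minSol_isSol hk.bound_nonneg (impulse_isSource hf h0 hC)

lemma meanPath_isMeanPath (hk : Subcrit G k κ) (hf : Measurable f) (h0 : ∀ x, 0 ≤ f x)
    (hC : ∀ x, f x ≤ C) : IsMeanPath G k f (meanPath G k f) :=
  ⟨(meanPath_isSol hk hf h0 hC).path, (meanPath_isSol hk hf h0 hC).eqn⟩

lemma lintegral_impulse_le (h0 : ∀ x, 0 ≤ f x) (hC : ∀ x, f x ≤ C) (x : PosReal) :
    ∫⁻ t in Set.Ioi (0 : ℝ), ENNReal.ofReal (impulse f t x) ≤ ENNReal.ofReal (C * x) := by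
  have hx : (0 : ℝ) < x := x.2
  have hC0 : 0 ≤ C := (h0 x).trans (hC x)
  rw [← setIntegral_indicator_Ico hx.le C, ofReal_integral_eq_lintegral_ofReal
    (integrableOn_indicator_const _ _)
    (ae_of_all _ fun s => Set.indicator_nonneg (fun _ _ => hC0) s)]
  refine setLIntegral_mono' measurableSet_Ioi fun t ht => ENNReal.ofReal_le_ofReal ?_
  have ht' : (0 : ℝ) < t := ht
  rw [impulse_of_nonneg f ht'.le]
  exact zeroExt_sub_le_indicator hC x ht'.le

lemma lintegral_Ioi_comp_sub_le {b : ℝ → ℝ≥0∞} (hb : ∀ t < 0, b t = 0) {s : ℝ} :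
    ∫⁻ t in Set.Ioi (0 : ℝ), b (t - s) ≤ ∫⁻ t in Set.Ioi (0 : ℝ), b t := by
  calc ∫⁻ t in Set.Ioi (0 : ℝ), b (t - s) ≤ ∫⁻ t, b (t - s) := setLIntegral_le_lintegral _ _
    _ = ∫⁻ t, b t := lintegral_sub_right_eq_self b s
    _ = ∫⁻ t in Set.Ici (0 : ℝ), b t := by
        rw [← lintegral_indicator measurableSet_Ici]
        refine lintegral_congr fun t => ?_
        by_cases ht : 0 ≤ t
        · simp [ht]
        · simp [ht, hb t (not_le.1 ht)]
    _ = ∫⁻ t in Set.Ioi (0 : ℝ), b t := setLIntegral_congr Ioi_ae_eq_Ici.symm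

/-- `evol` is a convolution in time of `k(x-·)` with `⟨G, φ_·⟩`. By Tonelli and translation
invariance its total integral is at most the product of the two total integrals. -/
lemma lintegral_evol_le (hk : Subcrit G k κ) {φ : ℝ → PosReal → ℝ} (hφ : IsPath φ)
    (h0 : ∀ t x, 0 ≤ φ t x) (x : PosReal) :
    ∫⁻ t in Set.Ioi (0 : ℝ), ENNReal.ofReal (evol (linH G k) φ t x) ≤
      ENNReal.ofReal (potK k x) *
        ∫⁻ z, (∫⁻ t in Set.Ioi (0 : ℝ), ENNReal.ofReal (φ t z)) ∂G := by
  set b : ℝ → ℝ≥0∞ := fun t => ENNReal.ofReal (∫ z, φ t z ∂G) with hbdef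
  have hbm : Measurable b := (measurable_integral_slice hφ.measurable).ennreal_ofReal
  have hb0 : ∀ t < 0, b t = 0 := fun t ht => by simp [hbdef, hφ.zero_of_neg t ht]
  have hb : ∫⁻ t in Set.Ioi (0 : ℝ), b t =
      ∫⁻ z, (∫⁻ t in Set.Ioi (0 : ℝ), ENNReal.ofReal (φ t z)) ∂G := by
    rw [lintegral_lintegral_swap (by
      exact (hφ.measurable.ennreal_ofReal.comp measurable_swap).aemeasurable)]
    refine lintegral_congr fun t => ?_
    exact ofReal_integral_eq_lintegral_ofReal (hφ.integrable t G) (ae_of_all _ (h0 t))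
  have he : ∀ t, ENNReal.ofReal (evol (linH G k) φ t x) =
      ∫⁻ s in Set.Ioi (0 : ℝ), ENNReal.ofReal (zeroExt k (x - s)) * b (t - s) := by
    intro t
    rw [evol, ofReal_integral_eq_lintegral_ofReal (hk.integrableOn_lin hφ t x)
      (ae_of_all _ fun s => hk.admissible.nonneg _ _ (h0 _))]
    exact lintegral_congr fun s => ENNReal.ofReal_mul (zeroExt_nonneg hk.nonneg _)
  have hkm : Measurable (fun s : ℝ => ENNReal.ofReal (zeroExt k (x - s))) :=
    ((measurable_zeroExt hk.measurable).comp (measurable_const.sub measurable_id)).ennreal_ofReal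
  simp_rw [he]
  rw [lintegral_lintegral_swap (by
    exact ((hkm.comp measurable_snd).mul (hbm.comp (measurable_fst.sub measurable_snd))).aemeasurable),
    hk.ofReal_potK, ← lintegral_mul_const _ hkm, ← hb]
  refine lintegral_mono fun s => ?_
  have hbs : Measurable (fun t => b (t - s)) := hbm.comp (measurable_id.sub measurable_const)
  rw [lintegral_const_mul _ hbs]
  exact mul_le_mul_right (lintegral_Ioi_comp_sub_le hb0) _

/-- `∫₀^∞ π_t f(x) dt` grows at most linearly in `x`. -/
lemma lintegral_meanPath_le (hk : Subcrit G k κ) (hf : Measurable f) (h0 : ∀ x, 0 ≤ f x)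
    (hC : ∀ x, f x ≤ C) (x : PosReal) :
    ∫⁻ t in Set.Ioi (0 : ℝ), ENNReal.ofReal (meanPath G k f t x) ≤
      ENNReal.ofReal (C * (1 + κ * ((∫ z, (z : ℝ) ∂G) / (1 - ∫ z, potK k z ∂G))) * x) := by
  have hC0 : 0 ≤ C := (h0 x).trans (hC x)
  have hF := impulse_isSource hf h0 hC
  have hH := hk.admissible
  have hκ := hk.bound_nonneg
  have hρ := hk.integral_potK_lt_one
  have hm1 : 0 ≤ ∫ z : PosReal, (z : ℝ) ∂G := integral_nonneg fun z => (le_of_lt z.2)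
  set M := (∫ z : PosReal, (z : ℝ) ∂G) / (1 - ∫ z, potK k z ∂G) with hM
  have hM0 : 0 ≤ M := div_nonneg hm1 (by linarith)
  -- `M` is the fixed point of `M = m₁ + ρ M`, with `m₁` the mean of `G` and `ρ = ⟨G,K⟩`. Hence the
  -- bound `C x + K(x) C M` reproduces itself under one Picard step.
  have hMeq : (∫ z : PosReal, (z : ℝ) ∂G) + (∫ z, potK k z ∂G) * M = M := by
    have hne : 1 - ∫ z, potK k z ∂G ≠ 0 := by linarith
    rw [hM]; field_simp; ring
  have step : ∀ n (x : PosReal), ∫⁻ t in Set.Ioi (0 : ℝ),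
      ENNReal.ofReal (picard (linH G k) (impulse f) n t x) ≤
        ENNReal.ofReal (C * x + potK k x * (C * M)) := by
    intro n
    induction n with
    | zero => intro x; simp [picard]
    | succ n ih =>
      intro x
      have hs := hH.picard_spec hκ hF n
      have hx : (0 : ℝ) < x := x.2
      have h1 : ∫⁻ z, (∫⁻ t in Set.Ioi (0 : ℝ),
          ENNReal.ofReal (picard (linH G k) (impulse f) n t z)) ∂G ≤ ENNReal.ofReal (C * M) := by
        refine (lintegral_mono ih).trans ?_
        have hi1 : Integrable (fun z : PosReal => C * (z : ℝ)) G := hk.integrable_coe.const_mul C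
        have hi2 : Integrable (fun z => potK k z * (C * M)) G := hk.integrable_potK.mul_const _
        have hi12 : Integrable (fun z : PosReal => C * (z : ℝ) + potK k z * (C * M)) G :=
          hi1.add hi2
        rw [← ofReal_integral_eq_lintegral_ofReal hi12 (ae_of_all _ fun z =>
          add_nonneg (mul_nonneg hC0 (le_of_lt z.2))
            (mul_nonneg (hk.potK_nonneg z) (mul_nonneg hC0 hM0)))]
        refine ENNReal.ofReal_le_ofReal (le_of_eq ?_)
        rw [integral_add hi1 hi2, integral_const_mul, integral_mul_const]
        nth_rewrite 2 [← hMeq]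
        ring
      have h2 := lintegral_evol_le hk hs.1 hs.2.1 x
      have hmeas : Measurable (fun t => ENNReal.ofReal (impulse f t x)) :=
        (hF.measurable.comp (measurable_id.prodMk measurable_const)).ennreal_ofReal
      simp only [picard]
      simp_rw [fun t => ENNReal.ofReal_add (hF.nonneg t x) (hH.evol_nonneg hs.2.1 t x)]
      rw [lintegral_add_left hmeas, ENNReal.ofReal_add (by positivity)
        (mul_nonneg (hk.potK_nonneg x) (by positivity)), ENNReal.ofReal_mul (hk.potK_nonneg x)]
      exact add_le_add (lintegral_impulse_le h0 hC x) (h2.trans (mul_le_mul_right h1 _))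
  have hlim : ∀ t, Tendsto (fun n => ENNReal.ofReal (picard (linH G k) (impulse f) n t x)) atTop
      (𝓝 (ENNReal.ofReal (meanPath G k f t x))) := fun t =>
    (ENNReal.continuous_ofReal.tendsto _).comp (hH.tendsto_picard hκ hF t x)
  -- Fatou's lemma carries the bound, uniform in the iterate, to the limit.
  have hfat : ∫⁻ t in Set.Ioi (0 : ℝ), ENNReal.ofReal (meanPath G k f t x) ≤
      ENNReal.ofReal (C * x + potK k x * (C * M)) := by
    calc ∫⁻ t in Set.Ioi (0 : ℝ), ENNReal.ofReal (meanPath G k f t x)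
        = ∫⁻ t in Set.Ioi (0 : ℝ), liminf (fun n =>
            ENNReal.ofReal (picard (linH G k) (impulse f) n t x)) atTop :=
          lintegral_congr fun t => (hlim t).liminf_eq.symm
      _ ≤ liminf (fun n => ∫⁻ t in Set.Ioi (0 : ℝ),
            ENNReal.ofReal (picard (linH G k) (impulse f) n t x)) atTop :=
          lintegral_liminf_le fun n => ((hH.picard_spec hκ hF n).1.measurable.comp
            (measurable_id.prodMk measurable_const)).ennreal_ofReal
      _ ≤ _ := by
          refine liminf_le_of_frequently_le' (Eventually.frequently ?_)
          exact Eventually.of_forall fun n => step n x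
  refine hfat.trans (ENNReal.ofReal_le_ofReal ?_)
  have h1 := hk.potK_le x
  have h2 := mul_le_mul_of_nonneg_right h1 (mul_nonneg hC0 hM0)
  nlinarith

end Mean

/-! ### The cumulant equation -/

/-- The branching mechanism of the cumulant equation. -/
noncomputable def cumH (α : PosReal → ℝ) (p : PosReal → ℕ → ℝ) (G : Measure PosReal) (y : ℝ)
    (φ : PosReal → ℝ) : ℝ :=
  zeroExt (fun y => α y * (1 - genFun p y (∫ z, Real.exp (-φ z) ∂G))) y

section Cumulant

variable {G : Measure PosReal} [IsProbabilityMeasure G] {α : PosReal → ℝ} {p : PosReal → ℕ → ℝ}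
  {κ : ℝ}

lemma integral_exp_neg_nonneg (φ : PosReal → ℝ) : 0 ≤ ∫ z, Real.exp (-φ z) ∂G :=
  integral_nonneg fun _ => (Real.exp_pos _).le

lemma integral_exp_neg_le_one {φ : PosReal → ℝ} (h0 : ∀ x, 0 ≤ φ x) :
    ∫ z, Real.exp (-φ z) ∂G ≤ 1 := by
  have := norm_integral_le_of_norm_le_const (μ := G) (f := fun z => Real.exp (-φ z)) (C := 1)
    (ae_of_all _ fun x => by
      rw [Real.norm_of_nonneg (Real.exp_pos _).le]
      exact Real.exp_le_one_iff.2 (by linarith [h0 x]))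
  simpa using (le_abs_self _).trans this

lemma integrable_exp_neg {φ : PosReal → ℝ} (hφ : Measurable φ) (h0 : ∀ x, 0 ≤ φ x) :
    Integrable (fun z => Real.exp (-φ z)) G :=
  Integrable.of_bound hφ.neg.exp.aestronglyMeasurable 1 (ae_of_all _ fun x => by
    rw [Real.norm_of_nonneg (Real.exp_pos _).le]
    exact Real.exp_le_one_iff.2 (by linarith [h0 x]))

lemma integrable_of_le {ν : Measure PosReal} [IsFiniteMeasure ν] {φ : PosReal → ℝ} {C : ℝ}
    (hφ : Measurable φ) (h0 : ∀ x, 0 ≤ φ x) (hC : ∀ x, φ x ≤ C) : Integrable φ ν :=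
  Integrable.of_bound hφ.aestronglyMeasurable C (ae_of_all _ fun x => by
    rw [Real.norm_of_nonneg (h0 x)]; exact hC x)

lemma one_sub_integral_exp_neg_le {φ : PosReal → ℝ} {C : ℝ} (hφ : Measurable φ)
    (h0 : ∀ x, 0 ≤ φ x) (hC : ∀ x, φ x ≤ C) :
    1 - ∫ z, Real.exp (-φ z) ∂G ≤ ∫ z, φ z ∂G := by
  have h1 : (1 : ℝ) = ∫ _z : PosReal, (1 : ℝ) ∂G := by simp
  rw [sub_le_iff_le_add, ← integral_add (integrable_of_le hφ h0 hC) (integrable_exp_neg hφ h0)]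
  nth_rewrite 1 [h1]
  refine integral_mono (integrable_const _)
    ((integrable_of_le hφ h0 hC).add (integrable_exp_neg hφ h0)) fun z => ?_
  have := Real.add_one_le_exp (-φ z)
  simp only
  linarith

/-- Two linearizations from above: `1 - g(x,z) ≤ g'(x,1-)(1-z)` by the Lipschitz bound, and `1 -
e^{-φ} ≤ φ`. -/
lemma cumH_le_linH (hα0 : ∀ x, 0 ≤ α x) (hp : IsOffspringLaw p) {φ : PosReal → ℝ} {C : ℝ}
    (hφ : Measurable φ) (h0 : ∀ x, 0 ≤ φ x) (hC : ∀ x, φ x ≤ C) (y : ℝ) :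
    cumH α p G y φ ≤ linH G (fun y => α y * genFunDeriv p y) y φ := by
  rw [linH, ← zeroExt_mul_const]
  refine zeroExt_mono (fun x => ?_) y
  have h1 := hp.genFun_sub_le x (integral_exp_neg_nonneg (G := G) φ) (integral_exp_neg_le_one h0)
    le_rfl
  rw [hp.genFun_one] at h1
  have h2 := mul_le_mul_of_nonneg_left (one_sub_integral_exp_neg_le (G := G) hφ h0 hC)
    (hp.genFunDeriv_nonneg x)
  have := mul_le_mul_of_nonneg_left (h1.trans h2) (hα0 x)
  linarith

lemma one_sub_genFun_nonneg (hp : IsOffspringLaw p) {φ : PosReal → ℝ} (h0 : ∀ x, 0 ≤ φ x)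
    (x : PosReal) : 0 ≤ 1 - genFun p x (∫ z, Real.exp (-φ z) ∂G) := by
  have := hp.genFun_mono x (integral_exp_neg_nonneg (G := G) φ) (integral_exp_neg_le_one h0) le_rfl
  rw [hp.genFun_one] at this
  linarith

/-- Monotonicity is inherited from `g(x,·)` being increasing on `[0,1]`, and the size bound from
domination by the linear mechanism. -/
lemma cumH_admissible (hαm : Measurable α) (hα0 : ∀ x, 0 ≤ α x) (hp : IsOffspringLaw p)
    (hk : Subcrit G (fun y => α y * genFunDeriv p y) κ) : Admissible G κ (cumH α p G) where
  zero_of_nonpos y hy φ := zeroExt_of_nonpos _ hy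
  nonneg y φ h := zeroExt_nonneg (fun x => mul_nonneg (hα0 x) (one_sub_genFun_nonneg hp h x)) y
  mono y φ ψ hφ hψ h0 hle _ := by
    refine zeroExt_mono (fun x => mul_le_mul_of_nonneg_left ?_ (hα0 x)) y
    have h0' : ∀ x, 0 ≤ ψ x := fun x => (h0 x).trans (hle x)
    have := hp.genFun_mono x (integral_exp_neg_nonneg (G := G) ψ)
      (integral_mono (integrable_exp_neg hψ h0') (integrable_exp_neg hφ h0)
        fun z => Real.exp_le_exp.2 (neg_le_neg (hle z))) (integral_exp_neg_le_one h0)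
    linarith
  le y φ C hφ h0 hC := (cumH_le_linH hα0 hp hφ h0 hC y).trans (hk.admissible.le y φ C hφ h0 hC)
  tendsto y φ ψ C hφ h0 hC hlim := by
    have h0' : ∀ x, 0 ≤ ψ x := fun x => ge_of_tendsto' (hlim x) fun n => h0 n x
    have hexp : Tendsto (fun n => ∫ z, Real.exp (-φ n z) ∂G) atTop
        (𝓝 (∫ z, Real.exp (-ψ z) ∂G)) := by
      refine tendsto_integral_of_dominated_convergence (fun _ => 1)
        (fun n => (hφ n).neg.exp.aestronglyMeasurable) (integrable_const _)
        (fun n => ae_of_all _ fun x => ?_) (ae_of_all _ fun x => ?_)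
      · rw [Real.norm_of_nonneg (Real.exp_pos _).le]
        exact Real.exp_le_one_iff.2 (by linarith [h0 n x])
      · exact (Real.continuous_exp.tendsto _).comp (hlim x).neg
    rcases lt_or_ge 0 y with hy | hy
    · simp only [cumH, zeroExt_of_pos _ hy]
      refine Tendsto.const_mul _ (Tendsto.const_sub _ ?_)
      -- Continuity of `g(x,·)` up to the endpoint `1` is obtained from its Lipschitz constant
      -- `g'(x,1-)` on `[0,1]`.
      rw [tendsto_iff_dist_tendsto_zero] at hexp ⊢
      refine squeeze_zero (fun _ => dist_nonneg) (fun n => ?_)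
        (by simpa using hexp.const_mul (genFunDeriv p ⟨y, hy⟩))
      rw [Real.dist_eq, Real.dist_eq]
      have key : ∀ {a b : ℝ}, 0 ≤ a → a ≤ b → b ≤ 1 →
          |genFun p ⟨y, hy⟩ b - genFun p ⟨y, hy⟩ a| ≤ genFunDeriv p ⟨y, hy⟩ * |b - a| := by
        intro a b ha hab hb
        rw [abs_of_nonneg (sub_nonneg.2 (hp.genFun_mono _ ha hab hb)),
          abs_of_nonneg (sub_nonneg.2 hab)]
        exact hp.genFun_sub_le _ ha hab hb
      rcases le_total (∫ z, Real.exp (-φ n z) ∂G) (∫ z, Real.exp (-ψ z) ∂G) with h | h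
      · have := key (integral_exp_neg_nonneg _) h (integral_exp_neg_le_one h0')
        rwa [abs_sub_comm, abs_sub_comm (∫ z, Real.exp (-φ n z) ∂G)]
      · exact key (integral_exp_neg_nonneg _) h (integral_exp_neg_le_one (h0 n))
    · simp only [cumH, zeroExt_of_nonpos _ hy]
      exact tendsto_const_nhds
  meas φ hφ h0 := by
    have h1 : Measurable (fun t => ∫ z, Real.exp (-φ t z) ∂G) :=
      (hφ.neg.exp.stronglyMeasurable.integral_prod_right' (ν := G)).measurable
    have h2 : Measurable (Function.uncurry fun (t : ℝ) (y : PosReal) =>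
        α y * (1 - genFun p y (∫ z, Real.exp (-φ t z) ∂G))) :=
      (hαm.comp measurable_snd).mul (measurable_const.sub (hp.measurable_genFun measurable_snd
        (h1.comp measurable_fst) (fun _ => integral_exp_neg_nonneg _)
        (fun q => integral_exp_neg_le_one (h0 q.1))))
    exact (measurable_zeroExt_uncurry h2).comp measurable_swap

lemma sq_integral_le {φ : PosReal → ℝ} (h1 : Integrable φ G)
    (h2 : Integrable (fun z => φ z ^ 2) G) : (∫ z, φ z ∂G) ^ 2 ≤ ∫ z, φ z ^ 2 ∂G := by
  have h : 0 ≤ ∫ z, (φ z - ∫ w, φ w ∂G) ^ 2 ∂G := integral_nonneg fun z => sq_nonneg _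
  set m := ∫ w, φ w ∂G with hm
  have e : ∫ z, (φ z - m) ^ 2 ∂G = (∫ z, φ z ^ 2 ∂G) - m ^ 2 := by
    calc ∫ z, (φ z - m) ^ 2 ∂G = ∫ z, (φ z ^ 2 - (2 * m) * φ z + m ^ 2) ∂G := by
          refine integral_congr_ae (ae_of_all _ fun z => ?_); simp only; ring
      _ = _ := by
          have h3 : Integrable (fun z => φ z ^ 2 - (2 * m) * φ z) G := h2.sub (h1.const_mul _)
          rw [integral_add h3 (integrable_const _),
            integral_sub h2 (h1.const_mul _), integral_const_mul, ← hm]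
          simp; ring
  linarith

/-- Matching second-order lower bound. With `q = 1 - ⟨G, e^{-φ}⟩`, replacing `⟨G,φ⟩` by `q` costs at
most `⟨G,φ²⟩`, weighted by `κ`; linearizing `g` at `1` costs `C₂ q² ≤ C₂⟨G,φ²⟩`, weighted by `a₀`.
This explains the constant `κ + a₀ C₂`. -/
lemma le_cumH (hα0 : ∀ x, 0 ≤ α x) {a₀ : ℝ} (hαa : ∀ x, α x ≤ a₀) (hp : IsOffspringLaw p)
    (hk : Subcrit G (fun y => α y * genFunDeriv p y) κ) {C₂ : ℝ} (hC₂ : 0 ≤ C₂)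
    (hg : ∀ x, Summable (fun i : ℕ => p x i * ((i : ℝ) * ((i : ℝ) - 1))) ∧
      ∑' i : ℕ, p x i * ((i : ℝ) * ((i : ℝ) - 1)) ≤ C₂)
    {φ : PosReal → ℝ} {C : ℝ} (hφ : Measurable φ) (h0 : ∀ x, 0 ≤ φ x) (hC : ∀ x, φ x ≤ C)
    (y : ℝ) :
    linH G (fun y => α y * genFunDeriv p y) y φ -
      zeroExt (fun _ => (κ + a₀ * C₂) * ∫ z, φ z ^ 2 ∂G) y ≤ cumH α p G y φ := by
  rw [linH, ← zeroExt_mul_const, ← zeroExt_sub]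
  refine zeroExt_mono (fun x => ?_) y
  have hi1 : Integrable φ G := integrable_of_le hφ h0 hC
  have hi2 : Integrable (fun z => φ z ^ 2) G :=
    integrable_of_le (C := C ^ 2) (hφ.pow_const 2) (fun z => sq_nonneg _)
      fun z => pow_le_pow_left₀ (h0 z) (hC z) 2
  set q := 1 - ∫ z, Real.exp (-φ z) ∂G with hq
  have hq0 : 0 ≤ q := by have := integral_exp_neg_le_one (G := G) h0; linarith
  have hq1 : q ≤ 1 := by have := integral_exp_neg_nonneg (G := G) φ; linarith
  have hqle : q ≤ ∫ z, φ z ∂G := one_sub_integral_exp_neg_le hφ h0 hC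
  have hqge : (∫ z, φ z ∂G) - ∫ z, φ z ^ 2 ∂G ≤ q := by
    have hi3 : Integrable (fun z => φ z - φ z ^ 2) G := hi1.sub hi2
    rw [hq, ← integral_sub hi1 hi2, le_sub_iff_add_le, ← integral_add hi3
      (integrable_exp_neg hφ h0)]
    have h1 : ∫ _z : PosReal, (1 : ℝ) ∂G = 1 := by simp
    refine le_trans ?_ h1.le
    refine integral_mono (hi3.add (integrable_exp_neg hφ h0)) (integrable_const _)
      fun z => ?_
    have hz := h0 z
    have h3 : Real.exp (-φ z) ≤ 1 / (1 + φ z) := by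
      rw [Real.exp_neg, ← one_div]
      exact one_div_le_one_div_of_le (by linarith) (by linarith [Real.add_one_le_exp (φ z)])
    have h4 : 1 / (1 + φ z) ≤ 1 - φ z + φ z ^ 2 := by
      -- Here `(1 + y)(1 - y + y²) = 1 + y³ ≥ 1`.
      rw [div_le_iff₀ (by linarith)]
      nlinarith [pow_nonneg hz 3]
    simp only
    linarith
  have hqsq : q ^ 2 ≤ ∫ z, φ z ^ 2 ∂G :=
    (pow_le_pow_left₀ hq0 hqle 2).trans (sq_integral_le hi1 hi2)
  have hexp : ∫ z, Real.exp (-φ z) ∂G = 1 - q := by rw [hq]; ring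
  have hmain := hp.one_sub_genFun_ge (hg x).1 (hg x).2 hq0 hq1
  rw [hexp]
  have hS : 0 ≤ ∫ z, φ z ^ 2 ∂G := integral_nonneg fun z => sq_nonneg _
  have hkx : α x * genFunDeriv p x ≤ κ := hk.le x
  have hkx0 : 0 ≤ α x * genFunDeriv p x := hk.nonneg x
  calc α x * genFunDeriv p x * (∫ z, φ z ∂G) - (κ + a₀ * C₂) * ∫ z, φ z ^ 2 ∂G
      ≤ α x * genFunDeriv p x * (∫ z, φ z ∂G) - (α x * genFunDeriv p x + α x * C₂) *
          ∫ z, φ z ^ 2 ∂G := by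
        have := mul_le_mul_of_nonneg_right (hαa x) hC₂
        have := mul_le_mul_of_nonneg_right (add_le_add hkx this) hS
        linarith
    _ ≤ α x * genFunDeriv p x * q - α x * C₂ * q ^ 2 := by
        have e1 := mul_le_mul_of_nonneg_left hqge hkx0
        have e2 := mul_le_mul_of_nonneg_left hqsq (mul_nonneg (hα0 x) hC₂)
        linarith
    _ = α x * (genFunDeriv p x * q - C₂ * q ^ 2) := by ring
    _ ≤ _ := mul_le_mul_of_nonneg_left hmain (hα0 x)

/-- A solution of the evolution equation restarted at time `τ` is a cumulant. -/
lemma IsSol.isCumulant (hH : Admissible G κ (cumH α p G)) {F U : ℝ → PosReal → ℝ}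
    (hU : IsSol (cumH α p G) F U) {τ : ℝ}
    (hF : ∀ t, 0 ≤ t → ∀ x : PosReal, F (τ + t) x = zeroExt (F τ) (x - t)) :
    IsCumulant α p G (U τ) (fun t => U (τ + t)) where
  measurable := hU.path.measurable.comp
    ((measurable_const.add (measurable_subtype_coe.comp measurable_fst)).prodMk measurable_snd)
  nonneg t x := hU.nonneg _ x
  locBdd T := by
    obtain ⟨C, hC⟩ := hU.path.locBdd (τ + T)
    refine ⟨C, fun t ht x => (le_abs_self _).trans (hC _ ?_ x)⟩
    have : (t : ℝ) ≤ T := by exact_mod_cast ht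
    linarith
  eqn t x := by
    rw [hU.restart hH hF t.coe_nonneg x]
    congr 1
    refine intervalIntegral.integral_congr fun s hs => ?_
    rw [Set.uIcc_of_le t.coe_nonneg] at hs
    simp only [cumH, sub_toNNReal t hs.1, Real.coe_toNNReal _ (sub_nonneg.2 hs.2)]
    simp only [show τ + (t : ℝ) - s = τ + (t - s) by ring]

end Cumulant

/-! ### Trains of impulses -/

/-- Quantitative form of the assumptions on the branching parameters. -/
structure BranchingData (α : PosReal → ℝ) (p : PosReal → ℕ → ℝ) (G : Measure PosReal)
    (κ a₀ C₂ : ℝ) : Prop where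
  rate_measurable : Measurable α
  rate_nonneg : ∀ x, 0 ≤ α x
  rate_le : ∀ x, α x ≤ a₀
  offspring : IsOffspringLaw p
  subcrit : Subcrit G (fun y => α y * genFunDeriv p y) κ
  second_nonneg : 0 ≤ C₂
  second : ∀ x, Summable (fun i : ℕ => p x i * ((i : ℝ) * ((i : ℝ) - 1))) ∧
    ∑' i : ℕ, p x i * ((i : ℝ) * ((i : ℝ) - 1)) ≤ C₂

/-- Impulses `h` released at the times `0, 1, …, m`. -/
noncomputable def train (h : PosReal → ℝ) (m : ℕ) (t : ℝ) (x : PosReal) : ℝ :=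
  ∑ i ∈ Finset.range (m + 1), impulse h (t - i) x

/-- The cumulant driven by impulses `h` at the times `0, 1, …, m`. -/
noncomputable def trainSol (α : PosReal → ℝ) (p : PosReal → ℕ → ℝ) (G : Measure PosReal)
    (h : PosReal → ℝ) (m : ℕ) : ℝ → PosReal → ℝ :=
  minSol (cumH α p G) (train h m)

lemma card_le_of_mem_Ioc {S : Finset ℕ} {a b : ℝ} (hab : a ≤ b)
    (hS : ∀ i ∈ S, a < i ∧ (i : ℝ) ≤ b) : (S.card : ℝ) ≤ b - a + 1 := by
  have h1 : S.map ⟨(fun i : ℕ => (i : ℤ)), Nat.cast_injective⟩ ⊆ Finset.Ioc ⌊a⌋ ⌊b⌋ := by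
    intro j hj
    obtain ⟨i, hi, rfl⟩ := Finset.mem_map.1 hj
    obtain ⟨h1, h2⟩ := hS i hi
    exact Finset.mem_Ioc.2 ⟨Int.floor_lt.2 (by exact_mod_cast h1), Int.le_floor.2 (by exact_mod_cast h2)⟩
  have h2 := Finset.card_le_card h1
  rw [Finset.card_map, Int.card_Ioc] at h2
  have h3 : ((⌊b⌋ - ⌊a⌋).toNat : ℤ) = ⌊b⌋ - ⌊a⌋ :=
    Int.toNat_of_nonneg (sub_nonneg.2 (Int.floor_mono hab))
  have h4 : (S.card : ℤ) ≤ ⌊b⌋ - ⌊a⌋ := by rw [← h3]; exact_mod_cast h2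
  have h5 : (S.card : ℝ) ≤ (⌊b⌋ : ℝ) - ⌊a⌋ := by exact_mod_cast h4
  linarith [Int.floor_le b, Int.lt_floor_add_one a]

/-- An impulse released at time `i` is still alive at `t` only if `t - x < i ≤ t`, and there are at
most `x + 1` such integers. The bound does not depend on `m`. -/
lemma train_le {h : PosReal → ℝ} {C : ℝ} (h0 : ∀ x, 0 ≤ h x) (hC : ∀ x, h x ≤ C) (m : ℕ) (t : ℝ)
    (x : PosReal) : train h m t x ≤ C * (x + 1) := by
  classical
  have hx : (0 : ℝ) < x := x.2
  have hC0 : 0 ≤ C := (h0 x).trans (hC x)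
  have h1 : train h m t x ≤ ∑ i ∈ Finset.range (m + 1),
      if (t - x < i ∧ (i : ℝ) ≤ t) then C else 0 := by
    refine Finset.sum_le_sum fun i _ => ?_
    by_cases hi : (i : ℝ) ≤ t
    · rw [impulse_of_nonneg h (sub_nonneg.2 hi)]
      split_ifs with hc
      · exact zeroExt_le hC0 hC _
      · rw [zeroExt_of_nonpos]
        have : ¬ (t - x < i) := fun h => hc ⟨h, hi⟩
        linarith
    · rw [impulse_of_neg h (by linarith)]
      split_ifs <;> linarith
  refine h1.trans ?_
  rw [← Finset.sum_filter, Finset.sum_const, nsmul_eq_mul]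
  have h2 := card_le_of_mem_Ioc (S := (Finset.range (m + 1)).filter
    fun i : ℕ => t - x < i ∧ (i : ℝ) ≤ t) (a := t - x) (b := t) (by linarith)
    fun i hi => (Finset.mem_filter.1 hi).2
  nlinarith

lemma train_isSource {h : PosReal → ℝ} {C : ℝ} (hm : Measurable h) (h0 : ∀ x, 0 ≤ h x)
    (hC : ∀ x, h x ≤ C) (m : ℕ) : IsSource (train h m) ((m + 1) * C) where
  measurable := by
    have h1 : ∀ i : ℕ, Measurable (fun q : ℝ × PosReal => impulse h (q.1 - i) q.2) := fun i =>
      (measurable_impulse hm).comp ((measurable_fst.sub measurable_const).prodMk measurable_snd)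
    exact Finset.measurable_sum (Finset.range (m + 1)) fun i _ => h1 i
  nonneg t x := Finset.sum_nonneg fun i _ => impulse_nonneg h0 _ _
  zero_of_neg t ht x := Finset.sum_eq_zero fun i _ => by
    have : (0 : ℝ) ≤ i := Nat.cast_nonneg i
    exact impulse_of_neg h (by linarith) x
  le t x := by
    refine (Finset.sum_le_card_nsmul _ _ C fun i _ => (impulse_isSource hm h0 hC).le _ _).trans ?_
    simp

/-- From time `m` on, every impulse has been released and the source is merely transported. This is
the condition under which the equation can be restarted at `m`. -/
lemma train_restart (h : PosReal → ℝ) (m : ℕ) (t : ℝ) (ht : 0 ≤ t) (x : PosReal) :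
    train h m (m + t) x = zeroExt (train h m m) (x - t) := by
  have hi : ∀ i ∈ Finset.range (m + 1), (i : ℝ) ≤ m := fun i hi => by
    exact_mod_cast Nat.lt_succ_iff.1 (Finset.mem_range.1 hi)
  rcases lt_or_ge 0 ((x : ℝ) - t) with hx | hx
  · rw [zeroExt_of_pos _ hx]
    refine Finset.sum_congr rfl fun i him => ?_
    have := hi i him
    rw [impulse_of_nonneg h (by linarith), impulse_of_nonneg h (by linarith)]
    congr 1
    simp only
    ring
  · rw [zeroExt_of_nonpos _ hx]
    refine Finset.sum_eq_zero fun i him => ?_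
    have := hi i him
    rw [impulse_of_nonneg h (by linarith), zeroExt_of_nonpos _ (by linarith)]

section TrainSol

variable {G : Measure PosReal} [IsProbabilityMeasure G] {α : PosReal → ℝ} {p : PosReal → ℕ → ℝ}
  {κ a₀ C₂ : ℝ} {h : PosReal → ℝ} {C : ℝ}

lemma BranchingData.admissible (D : BranchingData α p G κ a₀ C₂) :
    Admissible G κ (cumH α p G) :=
  cumH_admissible D.rate_measurable D.rate_nonneg D.offspring D.subcrit

lemma BranchingData.trainSol_isSol (D : BranchingData α p G κ a₀ C₂) (hm : Measurable h)
    (h0 : ∀ x, 0 ≤ h x) (hC : ∀ x, h x ≤ C) (m : ℕ) :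
    IsSol (cumH α p G) (train h m) (trainSol α p G h m) :=
  D.admissible.minSol_isSol D.subcrit.bound_nonneg (train_isSource hm h0 hC m)

lemma BranchingData.trainSol_isCumulant (D : BranchingData α p G κ a₀ C₂) (hm : Measurable h)
    (h0 : ∀ x, 0 ≤ h x) (hC : ∀ x, h x ≤ C) (m : ℕ) :
    IsCumulant α p G (trainSol α p G h m m) (fun t => trainSol α p G h m (m + t)) :=
  (D.trainSol_isSol hm h0 hC m).isCumulant D.admissible (train_restart h m)

lemma BranchingData.trainSol_zero (D : BranchingData α p G κ a₀ C₂) (hm : Measurable h)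
    (h0 : ∀ x, 0 ≤ h x) (hC : ∀ x, h x ≤ C) (x : PosReal) : trainSol α p G h 0 0 x = h x := by
  have hU := D.trainSol_isSol hm h0 hC 0
  rw [hU.eqn, evol, setIntegral_eq_zero_of_forall_eq_zero]
  · simp [train, impulse]
  · intro s hs
    have : (0 : ℝ) < s := hs
    exact D.admissible.zero fun z => hU.path.zero_of_neg _ (by linarith) z

/-- By causality the impulse released at `m+1` adds exactly `h` at that instant and does not affect
`evol` there. This is the recursion that matches one step of the Markov property along the grid. -/
lemma BranchingData.trainSol_succ (D : BranchingData α p G κ a₀ C₂) (hm : Measurable h)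
    (h0 : ∀ x, 0 ≤ h x) (hC : ∀ x, h x ≤ C) (m : ℕ) (x : PosReal) :
    trainSol α p G h (m + 1) (m + 1 : ℕ) x = h x + trainSol α p G h m (m + 1 : ℕ) x := by
  rw [(D.trainSol_isSol hm h0 hC (m + 1)).eqn, (D.trainSol_isSol hm h0 hC m).eqn]
  have h1 : train h (m + 1) (m + 1 : ℕ) x = train h m (m + 1 : ℕ) x + h x := by
    rw [train, Finset.sum_range_succ, ← train]
    simp [impulse]
  have h2 : ∀ t < ((m + 1 : ℕ) : ℝ), train h (m + 1) t = train h m t := by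
    intro t ht
    funext x
    rw [train, Finset.sum_range_succ, ← train, impulse_of_neg h (by linarith), add_zero]
  rw [h1, evol_congr (φ := trainSol α p G h (m + 1)) (ψ := trainSol α p G h m)
    fun r hr => minSol_congr h2 hr]
  ring

lemma evol_cumH_le (D : BranchingData α p G κ a₀ C₂) {U : ℝ → PosReal → ℝ} (hU : IsPath U)
    (h0 : ∀ t x, 0 ≤ U t x) (t : ℝ) (x : PosReal) :
    evol (cumH α p G) U t x ≤ evol (linH G fun y => α y * genFunDeriv p y) U t x := by
  refine integral_mono (D.admissible.integrableOn hU h0 t x) (D.subcrit.integrableOn_lin hU t x)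
    fun s => ?_
  obtain ⟨B, hB⟩ := hU.locBdd (t - s)
  exact cumH_le_linH D.rate_nonneg D.offspring (hU.slice _) (h0 _)
    (fun x => (le_abs_self _).trans (hB _ le_rfl x)) _

/-- The quadratic error of `le_cumH` is accumulated over a range of `s` of length `x`, whence the
factor `x`. -/
lemma le_evol_cumH (D : BranchingData α p G κ a₀ C₂) {U : ℝ → PosReal → ℝ} (hU : IsPath U)
    (h0 : ∀ t x, 0 ≤ U t x) {S : ℝ} (hS : ∀ t, ∫ z, U t z ^ 2 ∂G ≤ S) (t : ℝ) (x : PosReal) :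
    evol (linH G fun y => α y * genFunDeriv p y) U t x - (κ + a₀ * C₂) * S * x ≤
      evol (cumH α p G) U t x := by
  have hx : (0 : ℝ) < x := x.2
  have hc : 0 ≤ κ + a₀ * C₂ := add_nonneg D.subcrit.bound_nonneg
    (mul_nonneg ((D.rate_nonneg x).trans (D.rate_le x)) D.second_nonneg)
  have hi := integrableOn_indicator_const (x : ℝ) ((κ + a₀ * C₂) * S)
  rw [← setIntegral_indicator_Ico hx.le ((κ + a₀ * C₂) * S), evol, evol,
    ← integral_sub (D.subcrit.integrableOn_lin hU t x) hi]
  refine setIntegral_mono_on ((D.subcrit.integrableOn_lin hU t x).sub hi)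
    (D.admissible.integrableOn hU h0 t x) measurableSet_Ioi fun s hs => ?_
  have hs' : (0 : ℝ) < s := hs
  obtain ⟨B, hB⟩ := hU.locBdd (t - s)
  have h1 := le_cumH D.rate_nonneg D.rate_le D.offspring D.subcrit D.second_nonneg D.second
    (hU.slice (t - s)) (h0 _) (fun x => (le_abs_self _).trans (hB _ le_rfl x)) (x - s)
  have h2 := zeroExt_sub_le_indicator
    (h := fun _ : PosReal => (κ + a₀ * C₂) * ∫ z, U (t - s) z ^ 2 ∂G)
    (fun _ => mul_le_mul_of_nonneg_left (hS (t - s)) hc) (x : ℝ) hs'.le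
  linarith

/-- Comparison with the linear equation, with source bound `C(x+1)` from `train_le`. The result is
uniform in `m` and `t` and proportional to `C`, so impulses of size `ε` produce a cumulant of order
`ε`. -/
lemma BranchingData.trainSol_le (D : BranchingData α p G κ a₀ C₂) (hm : Measurable h)
    (h0 : ∀ x, 0 ≤ h x) (hC : ∀ x, h x ≤ C) (m : ℕ) (t : ℝ) (x : PosReal) :
    trainSol α p G h m t x ≤ C * (1 + κ * ((∫ z : PosReal, ((z : ℝ) + 1) ∂G) /
      (1 - ∫ z, potK (fun y => α y * genFunDeriv p y) z ∂G))) * (x + 1) := by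
  have hU := D.trainSol_isSol hm h0 hC m
  have hk := D.subcrit
  have hx : (0 : ℝ) < x := x.2
  have hC0 : 0 ≤ C := (h0 x).trans (hC x)
  have hi : Integrable (fun z : PosReal => C * ((z : ℝ) + 1)) G :=
    (hk.integrable_coe.add (integrable_const 1)).const_mul C
  have h1 := hk.comparison hU.path hi (fun z => mul_nonneg hC0 (by linarith [z.2.out]))
    (fun t _ x => by
      rw [hU.eqn]
      exact add_le_add (train_le h0 hC m t x) (evol_cumH_le D hU.path hU.nonneg t x)) t x
  rw [integral_const_mul] at h1
  have hm1 : 0 ≤ ∫ z : PosReal, ((z : ℝ) + 1) ∂G := integral_nonneg fun z =>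
    add_nonneg (le_of_lt z.2) zero_le_one
  have hM0 := div_nonneg hm1 (sub_nonneg.2 hk.integral_potK_lt_one.le)
  rw [mul_div_assoc] at h1
  set M := (∫ z : PosReal, ((z : ℝ) + 1) ∂G) /
      (1 - ∫ z, potK (fun y => α y * genFunDeriv p y) z ∂G) with hM
  have h2 : potK (fun y => α y * genFunDeriv p y) x * (C * M) ≤ κ * (x + 1) * (C * M) := by
    refine mul_le_mul_of_nonneg_right ((hk.potK_le x).trans ?_) (mul_nonneg hC0 hM0)
    nlinarith [hk.bound_nonneg]
  calc _ ≤ _ := h1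
    _ ≤ C * (x + 1) + κ * (x + 1) * (C * M) := by linarith
    _ = _ := by ring

/-- The cumulant driven by small impulses is close to the superposition of mean paths. -/
lemma BranchingData.exists_le_trainSol (D : BranchingData α p G κ a₀ C₂) {f : PosReal → ℝ}
    (hm : Measurable f) (h0 : ∀ x, 0 ≤ f x) (hC : ∀ x, f x ≤ C) :
    ∃ B : ℝ, 0 ≤ B ∧ ∀ ε : ℝ, 0 ≤ ε → ∀ (m : ℕ) (t : ℝ) (x : PosReal),
      ε * (∑ i ∈ Finset.range (m + 1), meanPath G (fun y => α y * genFunDeriv p y) f (t - i) x) -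
        ε ^ 2 * (B * x) ≤ trainSol α p G (fun z => ε * f z) m t x := by
  have hk := D.subcrit
  set k := fun y => α y * genFunDeriv p y with hkdef
  have hC0 : 0 ≤ C := (h0 ⟨1, Set.mem_Ioi.2 one_pos⟩).trans (hC _)
  have hρ := hk.integral_potK_lt_one
  have hm1 : 0 ≤ ∫ z : PosReal, ((z : ℝ) + 1) ∂G := integral_nonneg fun z =>
    add_nonneg (le_of_lt z.2) zero_le_one
  have hm1' : 0 ≤ ∫ z : PosReal, (z : ℝ) ∂G := integral_nonneg fun z => le_of_lt z.2
  -- `ε A (x+1)` bounds the cumulant, `ε² S` its squared `G`-norm, and `ε² E x` the resulting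
  -- deviation of `evol` from its linearization.
  set A := C * (1 + κ * ((∫ z : PosReal, ((z : ℝ) + 1) ∂G) / (1 - ∫ z, potK k z ∂G))) with hA
  have hA0 : 0 ≤ A := mul_nonneg hC0 (add_nonneg zero_le_one (mul_nonneg hk.bound_nonneg
    (div_nonneg hm1 (by linarith))))
  set S := A ^ 2 * ∫ z : PosReal, ((z : ℝ) + 1) ^ 2 ∂G with hS
  have hS0 : 0 ≤ S := mul_nonneg (sq_nonneg _) (integral_nonneg fun z => sq_nonneg _)
  have hi2 : Integrable (fun z : PosReal => ((z : ℝ) + 1) ^ 2) G := by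
    have : (fun z : PosReal => ((z : ℝ) + 1) ^ 2) = fun z : PosReal =>
        (z : ℝ) ^ 2 + (2 * (z : ℝ) + 1) := by funext z; ring
    rw [this]
    exact hk.sq_integrable.add ((hk.integrable_coe.const_mul 2).add (integrable_const 1))
  have hc : 0 ≤ κ + a₀ * C₂ := add_nonneg hk.bound_nonneg
    (mul_nonneg ((D.rate_nonneg ⟨1, Set.mem_Ioi.2 one_pos⟩).trans (D.rate_le _)) D.second_nonneg)
  set E := (κ + a₀ * C₂) * S with hE
  have hE0 : 0 ≤ E := mul_nonneg hc hS0
  set M := (∫ z : PosReal, (z : ℝ) ∂G) / (1 - ∫ z, potK k z ∂G) with hM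
  have hM0 : 0 ≤ M := div_nonneg hm1' (by linarith)
  -- The value of `B` comes from the comparison principle with `c(x) = ε² E x`: it returns `ε² E (x
  -- + K(x) M)`, and `K(x) ≤ κ x`.
  refine ⟨E * (1 + κ * M), mul_nonneg hE0 (add_nonneg zero_le_one
    (mul_nonneg hk.bound_nonneg hM0)), fun ε hε m t x => ?_⟩
  have hmε : Measurable (fun z => ε * f z) := hm.const_mul ε
  have h0ε : ∀ z, 0 ≤ ε * f z := fun z => mul_nonneg hε (h0 z)
  have hCε : ∀ z, ε * f z ≤ ε * C := fun z => mul_le_mul_of_nonneg_left (hC z) hε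
  have hU := D.trainSol_isSol hmε h0ε hCε m
  set U := trainSol α p G (fun z => ε * f z) m with hUdef
  have hUle : ∀ t x, U t x ≤ ε * A * (x + 1) := fun t x => by
    have := D.trainSol_le hmε h0ε hCε m t x
    rwa [mul_assoc ε C] at this
  have hsq : ∀ t, ∫ z, U t z ^ 2 ∂G ≤ ε ^ 2 * S := by
    intro t
    rw [hS, ← mul_assoc, ← mul_pow, ← integral_const_mul]
    refine integral_mono_of_nonneg (ae_of_all _ fun z => sq_nonneg _) (hi2.const_mul _)
      (ae_of_all _ fun z => ?_)
    simp only
    rw [← mul_pow]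
    exact pow_le_pow_left₀ (hU.nonneg t z) (hUle t z) 2
  have hπ := meanPath_isMeanPath hk hm h0 hC
  have hπi : ∀ i : ℕ, IsPath (fun t x => meanPath G k f (t - i) x) := fun i =>
    hπ.path.shift (Nat.cast_nonneg i)
  have hsum : IsPath (fun t x => ∑ i ∈ Finset.range (m + 1), meanPath G k f (t - i) x) :=
    IsPath.finset_sum _ hπi
  have hV := hsum.const_mul ε
  -- The superposition of shifted mean paths solves the linear equation with the same source, so the
  -- source cancels when the cumulant is subtracted.
  have hVeq : ∀ t x, ε * (∑ i ∈ Finset.range (m + 1), meanPath G k f (t - i) x) =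
      train (fun z => ε * f z) m t x + evol (linH G k)
        (fun t x => ε * ∑ i ∈ Finset.range (m + 1), meanPath G k f (t - i) x) t x := by
    intro t x
    rw [evol_const_mul, hk.evol_finset_sum _ hπi, train, Finset.mul_sum, Finset.mul_sum,
      ← Finset.sum_add_distrib]
    refine Finset.sum_congr rfl fun i _ => ?_
    rw [evol_shift, hπ.eqn]
    have : impulse (fun z => ε * f z) (t - i) x = ε * impulse f (t - i) x := by
      unfold impulse
      split_ifs
      · exact zeroExt_const_mul _ _ _
      · ring
    rw [this]
    ring
  have hcmp := hk.comparison (hV.sub hU.path) (c := fun z => ε ^ 2 * E * (z : ℝ))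
    (hk.integrable_coe.const_mul _)
    (fun z => mul_nonneg (mul_nonneg (sq_nonneg ε) hE0) (le_of_lt z.2)) (fun t _ x => by
      rw [hk.evol_sub hV hU.path, hVeq t x, hU.eqn t x]
      have := le_evol_cumH D hU.path hU.nonneg hsq t x
      rw [hE]
      linarith) t x
  rw [integral_const_mul, mul_div_assoc, ← hM] at hcmp
  have h2 : potK k x * (ε ^ 2 * E * M) ≤ κ * x * (ε ^ 2 * E * M) :=
    mul_le_mul_of_nonneg_right (hk.potK_le x) (mul_nonneg (mul_nonneg (sq_nonneg ε) hE0) hM0)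
  linarith

/-- Cumulants are dominated by mean paths. -/
lemma BranchingData.cumulant_le (D : BranchingData α p G κ a₀ C₂) {f : PosReal → ℝ}
    (hm : Measurable f) (h0 : ∀ x, 0 ≤ f x) (hC : ∀ x, f x ≤ C) {ε : ℝ} (hε : 0 ≤ ε) (t : ℝ)
    (x : PosReal) : trainSol α p G (fun z => ε * f z) 0 t x ≤
      ε * meanPath G (fun y => α y * genFunDeriv p y) f t x := by
  have hk := D.subcrit
  have hU := D.trainSol_isSol (hm.const_mul ε) (fun z => mul_nonneg hε (h0 z))
    (fun z => mul_le_mul_of_nonneg_left (hC z) hε) 0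
  have hπ := meanPath_isMeanPath hk hm h0 hC
  have := hk.nonpos_of_le_evol (hU.path.sub (hπ.path.const_mul ε)) (fun t ht x => by
    rw [hk.evol_sub hU.path (hπ.path.const_mul ε), evol_const_mul, hU.eqn t x, hπ.eqn t x]
    have h1 := evol_cumH_le D hU.path hU.nonneg t x
    have h2 : train (fun z => ε * f z) 0 t x = ε * impulse f t x := by
      simp only [train, zero_add, Finset.range_one, Finset.sum_singleton, Nat.cast_zero, sub_zero]
      rw [impulse_of_nonneg _ ht, impulse_of_nonneg _ ht, zeroExt_const_mul]
    rw [h2]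
    linarith) t x
  linarith

end TrainSol

/-! ### Counting measures -/

instance CountMeas.isFiniteMeasure_toMeas (ν : CountMeas) : IsFiniteMeasure ν.toMeas :=
  ν.1.isFiniteMeasure

lemma measurable_toMeas : Measurable CountMeas.toMeas :=
  measurable_subtype_coe.comp measurable_subtype_coe

/-- The tautological kernel `ν ↦ ν`. -/
noncomputable def countKernel : Kernel CountMeas PosReal where
  toFun := CountMeas.toMeas
  measurable' := measurable_toMeas

/-- The total masses are natural numbers, so the kernel is the sum of its restrictions to the sets
where the mass equals `n`, each of them a finite kernel with bound `n`. -/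
instance : IsSFiniteKernel countKernel := by
  classical
  have hs : ∀ n : ℕ, MeasurableSet {ν : CountMeas | ν.toMeas Set.univ = n} := fun n =>
    (measurableSet_singleton (n : ℝ≥0∞)).preimage
      ((Measure.measurable_coe MeasurableSet.univ).comp measurable_toMeas)
  refine ⟨⟨fun n => Kernel.piecewise (hs n) countKernel 0, fun n => ?_, ?_⟩⟩
  · refine ⟨⟨n, ENNReal.natCast_lt_top n, fun ν => ?_⟩⟩
    rw [Kernel.piecewise_apply]
    split_ifs with h
    · exact le_of_eq h
    · simp
  · ext ν s hsm
    obtain ⟨n, hn⟩ := ν.2 Set.univ MeasurableSet.univ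
    have hn' : ν.toMeas Set.univ = n := hn
    rw [Kernel.sum_apply' _ _ hsm, tsum_eq_single n]
    · simp [Kernel.piecewise_apply, hn']
    · intro m hm
      rw [Kernel.piecewise_apply, if_neg]
      · simp
      · simp only [Set.mem_ofPred_eq, hn', Nat.cast_inj]
        exact fun h => hm h.symm

lemma measurable_pairing_uncurry {β : Type*} [MeasurableSpace β] {h : β → PosReal → ℝ}
    (hh : Measurable (Function.uncurry h)) :
    Measurable (fun q : β × CountMeas => pairing q.2 (h q.1)) := by
  have h1 : Measurable (Function.uncurry fun (q : β × CountMeas) (x : PosReal) => h q.1 x) :=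
    hh.comp ((measurable_fst.comp measurable_fst).prodMk measurable_snd)
  exact (h1.stronglyMeasurable.integral_kernel_prod_right
    (κ := countKernel.comap Prod.snd measurable_snd)).measurable

lemma measurable_pairing {f : PosReal → ℝ} (hf : Measurable f) :
    Measurable (fun ν => pairing ν f) := by
  have := measurable_pairing_uncurry (β := Unit) (h := fun _ => f) (hf.comp measurable_snd)
  exact this.comp (measurable_const (a := ()).prodMk measurable_id)

lemma pairing_nonneg (ν : CountMeas) {f : PosReal → ℝ} (hf : ∀ x, 0 ≤ f x) : 0 ≤ pairing ν f :=
  integral_nonneg hf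

lemma integrable_toMeas (ν : CountMeas) {f : PosReal → ℝ} (hf : Measurable f) {C : ℝ}
    (hC : ∀ x, |f x| ≤ C) : Integrable f ν.toMeas :=
  Integrable.of_bound hf.aestronglyMeasurable C (ae_of_all _ hC)

/-- Evaluation along a process with right-continuous paths is jointly measurable. -/
lemma measurable_path {Ω : Type*} [MeasurableSpace Ω] {Y : ℝ≥0 → Ω → CountMeas}
    (hY : ∀ t, Measurable (Y t))
    (hc : ∀ ω t, ContinuousWithinAt (fun s => Y s ω) (Set.Ici t) t) :
    Measurable (fun q : ℝ≥0 × Ω => Y q.1 q.2) := by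
  -- The times `d n s = (⌊s(n+1)⌋+1)/(n+1)` approach `s` from the right and take countably many
  -- values, so right continuity turns the path into a limit of jointly measurable step processes.
  obtain ⟨e, he⟩ : ∃ e : ℕ → ℕ → ℝ≥0, ∀ n i, e n i = ((i : ℝ≥0) + 1) / (n + 1) :=
    ⟨_, fun _ _ => rfl⟩
  obtain ⟨d, hd⟩ : ∃ d : ℕ → ℝ≥0 → ℝ≥0, ∀ n s, d n s = e n ⌊s * (n + 1)⌋₊ := ⟨_, fun _ _ => rfl⟩
  have hds : ∀ n s, s ≤ d n s := fun n s => by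
    rw [hd, he, le_div_iff₀ (by positivity)]
    exact (Nat.lt_floor_add_one _).le
  have hdt : ∀ s, Tendsto (fun n => d n s) atTop (𝓝[≥] s) := by
    intro s
    refine tendsto_nhdsWithin_iff.2 ⟨?_, Eventually.of_forall fun n => hds n s⟩
    have hup : ∀ n, d n s ≤ s + 1 / (n + 1) := fun n => by
      rw [hd, he, div_le_iff₀ (by positivity), add_mul, div_mul_cancel₀ _ (by positivity)]
      gcongr
      exact Nat.floor_le zero_le
    refine tendsto_of_tendsto_of_tendsto_of_le_of_le tendsto_const_nhds ?_ (fun n => hds n s) hup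
    have h0 : Tendsto (fun n : ℕ => (1 : ℝ≥0) / (n + 1)) atTop (𝓝 0) :=
      tendsto_one_div_add_atTop_nhds_zero_nat
    simpa using h0.const_add s
  have hstep : ∀ n, Measurable (fun q : ℝ≥0 × Ω => Y (d n q.1) q.2) := by
    intro n
    have h1 : Measurable (fun r : ℕ × Ω => Y (e n r.1) r.2) :=
      measurable_from_prod_countable_right fun i => hY (e n i)
    have h2 : Measurable (fun q : ℝ≥0 × Ω => (⌊q.1 * (n + 1)⌋₊, q.2)) :=
      (Nat.measurable_floor.comp (measurable_fst.mul_const _)).prodMk measurable_snd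
    simp_rw [hd]
    exact h1.comp h2
  have hbcf : ∀ g : BoundedContinuousFunction PosReal ℝ≥0,
      Measurable (fun q : ℝ≥0 × Ω => ∫⁻ x, g x ∂(Y q.1 q.2).toMeas) := by
    intro g
    refine measurable_of_tendsto_metrizable
      (f := fun n (q : ℝ≥0 × Ω) => ∫⁻ x, g x ∂(Y (d n q.1) q.2).toMeas) (fun n => ?_) ?_
    · exact (Measure.measurable_lintegral g.continuous.measurable.coe_nnreal_ennreal).comp
        (measurable_toMeas.comp (hstep n))
    · rw [tendsto_pi_nhds]
      intro q
      have h1 : Tendsto (fun n => Y (d n q.1) q.2) atTop (𝓝 (Y q.1 q.2)) :=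
        (hc q.2 q.1).tendsto.comp (hdt q.1)
      have h2 : Tendsto (fun n => (Y (d n q.1) q.2).1) atTop (𝓝 (Y q.1 q.2).1) :=
        (continuous_subtype_val.tendsto _).comp h1
      exact (FiniteMeasure.tendsto_iff_forall_lintegral_tendsto.1 h2) g
  -- Weak convergence controls only integrals of bounded continuous functions. Closed sets follow by
  -- outer approximation, and they form a π-system generating the Borel sets.
  have hclosed : ∀ F : Set PosReal, IsClosed F →
      Measurable (fun q : ℝ≥0 × Ω => (Y q.1 q.2).toMeas F) := by
    intro F hF
    refine measurable_of_tendsto_metrizable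
      (f := fun n (q : ℝ≥0 × Ω) => ∫⁻ x, hF.apprSeq n x ∂(Y q.1 q.2).toMeas)
      (fun n => hbcf _) ?_
    rw [tendsto_pi_nhds]
    exact fun q => HasOuterApproxClosed.tendsto_lintegral_apprSeq hF _
  have hmeas : Measurable (fun q : ℝ≥0 × Ω => (Y q.1 q.2).toMeas) :=
    Measurable.measure_of_isPiSystem
      (by rw [BorelSpace.measurable_eq (α := PosReal), borel_eq_generateFrom_isClosed])
      isPiSystem_isClosed hclosed (hclosed _ isClosed_univ)
  exact (hmeas.subtype_mk).subtype_mk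

/-! ### The immigration exponent -/

lemma pairing_mono (ν : CountMeas) {f g : PosReal → ℝ} (hf : Integrable f ν.toMeas)
    (hg : Integrable g ν.toMeas) (h : ∀ x, f x ≤ g x) : pairing ν f ≤ pairing ν g :=
  integral_mono hf hg h

lemma abs_pairing_le (ν : CountMeas) {f : PosReal → ℝ} {C : ℝ} (hC : ∀ x, |f x| ≤ C) :
    |pairing ν f| ≤ C * ν.toMeas.real Set.univ := by
  rw [← Real.norm_eq_abs, pairing]
  exact norm_integral_le_of_norm_le_const (ae_of_all _ hC)

section Immigration

variable {L : Measure CountMeas} [IsFiniteMeasure L]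

lemma integrable_mass (hL : ∫⁻ ν, ν.toMeas Set.univ ∂L < ∞) :
    Integrable (fun ν : CountMeas => ν.toMeas.real Set.univ) L := by
  refine integrable_toReal_of_lintegral_ne_top ?_ hL.ne
  exact ((Measure.measurable_coe MeasurableSet.univ).comp measurable_toMeas).aemeasurable

lemma integrable_pairing (hL : ∫⁻ ν, ν.toMeas Set.univ ∂L < ∞) {f : PosReal → ℝ}
    (hf : Measurable f) {C : ℝ} (hC : ∀ x, |f x| ≤ C) : Integrable (fun ν => pairing ν f) L :=
  Integrable.mono' ((integrable_mass hL).const_mul C) (measurable_pairing hf).aestronglyMeasurable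
    (ae_of_all _ fun ν => abs_pairing_le ν hC)

lemma one_sub_exp_neg_mem {y : ℝ} (hy : 0 ≤ y) : 0 ≤ 1 - Real.exp (-y) ∧ 1 - Real.exp (-y) ≤ 1 :=
  ⟨by linarith [Real.exp_le_one_iff.2 (neg_nonpos.2 hy)], by linarith [Real.exp_pos (-y)]⟩

lemma integrable_immExponent {f : PosReal → ℝ} (hf : Measurable f) (h0 : ∀ x, 0 ≤ f x) :
    Integrable (fun ν => 1 - Real.exp (-pairing ν f)) L :=
  Integrable.of_bound (measurable_const.sub (measurable_pairing hf).neg.exp).aestronglyMeasurable 1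
    (ae_of_all _ fun ν => by
      have := one_sub_exp_neg_mem (pairing_nonneg ν h0)
      rw [Real.norm_of_nonneg this.1]
      exact this.2)

lemma immExponent_nonneg {f : PosReal → ℝ} (h0 : ∀ x, 0 ≤ f x) : 0 ≤ immExponent L f :=
  integral_nonneg fun ν => (one_sub_exp_neg_mem (pairing_nonneg ν h0)).1

lemma immExponent_le {f : PosReal → ℝ} (h0 : ∀ x, 0 ≤ f x) :
    immExponent L f ≤ L.real Set.univ := by
  have := norm_integral_le_of_norm_le_const (μ := L) (f := fun ν => 1 - Real.exp (-pairing ν f))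
    (C := 1) (ae_of_all _ fun ν => by
      have := one_sub_exp_neg_mem (pairing_nonneg ν h0)
      rw [Real.norm_of_nonneg this.1]
      exact this.2)
  rw [one_mul] at this
  exact (le_abs_self _).trans this

lemma immExponent_mono {f g : PosReal → ℝ} (hf : Measurable f) (hg : Measurable g)
    (h0 : ∀ x, 0 ≤ f x) (h : ∀ x, f x ≤ g x) {C : ℝ} (hC : ∀ x, g x ≤ C) :
    immExponent L f ≤ immExponent L g := by
  have h0' : ∀ x, 0 ≤ g x := fun x => (h0 x).trans (h x)
  refine integral_mono (integrable_immExponent hf h0) (integrable_immExponent hg h0') fun ν => ?_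
  have := pairing_mono ν (integrable_of_le hf h0 fun x => (h x).trans (hC x))
    (integrable_of_le hg h0' hC) h
  have := Real.exp_le_exp.2 (neg_le_neg this)
  simp only
  linarith

lemma immExponent_le_integral (hL : ∫⁻ ν, ν.toMeas Set.univ ∂L < ∞) {f : PosReal → ℝ} {C : ℝ}
    (hf : Measurable f) (h0 : ∀ x, 0 ≤ f x) (hC : ∀ x, f x ≤ C) :
    immExponent L f ≤ ∫ ν, pairing ν f ∂L := by
  refine integral_mono (integrable_immExponent hf h0)
    (integrable_pairing hL hf (C := C) fun x => by rw [abs_of_nonneg (h0 x)]; exact hC x)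
    fun ν => ?_
  have := Real.add_one_le_exp (-pairing ν f)
  simp only
  linarith

lemma measurable_immExponent {V : ℝ → PosReal → ℝ} (hV : Measurable (Function.uncurry V)) :
    Measurable (fun s => immExponent L (V s)) :=
  ((measurable_const.sub (measurable_pairing_uncurry hV).neg.exp).stronglyMeasurable.integral_prod_right'
    (ν := L)).measurable

lemma measurable_integral_pairing {V : ℝ → PosReal → ℝ} (hV : Measurable (Function.uncurry V)) :
    Measurable (fun s => ∫ ν, pairing ν (V s) ∂L) :=
  ((measurable_pairing_uncurry hV).stronglyMeasurable.integral_prod_right' (ν := L)).measurable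

lemma intervalIntegrable_immExponent {V : ℝ → PosReal → ℝ} (hV : Measurable (Function.uncurry V))
    (h0 : ∀ t x, 0 ≤ V t x) (a b : ℝ) :
    IntervalIntegrable (fun s => immExponent L (V s)) volume a b := by
  rw [intervalIntegrable_iff]
  exact Measure.integrableOn_of_bounded (M := L.real Set.univ) (by simp)
    (measurable_immExponent hV).aestronglyMeasurable
    (ae_of_all _ fun s => by
      rw [Real.norm_of_nonneg (immExponent_nonneg (h0 s))]; exact immExponent_le (h0 s))

lemma IsPath.intervalIntegrable_integral_pairing (hL : ∫⁻ ν, ν.toMeas Set.univ ∂L < ∞)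
    {V : ℝ → PosReal → ℝ} (hV : IsPath V) (a b : ℝ) :
    IntervalIntegrable (fun s => ∫ ν, pairing ν (V s) ∂L) volume a b := by
  obtain ⟨C, hC⟩ := hV.locBdd (max a b)
  rw [intervalIntegrable_iff]
  refine Measure.integrableOn_of_bounded (M := ∫ ν, C * ν.toMeas.real Set.univ ∂L) (by simp)
    (measurable_integral_pairing hV.measurable).aestronglyMeasurable ?_
  refine (ae_restrict_iff' measurableSet_uIoc).2 (ae_of_all _ fun s hs => ?_)
  exact norm_integral_le_of_norm_le ((integrable_mass hL).const_mul C)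
    (ae_of_all _ fun ν => abs_pairing_le ν (hC s hs.2))

/-- From `y - y² ≤ 1 - e^{-y} ≤ y` for `y ≥ 0`: the quadratic loss is `t y² = (t y)²/t`, which
vanishes because `t y` converges. -/
lemma tendsto_mul_one_sub_exp_neg {y : ℝ → ℝ} {l : ℝ} (h0 : ∀ t, 0 ≤ y t)
    (h : Tendsto (fun t => t * y t) atTop (𝓝 l)) :
    Tendsto (fun t => t * (1 - Real.exp (-y t))) atTop (𝓝 l) := by
  have hlow : Tendsto (fun t => t * y t - (t * y t) ^ 2 * t⁻¹) atTop (𝓝 l) := by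
    simpa using h.sub ((h.pow 2).mul tendsto_inv_atTop_zero)
  refine tendsto_of_tendsto_of_tendsto_of_le_of_le' hlow h ?_ ?_
  · filter_upwards [eventually_gt_atTop 0] with t ht
    have hy := h0 t
    have h3 : Real.exp (-y t) ≤ 1 / (1 + y t) := by
      rw [Real.exp_neg, ← one_div]
      exact one_div_le_one_div_of_le (by linarith) (by linarith [Real.add_one_le_exp (y t)])
    have h4 : 1 / (1 + y t) ≤ 1 - y t + y t ^ 2 := by
      rw [div_le_iff₀ (by linarith)]
      nlinarith [pow_nonneg hy 3]
    have h5 : t * y t - (t * y t) ^ 2 * t⁻¹ = t * (y t - y t ^ 2) := by field_simp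
    rw [h5]
    exact mul_le_mul_of_nonneg_left (by linarith) ht.le
  · filter_upwards [eventually_gt_atTop 0] with t ht
    exact mul_le_mul_of_nonneg_left (by linarith [Real.add_one_le_exp (-y t)]) ht.le

/-- The truncated first-order lower bound for the cumulant. -/
noncomputable def lowerPath (S : ℝ → PosReal → ℝ) (B ε : ℝ) (s : ℝ) (x : PosReal) : ℝ :=
  max 0 (ε * S s x - ε ^ 2 * (B * x))

lemma lowerPath_nonneg (S : ℝ → PosReal → ℝ) (B ε s : ℝ) (x : PosReal) :
    0 ≤ lowerPath S B ε s x := le_max_left _ _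

lemma lowerPath_le {S : ℝ → PosReal → ℝ} (hS : ∀ t x, 0 ≤ S t x) {B ε : ℝ} (hB : 0 ≤ B)
    (hε : 0 ≤ ε) (s : ℝ) (x : PosReal) : lowerPath S B ε s x ≤ ε * S s x := by
  have hx : (0 : ℝ) < x := x.2
  refine max_le (mul_nonneg hε (hS s x)) ?_
  have : 0 ≤ ε ^ 2 * (B * x) := by positivity
  linarith

lemma measurable_lowerPath {S : ℝ → PosReal → ℝ} (hS : IsPath S) (B ε : ℝ) :
    Measurable (Function.uncurry (lowerPath S B ε)) :=
  measurable_const.max ((hS.measurable.const_mul ε).sub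
    (((measurable_subtype_coe.comp measurable_snd).const_mul B).const_mul (ε ^ 2)))

/-- With `ε = 1/t` the rescaled path is `max 0 (S - Bx/t)`. The truncation at `0` keeps it dominated
by the bounded function `S`, although the correction `Bx` is unbounded. -/
lemma tendsto_pairing_lowerPath {S : ℝ → PosReal → ℝ} (hS : IsPath S) (h0 : ∀ t x, 0 ≤ S t x)
    {B : ℝ} (hB : 0 ≤ B) (s : ℝ) (ν : CountMeas) :
    Tendsto (fun t : ℝ => t * pairing ν (lowerPath S B t⁻¹ s)) atTop (𝓝 (pairing ν (S s))) := by
  obtain ⟨C, hC⟩ := hS.locBdd s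
  simp only [pairing, ← integral_const_mul]
  refine tendsto_integral_filter_of_dominated_convergence (S s) ?_ ?_
    (integrable_toMeas ν (hS.slice s) (hC s le_rfl)) (ae_of_all _ fun x => ?_)
  · exact Eventually.of_forall fun t => ((((measurable_lowerPath hS B t⁻¹).comp
      (measurable_const.prodMk measurable_id)).const_mul t)).aestronglyMeasurable
  · filter_upwards [eventually_gt_atTop 0] with t ht
    refine ae_of_all _ fun x => ?_
    rw [Real.norm_of_nonneg (mul_nonneg ht.le (lowerPath_nonneg _ _ _ _ _))]
    calc t * lowerPath S B t⁻¹ s x ≤ t * (t⁻¹ * S s x) :=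
          mul_le_mul_of_nonneg_left (lowerPath_le h0 hB (inv_nonneg.2 ht.le) s x) ht.le
      _ = S s x := by field_simp
  · have h1 : Tendsto (fun t : ℝ => max 0 (S s x - t⁻¹ * (B * x))) atTop (𝓝 (S s x)) := by
      have h2 : Tendsto (fun t : ℝ => S s x - t⁻¹ * (B * x)) atTop (𝓝 (S s x)) := by
        simpa using (tendsto_inv_atTop_zero.mul_const (B * (x : ℝ))).const_sub (S s x)
      simpa [max_eq_right (h0 s x)] using (tendsto_const_nhds (x := (0 : ℝ))).max h2
    refine h1.congr' ?_
    filter_upwards [eventually_gt_atTop 0] with t ht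
    rw [lowerPath, mul_max_of_nonneg _ _ ht.le, mul_zero]
    congr 1
    field_simp

/-- First-order expansion of the immigration exponent. -/
lemma tendsto_immExponent_lowerPath (hL : ∫⁻ ν, ν.toMeas Set.univ ∂L < ∞) {S : ℝ → PosReal → ℝ}
    (hS : IsPath S) (h0 : ∀ t x, 0 ≤ S t x) {B : ℝ} (hB : 0 ≤ B) :
    Tendsto (fun t : ℝ => t * ∫ s in (0 : ℝ)..1, immExponent L (lowerPath S B t⁻¹ s)) atTop
      (𝓝 (∫ s in (0 : ℝ)..1, ∫ ν, pairing ν (S s) ∂L)) := by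
  obtain ⟨C, hC⟩ := hS.locBdd 1
  -- This bound holds for every `t > 0` and dominates both the integral over `ν` and the one over
  -- `s`.
  have hbound : ∀ t : ℝ, 0 < t → ∀ s ν, t * (1 - Real.exp (-pairing ν (lowerPath S B t⁻¹ s))) ≤
      pairing ν (S s) := by
    intro t ht s ν
    obtain ⟨D, hD⟩ := hS.locBdd s
    have hle := lowerPath_le h0 hB (inv_nonneg.2 ht.le) s
    have h1 : pairing ν (lowerPath S B t⁻¹ s) ≤ t⁻¹ * pairing ν (S s) := by
      rw [pairing, pairing, ← integral_const_mul]
      have hi := (integrable_toMeas ν (hS.slice s) (hD s le_rfl)).const_mul t⁻¹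
      exact integral_mono_of_nonneg (ae_of_all _ (lowerPath_nonneg _ _ _ _)) hi (ae_of_all _ hle)
    calc t * (1 - Real.exp (-pairing ν (lowerPath S B t⁻¹ s)))
        ≤ t * (t⁻¹ * pairing ν (S s)) := by
          refine mul_le_mul_of_nonneg_left ?_ ht.le
          linarith [Real.add_one_le_exp (-pairing ν (lowerPath S B t⁻¹ s))]
      _ = pairing ν (S s) := by field_simp
  have hnonneg : ∀ t : ℝ, 0 < t → ∀ s ν,
      0 ≤ t * (1 - Real.exp (-pairing ν (lowerPath S B t⁻¹ s))) := fun t ht s ν =>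
    mul_nonneg ht.le (one_sub_exp_neg_mem (pairing_nonneg ν (lowerPath_nonneg _ _ _ _))).1
  have hslice : ∀ t s, Measurable (lowerPath S B t⁻¹ s) := fun t s =>
    (measurable_lowerPath hS B t⁻¹).comp (measurable_const.prodMk measurable_id)
  simp only [← intervalIntegral.integral_const_mul]
  refine intervalIntegral.tendsto_integral_filter_of_dominated_convergence
    (fun _ => ∫ ν, C * ν.toMeas.real Set.univ ∂L) ?_ ?_ intervalIntegrable_const ?_
  · exact Eventually.of_forall fun t =>
      ((measurable_immExponent (measurable_lowerPath hS B t⁻¹)).const_mul t).aestronglyMeasurable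
  · filter_upwards [eventually_gt_atTop 0] with t ht
    refine ae_of_all _ fun s hs => ?_
    rw [Set.uIoc_of_le zero_le_one] at hs
    rw [immExponent, ← integral_const_mul]
    refine norm_integral_le_of_norm_le ((integrable_mass hL).const_mul C) (ae_of_all _ fun ν => ?_)
    rw [Real.norm_of_nonneg (hnonneg t ht s ν)]
    exact (hbound t ht s ν).trans ((le_abs_self _).trans (abs_pairing_le ν (hC s hs.2)))
  · refine ae_of_all _ fun s hs => ?_
    rw [Set.uIoc_of_le zero_le_one] at hs
    simp only [immExponent, ← integral_const_mul]
    refine tendsto_integral_filter_of_dominated_convergence (fun ν => pairing ν (S s)) ?_ ?_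
      (integrable_pairing hL (hS.slice s) (hC s hs.2)) (ae_of_all _ fun ν => ?_)
    · exact Eventually.of_forall fun t => ((measurable_const.sub
        (measurable_pairing (hslice t s)).neg.exp).const_mul t).aestronglyMeasurable
    · filter_upwards [eventually_gt_atTop 0] with t ht
      refine ae_of_all _ fun ν => ?_
      rw [Real.norm_of_nonneg (hnonneg t ht s ν)]
      exact hbound t ht s ν
    · exact tendsto_mul_one_sub_exp_neg
        (fun t => pairing_nonneg ν (lowerPath_nonneg _ _ _ _))
        (tendsto_pairing_lowerPath hS h0 hB s ν)

end Immigration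

/-! ### Laplace functionals along the process -/

section MarkovProcess

variable {G : Measure PosReal} [IsProbabilityMeasure G] {α : PosReal → ℝ} {p : PosReal → ℕ → ℝ}
  {κ a₀ C₂ : ℝ} {L : Measure CountMeas} [IsFiniteMeasure L] {P : ℝ≥0 → Kernel CountMeas CountMeas}
  {Ω : Type*} [mΩ : MeasurableSpace Ω] {μ : Measure Ω} [IsProbabilityMeasure μ]
  {𝓕 : Filtration ℝ≥0 mΩ} {σ : CountMeas} {Y : ℝ≥0 → Ω → CountMeas}

lemma IsRightContMarkov.measurable (hY : IsRightContMarkov μ 𝓕 P σ Y) (t : ℝ≥0) :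
    Measurable (Y t) := (hY.adapted t).mono (𝓕.le t) le_rfl

lemma exp_neg_mem {y : ℝ} (hy : 0 ≤ y) : |Real.exp (-y)| ≤ 1 := by
  rw [abs_of_pos (Real.exp_pos _)]
  exact Real.exp_le_one_iff.2 (neg_nonpos.2 hy)

/-- The weight `W` carries the observations made up to time `s`. The initial state is evaluated at
the cumulant, while the immigration during the step factors out as a deterministic constant, so the
identity can be iterated. -/
lemma IsRightContMarkov.integral_mul_exp (hP : IsImmigrationSemigroup α p G L P)
    (hY : IsRightContMarkov μ 𝓕 P σ Y) {s r : ℝ≥0} {W : Ω → ℝ} (hW : Measurable[𝓕 s] W)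
    (hW1 : ∀ ω, |W ω| ≤ 1) {g : PosReal → ℝ} {C : ℝ} (hg : Measurable g) (hg0 : ∀ x, 0 ≤ g x)
    (hgC : ∀ x, g x ≤ C) {u : ℝ≥0 → PosReal → ℝ} (hu : IsCumulant α p G g u) :
    ∫ ω, W ω * Real.exp (-pairing (Y (s + r) ω) g) ∂μ =
      (∫ ω, W ω * Real.exp (-pairing (Y s ω) (u r)) ∂μ) *
        Real.exp (-∫ q in (0 : ℝ)..r, immExponent L (u q.toNNReal)) := by
  have hhm : Measurable (fun ν => Real.exp (-pairing ν g)) := (measurable_pairing hg).neg.exp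
  have hh1 : ∀ ν, |Real.exp (-pairing ν g)| ≤ 1 := fun ν => exp_neg_mem (pairing_nonneg ν hg0)
  have hmk := hY.markov s (s + r) le_self_add _ hhm ⟨1, hh1⟩
  have hbdd : IsBddBorel g := ⟨hg, C, fun x => by rw [abs_of_nonneg (hg0 x)]; exact hgC x⟩
  simp only [add_tsub_cancel_left, hP.laplace g hbdd hg0 u hu r] at hmk
  have hi : Integrable (fun ω => Real.exp (-pairing (Y (s + r) ω) g)) μ :=
    Integrable.of_bound (hhm.comp (hY.measurable _)).aestronglyMeasurable 1
      (ae_of_all _ fun ω => hh1 _)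
  have hWm : Measurable W := hW.mono (𝓕.le s) le_rfl
  have hWi : Integrable (W * fun ω => Real.exp (-pairing (Y (s + r) ω) g)) μ :=
    hi.bdd_mul (c := 1) hWm.aestronglyMeasurable (ae_of_all _ hW1)
  have hce := condExp_mul_of_stronglyMeasurable_left (μ := μ) (m := 𝓕 s) hW.stronglyMeasurable hWi hi
  have h1 : ∫ ω, W ω * Real.exp (-pairing (Y (s + r) ω) g) ∂μ =
      ∫ ω, (μ[W * fun ω => Real.exp (-pairing (Y (s + r) ω) g) | 𝓕 s]) ω ∂μ :=
    (integral_condExp (𝓕.le s)).symm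
  rw [h1, ← integral_mul_const]
  refine integral_congr_ae ?_
  filter_upwards [hce, hmk] with ω h2 h3
  rw [h2, Pi.mul_apply, h3, sub_eq_add_neg, Real.exp_add]
  ring

lemma IsRightContMarkov.integral_exp (hP : IsImmigrationSemigroup α p G L P)
    (hY : IsRightContMarkov μ 𝓕 P σ Y) (r : ℝ≥0) {g : PosReal → ℝ} {C : ℝ} (hg : Measurable g)
    (hg0 : ∀ x, 0 ≤ g x) (hgC : ∀ x, g x ≤ C) {u : ℝ≥0 → PosReal → ℝ}
    (hu : IsCumulant α p G g u) :
    ∫ ω, Real.exp (-pairing (Y r ω) g) ∂μ =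
      Real.exp (-(pairing σ (u r) + ∫ q in (0 : ℝ)..r, immExponent L (u q.toNNReal))) := by
  have h := hY.integral_mul_exp hP (s := 0) (r := r) (W := fun _ => 1) measurable_const
    (fun _ => by simp) hg hg0 hgC hu
  simp only [one_mul, zero_add] at h
  rw [h, neg_add, Real.exp_add]
  congr 1
  have h2 : ∀ᵐ ω ∂μ, Real.exp (-pairing (Y 0 ω) (u r)) = Real.exp (-pairing σ (u r)) := by
    filter_upwards [hY.initial] with ω hω
    rw [hω]
  rw [integral_congr_ae h2]
  simp

/-! ### Observations on a unit grid -/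

variable {h : PosReal → ℝ} {C : ℝ}

/-- Iterated Laplace functional of the process observed at the times `θ, θ+1, …, θ+q`. -/
lemma integral_exp_sum_aux (D : BranchingData α p G κ a₀ C₂) (hP : IsImmigrationSemigroup α p G L P)
    (hY : IsRightContMarkov μ 𝓕 P σ Y) (hm : Measurable h) (h0 : ∀ x, 0 ≤ h x)
    (hC : ∀ x, h x ≤ C) (θ : ℝ≥0) (q m : ℕ) :
    ∫ ω, Real.exp (-∑ k ∈ Finset.range q, pairing (Y (θ + k) ω) h) *
        Real.exp (-pairing (Y (θ + q) ω) (trainSol α p G h m m)) ∂μ ≤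
      Real.exp (-∑ j ∈ Finset.range q, ∫ s in (0 : ℝ)..1,
        immExponent L (trainSol α p G h (m + j) ((m + j : ℕ) + s.toNNReal))) := by
  have hU := fun m => D.trainSol_isSol hm h0 hC m
  induction q generalizing m with
  -- At the first observation the remaining exponential is simply bounded by `1`. This discards the
  -- initial population and the immigration before `θ`, which are irrelevant for an upper bound.
  | zero =>
    simp only [Finset.range_zero, Finset.sum_empty, neg_zero, Real.exp_zero, one_mul]
    have := norm_integral_le_of_norm_le_const (μ := μ)
      (f := fun ω => Real.exp (-pairing (Y (θ + (0 : ℕ)) ω) (trainSol α p G h m m))) (C := 1)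
      (ae_of_all _ fun ω => exp_neg_mem (pairing_nonneg _ ((hU m).nonneg _)))
    simpa using (le_abs_self _).trans this
  | succ q ih =>
    set W : Ω → ℝ := fun ω => Real.exp (-∑ k ∈ Finset.range (q + 1), pairing (Y (θ + k) ω) h)
      with hW
    have hWm : Measurable[𝓕 (θ + q)] W := by
      refine Measurable.exp (Measurable.neg (Finset.measurable_sum _ fun k hk => ?_))
      have hkq : θ + k ≤ θ + q := by
        have : (k : ℝ≥0) ≤ q := by exact_mod_cast Nat.lt_succ_iff.1 (Finset.mem_range.1 hk)
        gcongr
      exact (measurable_pairing hm).comp ((hY.adapted (θ + k)).mono (𝓕.mono hkq) le_rfl)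
    have hW1 : ∀ ω, |W ω| ≤ 1 := fun ω =>
      exp_neg_mem (Finset.sum_nonneg fun k _ => pairing_nonneg _ h0)
    obtain ⟨B, hB⟩ := (hU m).path.locBdd m
    -- One unit of time is peeled off at the end: the function `U_m` observed at `θ+q+1` is pulled
    -- back to `θ+q` as `U_{m+1}`, with the same `m` impulses beyond time `0`.
    have hstep := hY.integral_mul_exp hP (s := θ + q) (r := 1) hWm hW1 ((hU m).path.slice m)
      ((hU m).nonneg m) (fun x => (le_abs_self _).trans (hB m le_rfl x))
      (D.trainSol_isCumulant hm h0 hC m)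
    have e1 : θ + ((q + 1 : ℕ) : ℝ≥0) = θ + q + 1 := by push_cast; ring
    rw [e1, hstep, Finset.sum_range_succ', neg_add, Real.exp_add]
    -- The observation `h` at time `θ+q` merges with the pulled-back function, and by
    -- `trainSol_succ` the sum is the value of the next train solution at its last impulse. The
    -- induction hypothesis thus applies with `m+1`.
    have e2 : ∀ ω, W ω * Real.exp (-pairing (Y (θ + q) ω)
        (trainSol α p G h m (m + ((1 : ℝ≥0) : ℝ)))) =
        Real.exp (-∑ k ∈ Finset.range q, pairing (Y (θ + k) ω) h) *
          Real.exp (-pairing (Y (θ + q) ω) (trainSol α p G h (m + 1) (m + 1 : ℕ))) := by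
      intro ω
      have e3 : trainSol α p G h (m + 1) (m + 1 : ℕ) =
          fun x => h x + trainSol α p G h m (m + ((1 : ℝ≥0) : ℝ)) x := by
        funext x
        rw [D.trainSol_succ hm h0 hC]
        push_cast
        rfl
      have e4 : pairing (Y (θ + q) ω) (trainSol α p G h (m + 1) (m + 1 : ℕ)) =
          pairing (Y (θ + q) ω) h +
            pairing (Y (θ + q) ω) (trainSol α p G h m (m + ((1 : ℝ≥0) : ℝ))) := by
        rw [e3]
        exact integral_add (integrable_of_le hm h0 hC) ((hU m).path.integrable _ _)
      rw [e4, hW]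
      beta_reduce
      rw [Finset.sum_range_succ, neg_add, neg_add, Real.exp_add, Real.exp_add]
      ring
    simp_rw [e2]
    refine mul_le_mul ((ih (m + 1)).trans (le_of_eq ?_)) (le_of_eq ?_) (Real.exp_pos _).le
      (Real.exp_pos _).le
    · simp only [show ∀ j, m + 1 + j = m + (j + 1) from fun j => by ring]
    · simp

/-- The case `m = 0`: a single impulse evaluated at time `0` is `h`, which accounts for the last of
the `q+1` observations. -/
lemma integral_exp_sum_le (D : BranchingData α p G κ a₀ C₂) (hP : IsImmigrationSemigroup α p G L P)
    (hY : IsRightContMarkov μ 𝓕 P σ Y) (hm : Measurable h) (h0 : ∀ x, 0 ≤ h x)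
    (hC : ∀ x, h x ≤ C) (θ : ℝ≥0) (q : ℕ) :
    ∫ ω, Real.exp (-∑ k ∈ Finset.range (q + 1), pairing (Y (θ + k) ω) h) ∂μ ≤
      Real.exp (-∑ j ∈ Finset.range q, ∫ s in (0 : ℝ)..1,
        immExponent L (trainSol α p G h j (j + s.toNNReal))) := by
  have := integral_exp_sum_aux D hP hY hm h0 hC θ q 0
  have e : trainSol α p G h 0 ((0 : ℕ) : ℝ) = h := by
    funext x
    rw [Nat.cast_zero]
    exact D.trainSol_zero hm h0 hC x
  rw [e] at this
  simp only [zero_add] at this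
  refine le_trans (le_of_eq ?_) this
  refine integral_congr_ae (ae_of_all _ fun ω => ?_)
  simp only [Finset.sum_range_succ, neg_add, Real.exp_add]

/-- Superposition of the mean paths of the last `J+1` impulses. -/
noncomputable def meanTrain (G : Measure PosReal) (k f : PosReal → ℝ) (J : ℕ) (s : ℝ)
    (x : PosReal) : ℝ :=
  if 0 ≤ s then ∑ i ∈ Finset.range (J + 1), meanPath G k f (s + i) x else 0

lemma meanTrain_isPath {k f : PosReal → ℝ} (hk : Subcrit G k κ) (hf : Measurable f)
    (h0 : ∀ x, 0 ≤ f x) (hC : ∀ x, f x ≤ C) (J : ℕ) : IsPath (meanTrain G k f J) where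
  measurable := by
    have hπ := (meanPath_isMeanPath hk hf h0 hC).path
    have h1 : ∀ i : ℕ, Measurable (fun q : ℝ × PosReal => meanPath G k f (q.1 + i) q.2) := fun i =>
      hπ.measurable.comp ((measurable_fst.add measurable_const).prodMk measurable_snd)
    exact Measurable.ite (measurableSet_Ici.preimage measurable_fst)
      (Finset.measurable_sum (Finset.range (J + 1)) fun i _ => h1 i) measurable_const
  zero_of_neg t ht x := if_neg (not_le.2 ht)
  locBdd T := by
    have hπ := (meanPath_isMeanPath hk hf h0 hC).path
    obtain ⟨B, hB⟩ := hπ.locBdd (T + J)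
    refine ⟨(J + 1) * B, fun t ht x => ?_⟩
    have hB0 : 0 ≤ B := (abs_nonneg _).trans (hB (T + J) le_rfl x)
    unfold meanTrain
    split_ifs
    · refine (Finset.abs_sum_le_sum_abs _ _).trans ?_
      refine (Finset.sum_le_card_nsmul _ _ B fun i hi => hB _ ?_ x).trans (by simp)
      have : (i : ℝ) ≤ J := by exact_mod_cast Nat.lt_succ_iff.1 (Finset.mem_range.1 hi)
      linarith
    · simp; positivity

lemma meanTrain_nonneg {k f : PosReal → ℝ} (hk : Subcrit G k κ) (hf : Measurable f)
    (h0 : ∀ x, 0 ≤ f x) (hC : ∀ x, f x ≤ C) (J : ℕ) (s : ℝ) (x : PosReal) :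
    0 ≤ meanTrain G k f J s x := by
  unfold meanTrain
  split_ifs
  · exact Finset.sum_nonneg fun i _ => (meanPath_isSol hk hf h0 hC).nonneg _ _
  · exact le_rfl

/-- Upper bound for the Laplace functional of the process on a unit grid. -/
lemma exists_integral_exp_sum_le (D : BranchingData α p G κ a₀ C₂)
    (hP : IsImmigrationSemigroup α p G L P) (hY : IsRightContMarkov μ 𝓕 P σ Y) {f : PosReal → ℝ}
    (hm : Measurable f) (h0 : ∀ x, 0 ≤ f x) (hC : ∀ x, f x ≤ C) :
    ∃ B : ℝ, 0 ≤ B ∧ ∀ (J q : ℕ) (ε : ℝ) (θ : ℝ≥0), 0 ≤ ε →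
      ∫ ω, Real.exp (-∑ k ∈ Finset.range (q + 1), pairing (Y (θ + k) ω) (fun x => ε * f x)) ∂μ ≤
        Real.exp (-(((q : ℝ) - J) * ∫ s in (0 : ℝ)..1, immExponent L
          (lowerPath (meanTrain G (fun y => α y * genFunDeriv p y) f J) B ε s))) := by
  have hk := D.subcrit
  obtain ⟨B, hB0, hB⟩ := D.exists_le_trainSol hm h0 hC
  refine ⟨B, hB0, fun J q ε θ hε => ?_⟩
  set k := fun y => α y * genFunDeriv p y with hkdef
  have hmε : Measurable (fun z => ε * f z) := hm.const_mul ε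
  have h0ε : ∀ z, 0 ≤ ε * f z := fun z => mul_nonneg hε (h0 z)
  have hCε : ∀ z, ε * f z ≤ ε * C := fun z => mul_le_mul_of_nonneg_left (hC z) hε
  have hU := fun m => D.trainSol_isSol hmε h0ε hCε m
  have hS := meanTrain_isPath hk hm h0 hC J
  set I := ∫ s in (0 : ℝ)..1, immExponent L (lowerPath (meanTrain G k f J) B ε s) with hI
  refine (integral_exp_sum_le D hP hY hmε h0ε hCε θ q).trans (Real.exp_le_exp.2 (neg_le_neg ?_))
  have hUm : ∀ j : ℕ, Measurable (Function.uncurry fun (s : ℝ) (x : PosReal) =>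
      trainSol α p G (fun z => ε * f z) j (j + s.toNNReal) x) := fun j =>
    (hU j).path.measurable.comp ((measurable_const.add (measurable_subtype_coe.comp
      (measurable_real_toNNReal.comp measurable_fst))).prodMk measurable_snd)
  have hnonneg : ∀ j : ℕ, 0 ≤ ∫ s in (0 : ℝ)..1,
      immExponent L (trainSol α p G (fun z => ε * f z) j (j + s.toNNReal)) := fun j =>
    intervalIntegral.integral_nonneg zero_le_one fun s _ =>
      immExponent_nonneg ((hU j).nonneg _)
  -- When `j ≥ J`, the train contains at least the `J+1` most recent impulses; the contributions of
  -- older ones are nonnegative and may be dropped.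
  have hlow : ∀ j : ℕ, J ≤ j → I ≤ ∫ s in (0 : ℝ)..1,
      immExponent L (trainSol α p G (fun z => ε * f z) j (j + s.toNNReal)) := by
    intro j hj
    refine intervalIntegral.integral_mono_on zero_le_one
      (intervalIntegrable_immExponent (measurable_lowerPath hS B ε) (lowerPath_nonneg _ _ _) _ _)
      (intervalIntegrable_immExponent (hUm j) (fun s x => (hU j).nonneg _ x) _ _) fun s hs => ?_
    obtain ⟨R, hR⟩ := (hU j).path.locBdd (j + s.toNNReal)
    refine immExponent_mono ((measurable_lowerPath hS B ε).comp
      (measurable_const.prodMk measurable_id)) ((hU j).path.slice _) (lowerPath_nonneg _ _ _ _)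
      (fun x => max_le ((hU j).nonneg _ x) ?_) (fun x => (le_abs_self _).trans (hR _ le_rfl x))
    refine le_trans ?_ (hB ε hε j (j + s.toNNReal) x)
    rw [Real.coe_toNNReal _ hs.1, meanTrain, if_pos hs.1]
    have hsub : ∑ i ∈ Finset.range (J + 1), meanPath G k f (s + i) x ≤
        ∑ i ∈ Finset.range (j + 1), meanPath G k f (j + s - i) x := by
      -- Impulses are renumbered by their age, so that the recent ones come first.
      rw [← Finset.sum_range_reflect (fun i : ℕ => meanPath G k f (j + s - i) x) (j + 1)]
      refine (Finset.sum_le_sum_of_subset_of_nonneg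
        (Finset.range_mono (Nat.succ_le_succ hj)) fun i _ _ =>
          (meanPath_isSol hk hm h0 hC).nonneg _ _).trans (Finset.sum_le_sum fun i hi => ?_)
      have hij : i ≤ j := Nat.lt_succ_iff.1 (Finset.mem_range.1 hi)
      rw [show j + 1 - 1 - i = j - i by omega, Nat.cast_sub hij]
      refine le_of_eq ?_
      congr 1
      ring
    have := mul_le_mul_of_nonneg_left hsub hε
    linarith
  have hI0 : 0 ≤ I := intervalIntegral.integral_nonneg zero_le_one fun s _ =>
    immExponent_nonneg (lowerPath_nonneg _ _ _ _)
  -- For `q ≤ J` the claimed exponent has the trivial sign; otherwise the first `J` summands are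
  -- dropped and the other `q - J` are each at least `I`.
  rcases le_total q J with hq | hq
  · have h1 : (q : ℝ) - J ≤ 0 := by
      have : (q : ℝ) ≤ J := by exact_mod_cast hq
      linarith
    exact (mul_nonpos_of_nonpos_of_nonneg h1 hI0).trans (Finset.sum_nonneg fun j _ => hnonneg j)
  · rw [← Finset.sum_range_add_sum_Ico _ hq]
    have h1 : ((q : ℝ) - J) * I ≤ ∑ j ∈ Finset.Ico J q, ∫ s in (0 : ℝ)..1,
        immExponent L (trainSol α p G (fun z => ε * f z) j (j + s.toNNReal)) := by
      have := Finset.card_nsmul_le_sum (Finset.Ico J q) (fun j : ℕ => ∫ s in (0 : ℝ)..1,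
        immExponent L (trainSol α p G (fun z => ε * f z) j (j + s.toNNReal))) I
        fun j hj => hlow j (Finset.mem_Ico.1 hj).1
      rwa [Nat.card_Ico, nsmul_eq_mul, Nat.cast_sub hq] at this
    have h2 := Finset.sum_nonneg fun j (_ : j ∈ Finset.range J) => hnonneg j
    linarith

/-- First-moment bound. -/
lemma lintegral_pairing_le (D : BranchingData α p G κ a₀ C₂)
    (hP : IsImmigrationSemigroup α p G L P) (hY : IsRightContMarkov μ 𝓕 P σ Y)
    (hL : ∫⁻ ν, ν.toMeas Set.univ ∂L < ∞) {f : PosReal → ℝ}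
    (hm : Measurable f) (h0 : ∀ x, 0 ≤ f x) (hC : ∀ x, f x ≤ C) (t : ℝ≥0) :
    ∫⁻ ω, ENNReal.ofReal (pairing (Y t ω) f) ∂μ ≤ ENNReal.ofReal
      (pairing σ (meanPath G (fun y => α y * genFunDeriv p y) f t) + ∫ s in (0 : ℝ)..t,
        ∫ ν, pairing ν (meanPath G (fun y => α y * genFunDeriv p y) f s) ∂L) := by
  have hk := D.subcrit
  set k := fun y => α y * genFunDeriv p y with hkdef
  have hπ := (meanPath_isMeanPath hk hm h0 hC).path
  set M := pairing σ (meanPath G k f t) + ∫ s in (0 : ℝ)..t,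
        ∫ ν, pairing ν (meanPath G k f s) ∂L with hM
  have hfm : Measurable (fun ω => pairing (Y t ω) f) := (measurable_pairing hm).comp (hY.measurable t)
  have hf0 : ∀ ω, 0 ≤ pairing (Y t ω) f := fun ω => pairing_nonneg _ h0
  -- The first moment is recovered from Laplace functionals through `n(1 - e^{-y/n}) → y`. Fatou's
  -- lemma then turns bounds uniform in `n` into a bound on the mean, without assuming integrability
  -- beforehand.
  have hlim : ∀ ω, Tendsto (fun n : ℕ => ENNReal.ofReal
      (n * (1 - Real.exp (-((n : ℝ)⁻¹ * pairing (Y t ω) f))))) atTop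
      (𝓝 (ENNReal.ofReal (pairing (Y t ω) f))) := by
    intro ω
    refine (ENNReal.continuous_ofReal.tendsto _).comp ?_
    -- The absolute value makes the argument nonnegative for every real `r`, as the limit lemma
    -- requires; it is invisible along natural numbers.
    have h1 : Tendsto (fun r : ℝ => r * (1 - Real.exp (-(|r|⁻¹ * pairing (Y t ω) f)))) atTop
        (𝓝 (pairing (Y t ω) f)) := by
      refine tendsto_mul_one_sub_exp_neg (y := fun r => |r|⁻¹ * pairing (Y t ω) f)
        (fun r => mul_nonneg (inv_nonneg.2 (abs_nonneg _)) (hf0 ω)) ?_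
      refine tendsto_const_nhds.congr' ?_
      filter_upwards [eventually_gt_atTop 0] with r hr
      rw [abs_of_pos hr]
      field_simp
    have h2 := h1.comp tendsto_natCast_atTop_atTop
    refine h2.congr fun n => ?_
    simp [Function.comp]
  have hstep : ∀ n : ℕ, ∫⁻ ω, ENNReal.ofReal
      (n * (1 - Real.exp (-((n : ℝ)⁻¹ * pairing (Y t ω) f)))) ∂μ ≤ ENNReal.ofReal M := by
    intro n
    set ε := (n : ℝ)⁻¹ with hεdef
    have hε : 0 ≤ ε := inv_nonneg.2 (Nat.cast_nonneg n)
    have hmε : Measurable (fun z => ε * f z) := hm.const_mul ε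
    have h0ε : ∀ z, 0 ≤ ε * f z := fun z => mul_nonneg hε (h0 z)
    have hCε : ∀ z, ε * f z ≤ ε * C := fun z => mul_le_mul_of_nonneg_left (hC z) hε
    have hU := D.trainSol_isSol hmε h0ε hCε 0
    have hcum := D.trainSol_isCumulant hmε h0ε hCε 0
    have e0 : trainSol α p G (fun z => ε * f z) 0 ((0 : ℕ) : ℝ) = fun z => ε * f z := by
      funext x
      rw [Nat.cast_zero]
      exact D.trainSol_zero hmε h0ε hCε x
    rw [e0] at hcum
    simp only [Nat.cast_zero, zero_add] at hcum
    have hlap := hY.integral_exp hP t hmε h0ε hCε hcum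
    have hpair : ∀ ν : CountMeas, pairing ν (fun z => ε * f z) = ε * pairing ν f := fun ν =>
      integral_const_mul _ _
    simp only [hpair] at hlap
    have hle := fun t x => D.cumulant_le hm h0 hC hε t x
    have hi : Integrable (fun ω => Real.exp (-(ε * pairing (Y t ω) f))) μ :=
      Integrable.of_bound (hfm.const_mul ε).neg.exp.aestronglyMeasurable 1
        (ae_of_all _ fun ω => exp_neg_mem (mul_nonneg hε (hf0 ω)))
    have hi2 : Integrable (fun ω => (n : ℝ) * (1 - Real.exp (-(ε * pairing (Y t ω) f)))) μ :=
      ((integrable_const 1).sub hi).const_mul _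
    rw [← ofReal_integral_eq_lintegral_ofReal hi2 (ae_of_all _ fun ω =>
      mul_nonneg (Nat.cast_nonneg n) (one_sub_exp_neg_mem (mul_nonneg hε (hf0 ω))).1)]
    refine ENNReal.ofReal_le_ofReal ?_
    rw [integral_const_mul, integral_sub (integrable_const _) hi, hlap]
    simp only [integral_const, probReal_univ, smul_eq_mul, mul_one]
    have hA1 : pairing σ (trainSol α p G (fun z => ε * f z) 0 t) ≤
        ε * pairing σ (meanPath G k f t) := by
      rw [pairing, pairing, ← integral_const_mul]
      exact integral_mono (hU.path.integrable _ _) ((hπ.integrable _ _).const_mul _) (hle t)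
    have hA2 : ∫ s in (0 : ℝ)..t, immExponent L
        (trainSol α p G (fun z => ε * f z) 0 (s.toNNReal : ℝ)) ≤
        ε * ∫ s in (0 : ℝ)..t, ∫ ν, pairing ν (meanPath G k f s) ∂L := by
      rw [← intervalIntegral.integral_const_mul]
      have hmeas : Measurable (Function.uncurry fun (s : ℝ) (x : PosReal) =>
          trainSol α p G (fun z => ε * f z) 0 (s.toNNReal : ℝ) x) :=
        hU.path.measurable.comp ((measurable_subtype_coe.comp
          (measurable_real_toNNReal.comp measurable_fst)).prodMk measurable_snd)
      refine intervalIntegral.integral_mono_on t.coe_nonneg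
        (intervalIntegrable_immExponent hmeas (fun s x => hU.nonneg _ x) _ _)
        ((hπ.intervalIntegrable_integral_pairing hL _ _).const_mul _) fun s hs => ?_
      rw [Real.coe_toNNReal _ hs.1]
      obtain ⟨R, hR⟩ := hU.path.locBdd s
      obtain ⟨R', hR'⟩ := hπ.locBdd s
      refine (immExponent_le_integral hL (hU.path.slice s) (hU.nonneg s)
        fun x => (le_abs_self _).trans (hR s le_rfl x)).trans ?_
      rw [← integral_const_mul]
      refine integral_mono (integrable_pairing hL (hU.path.slice s) (hR s le_rfl))
        ((integrable_pairing hL (hπ.slice s) (hR' s le_rfl)).const_mul _) fun ν => ?_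
      simp only
      rw [pairing, pairing, ← integral_const_mul]
      exact integral_mono (hU.path.integrable _ _) ((hπ.integrable _ _).const_mul _) (hle s)
    set A := pairing σ (trainSol α p G (fun z => ε * f z) 0 t) + ∫ s in (0 : ℝ)..t, immExponent L
        (trainSol α p G (fun z => ε * f z) 0 (s.toNNReal : ℝ)) with hA
    have hAM : A ≤ ε * M := by rw [hM, mul_add]; exact add_le_add hA1 hA2
    have hM0 : 0 ≤ M := add_nonneg
      (pairing_nonneg _ ((meanPath_isSol hk hm h0 hC).nonneg _))
      (intervalIntegral.integral_nonneg t.coe_nonneg fun s _ => integral_nonneg fun ν =>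
        pairing_nonneg _ ((meanPath_isSol hk hm h0 hC).nonneg _))
    calc (n : ℝ) * (1 - Real.exp (-A)) ≤ n * (ε * M) := by
          refine mul_le_mul_of_nonneg_left ?_ (Nat.cast_nonneg n)
          linarith [Real.add_one_le_exp (-A)]
      -- Only `n * n⁻¹ ≤ 1` is used, which also covers `n = 0`, where the inverse is `0`.
      _ ≤ M := by
          rw [← mul_assoc, hεdef]
          exact mul_le_of_le_one_left hM0 (mul_inv_le_one)
  calc ∫⁻ ω, ENNReal.ofReal (pairing (Y t ω) f) ∂μ
      = ∫⁻ ω, liminf (fun n : ℕ => ENNReal.ofReal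
          (n * (1 - Real.exp (-((n : ℝ)⁻¹ * pairing (Y t ω) f))))) atTop ∂μ :=
        lintegral_congr fun ω => (hlim ω).liminf_eq.symm
    _ ≤ liminf (fun n : ℕ => ∫⁻ ω, ENNReal.ofReal
          (n * (1 - Real.exp (-((n : ℝ)⁻¹ * pairing (Y t ω) f)))) ∂μ) atTop :=
        lintegral_liminf_le fun n =>
          ((measurable_const.sub (hfm.const_mul _).neg.exp).const_mul _).ennreal_ofReal
    _ ≤ ENNReal.ofReal M :=
        liminf_le_of_frequently_le' (Eventually.of_forall hstep).frequently

end MarkovProcess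

/-! ### Total means -/

/-- The masses of the tails are integers tending to `0`, hence eventually equal to `0`: a counting
measure has bounded support. -/
lemma CountMeas.exists_measure_Ioi_eq_zero (ν : CountMeas) :
    ∃ n : ℕ, ν.toMeas {x : PosReal | (n : ℝ) < x} = 0 := by
  have hms : ∀ n : ℕ, MeasurableSet {x : PosReal | (n : ℝ) < x} := fun n =>
    measurableSet_lt measurable_const measurable_subtype_coe
  have hlim : Tendsto (fun n : ℕ => ν.toMeas {x : PosReal | (n : ℝ) < x}) atTop (𝓝 0) := by
    have h := tendsto_measure_iInter_atTop (μ := ν.toMeas)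
      (s := fun n : ℕ => {x : PosReal | (n : ℝ) < x}) (fun n => (hms n).nullMeasurableSet)
      (fun m n hmn x (hx : (n : ℝ) < x) => lt_of_le_of_lt (Nat.cast_le.2 hmn) hx)
      ⟨0, measure_ne_top _ _⟩
    have he : ⋂ n : ℕ, {x : PosReal | (n : ℝ) < x} = ∅ := by
      refine Set.eq_empty_of_forall_notMem fun x hx => ?_
      obtain ⟨n, hn⟩ := exists_nat_ge (x : ℝ)
      exact absurd (Set.mem_iInter.1 hx n) (not_lt.2 hn)
    rwa [he, measure_empty] at h
  obtain ⟨n, hn⟩ := (hlim.eventually_lt_const zero_lt_one).exists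
  refine ⟨n, ?_⟩
  obtain ⟨j, hj⟩ := ν.2 _ (hms n)
  have hj' : ν.toMeas {x : PosReal | (n : ℝ) < x} = j := hj
  rw [hj'] at hn ⊢
  have : j < 1 := by exact_mod_cast hn
  have : j = 0 := by omega
  simp [this]

lemma CountMeas.integrable_coe (ν : CountMeas) :
    Integrable (fun x : PosReal => (x : ℝ)) ν.toMeas := by
  obtain ⟨n, hn⟩ := ν.exists_measure_Ioi_eq_zero
  refine Integrable.of_bound measurable_subtype_coe.aestronglyMeasurable n ?_
  have h : ∀ᵐ x : PosReal ∂ν.toMeas, ¬ ((n : ℝ) < x) := by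
    rw [ae_iff]
    simpa using hn
  filter_upwards [h] with x hx
  rw [Real.norm_of_nonneg (le_of_lt x.2)]
  exact not_lt.1 hx

lemma totalMean_restrict (V : ℝ → PosReal → ℝ) (x : PosReal) :
    totalMean (fun t : ℝ≥0 => V t) x = ∫ s in Set.Ioi (0 : ℝ), V s x := by
  refine setIntegral_congr_fun measurableSet_Ioi fun s hs => ?_
  simp only [Real.coe_toNNReal _ (le_of_lt hs)]

section TotalMean

variable {G : Measure PosReal} [IsProbabilityMeasure G] {k f : PosReal → ℝ} {κ C : ℝ}
  {L : Measure CountMeas} [IsFiniteMeasure L]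

lemma meanPath_integrableOn (hk : Subcrit G k κ) (hf : Measurable f) (h0 : ∀ x, 0 ≤ f x)
    (hC : ∀ x, f x ≤ C) (x : PosReal) :
    IntegrableOn (fun s => meanPath G k f s x) (Set.Ioi (0 : ℝ)) := by
  have hsol := meanPath_isSol hk hf h0 hC
  refine (lintegral_ofReal_ne_top_iff_integrable
    (hsol.path.measurable.comp (measurable_id.prodMk measurable_const)).aestronglyMeasurable
    (ae_of_all _ fun s => hsol.nonneg s x)).1 ?_
  exact ((lintegral_meanPath_le hk hf h0 hC x).trans_lt ENNReal.ofReal_lt_top).ne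

/-- `Π_∞ f` for nonnegative `f`. -/
noncomputable def totalPath (G : Measure PosReal) (k f : PosReal → ℝ) (x : PosReal) : ℝ :=
  ∫ s in Set.Ioi (0 : ℝ), meanPath G k f s x

lemma totalPath_nonneg (hk : Subcrit G k κ) (hf : Measurable f) (h0 : ∀ x, 0 ≤ f x)
    (hC : ∀ x, f x ≤ C) (x : PosReal) : 0 ≤ totalPath G k f x :=
  integral_nonneg fun s => (meanPath_isSol hk hf h0 hC).nonneg s x

lemma ofReal_totalPath (hk : Subcrit G k κ) (hf : Measurable f) (h0 : ∀ x, 0 ≤ f x)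
    (hC : ∀ x, f x ≤ C) (x : PosReal) : ENNReal.ofReal (totalPath G k f x) =
      ∫⁻ s in Set.Ioi (0 : ℝ), ENNReal.ofReal (meanPath G k f s x) :=
  ofReal_integral_eq_lintegral_ofReal (meanPath_integrableOn hk hf h0 hC x)
    (ae_of_all _ fun s => (meanPath_isSol hk hf h0 hC).nonneg s x)

lemma exists_totalPath_le (hk : Subcrit G k κ) (hf : Measurable f) (h0 : ∀ x, 0 ≤ f x)
    (hC : ∀ x, f x ≤ C) : ∃ A : ℝ, 0 ≤ A ∧ ∀ x, totalPath G k f x ≤ A * x := by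
  have hC0 : 0 ≤ C := (h0 ⟨1, Set.mem_Ioi.2 one_pos⟩).trans (hC _)
  have hm1 : 0 ≤ ∫ z : PosReal, (z : ℝ) ∂G := integral_nonneg fun z => (le_of_lt z.2)
  have hA : 0 ≤ C * (1 + κ * ((∫ z, (z : ℝ) ∂G) / (1 - ∫ z, potK k z ∂G))) :=
    mul_nonneg hC0 (add_nonneg zero_le_one (mul_nonneg hk.bound_nonneg
      (div_nonneg hm1 (sub_nonneg.2 hk.integral_potK_lt_one.le))))
  refine ⟨_, hA, fun x => ?_⟩
  have h := lintegral_meanPath_le hk hf h0 hC x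
  rw [← ofReal_totalPath hk hf h0 hC] at h
  exact (ENNReal.ofReal_le_ofReal_iff (mul_nonneg hA (le_of_lt x.2))).1 h

lemma measurable_totalPath (hk : Subcrit G k κ) (hf : Measurable f) (h0 : ∀ x, 0 ≤ f x)
    (hC : ∀ x, f x ≤ C) : Measurable (totalPath G k f) := by
  have h1 : Measurable (fun q : PosReal × ℝ => meanPath G k f q.2 q.1) :=
    (meanPath_isSol hk hf h0 hC).path.measurable.comp measurable_swap
  exact (h1.stronglyMeasurable.integral_prod_right'
    (ν := volume.restrict (Set.Ioi (0 : ℝ)))).measurable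

lemma integrable_totalPath (hk : Subcrit G k κ) (hf : Measurable f) (h0 : ∀ x, 0 ≤ f x)
    (hC : ∀ x, f x ≤ C) (ν : CountMeas) : Integrable (totalPath G k f) ν.toMeas := by
  obtain ⟨A, -, hA⟩ := exists_totalPath_le hk hf h0 hC
  refine Integrable.mono' (ν.integrable_coe.const_mul A)
    (measurable_totalPath hk hf h0 hC).aestronglyMeasurable (ae_of_all _ fun x => ?_)
  rw [Real.norm_of_nonneg (totalPath_nonneg hk hf h0 hC x)]
  exact hA x

/-- Linear growth of `Π_∞ f` reduces the claim to the `L`-integrability of `⟨ν, x⟩`. -/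
lemma integrable_pairing_totalPath (hk : Subcrit G k κ)
    (hLx : ∫⁻ ν, (∫⁻ x, ENNReal.ofReal (x : ℝ) ∂ν.toMeas) ∂L < ∞) (hf : Measurable f)
    (h0 : ∀ x, 0 ≤ f x) (hC : ∀ x, f x ≤ C) :
    Integrable (fun ν => pairing ν (totalPath G k f)) L := by
  obtain ⟨A, hA0, hA⟩ := exists_totalPath_le hk hf h0 hC
  have hn := totalPath_nonneg hk hf h0 hC
  refine (lintegral_ofReal_ne_top_iff_integrable
    (measurable_pairing (measurable_totalPath hk hf h0 hC)).aestronglyMeasurable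
    (ae_of_all _ fun ν => pairing_nonneg ν hn)).1 (ne_of_lt ?_)
  calc ∫⁻ ν, ENNReal.ofReal (pairing ν (totalPath G k f)) ∂L
      ≤ ∫⁻ ν, ENNReal.ofReal A * (∫⁻ x, ENNReal.ofReal (x : ℝ) ∂ν.toMeas) ∂L := by
        refine lintegral_mono fun ν => ?_
        rw [pairing, ofReal_integral_eq_lintegral_ofReal (integrable_totalPath hk hf h0 hC ν)
          (ae_of_all _ hn), ← lintegral_const_mul _ measurable_subtype_coe.ennreal_ofReal]
        refine lintegral_mono fun x => ?_
        rw [← ENNReal.ofReal_mul hA0]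
        exact ENNReal.ofReal_le_ofReal (hA x)
    _ = ENNReal.ofReal A * ∫⁻ ν, (∫⁻ x, ENNReal.ofReal (x : ℝ) ∂ν.toMeas) ∂L :=
        lintegral_const_mul _ ((Measure.measurable_lintegral
          measurable_subtype_coe.ennreal_ofReal).comp measurable_toMeas)
    _ < ∞ := ENNReal.mul_lt_top ENNReal.ofReal_lt_top hLx

lemma lintegral_integral_pairing (hk : Subcrit G k κ) (hL : ∫⁻ ν, ν.toMeas Set.univ ∂L < ∞)
    (hf : Measurable f) (h0 : ∀ x, 0 ≤ f x) (hC : ∀ x, f x ≤ C) :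
    ∫⁻ s in Set.Ioi (0 : ℝ), ENNReal.ofReal (∫ ν, pairing ν (meanPath G k f s) ∂L) =
      ∫⁻ ν, ENNReal.ofReal (pairing ν (totalPath G k f)) ∂L := by
  have hsol := meanPath_isSol hk hf h0 hC
  have h1 : ∀ s, ENNReal.ofReal (∫ ν, pairing ν (meanPath G k f s) ∂L) =
      ∫⁻ ν, ENNReal.ofReal (pairing ν (meanPath G k f s)) ∂L := by
    intro s
    obtain ⟨B, hB⟩ := hsol.path.locBdd s
    exact ofReal_integral_eq_lintegral_ofReal
      (integrable_pairing hL (hsol.path.slice s) (hB s le_rfl))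
      (ae_of_all _ fun ν => pairing_nonneg ν (hsol.nonneg s))
  simp_rw [h1]
  rw [lintegral_lintegral_swap
    (measurable_pairing_uncurry hsol.path.measurable).ennreal_ofReal.aemeasurable]
  refine lintegral_congr fun ν => ?_
  have h2 : ∀ s, ENNReal.ofReal (pairing ν (meanPath G k f s)) =
      ∫⁻ x, ENNReal.ofReal (meanPath G k f s x) ∂ν.toMeas := fun s =>
    ofReal_integral_eq_lintegral_ofReal (hsol.path.integrable s ν.toMeas)
      (ae_of_all _ (hsol.nonneg s))
  simp_rw [h2]
  rw [lintegral_lintegral_swap hsol.path.measurable.ennreal_ofReal.aemeasurable, pairing,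
    ofReal_integral_eq_lintegral_ofReal (integrable_totalPath hk hf h0 hC ν)
      (ae_of_all _ (totalPath_nonneg hk hf h0 hC))]
  exact lintegral_congr fun x => (ofReal_totalPath hk hf h0 hC x).symm

lemma integral_pairing_integrableOn (hk : Subcrit G k κ)
    (hL : ∫⁻ ν, ν.toMeas Set.univ ∂L < ∞)
    (hLx : ∫⁻ ν, (∫⁻ x, ENNReal.ofReal (x : ℝ) ∂ν.toMeas) ∂L < ∞)
    (hf : Measurable f) (h0 : ∀ x, 0 ≤ f x) (hC : ∀ x, f x ≤ C) :
    IntegrableOn (fun s => ∫ ν, pairing ν (meanPath G k f s) ∂L) (Set.Ioi (0 : ℝ)) ∧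
      ∫ s in Set.Ioi (0 : ℝ), (∫ ν, pairing ν (meanPath G k f s) ∂L) =
        ∫ ν, pairing ν (totalPath G k f) ∂L := by
  have hsol := meanPath_isSol hk hf h0 hC
  have hm := measurable_integral_pairing (L := L) hsol.path.measurable
  have hn : ∀ s, 0 ≤ ∫ ν, pairing ν (meanPath G k f s) ∂L := fun s =>
    integral_nonneg fun ν => pairing_nonneg ν (hsol.nonneg s)
  have hi := integrable_pairing_totalPath hk hLx hf h0 hC
  have hn' : ∀ ν, 0 ≤ pairing ν (totalPath G k f) := fun ν =>
    pairing_nonneg ν (totalPath_nonneg hk hf h0 hC)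
  have he := lintegral_integral_pairing hk hL hf h0 hC
  refine ⟨(lintegral_ofReal_ne_top_iff_integrable hm.aestronglyMeasurable (ae_of_all _ hn)).1 ?_, ?_⟩
  · rw [he]
    exact (lintegral_ofReal_ne_top_iff_integrable hi.1 (ae_of_all _ hn')).2 hi
  · rw [integral_eq_lintegral_of_nonneg_ae (ae_of_all _ hn) hm.aestronglyMeasurable,
      integral_eq_lintegral_of_nonneg_ae (ae_of_all _ hn') hi.1, he]

/-- The corresponding statement for immigration, applied to the Dirac mass at `σ` in place of `L`.
The moment conditions hold because `σ` is finite with bounded support. -/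
lemma pairing_integrableOn (hk : Subcrit G k κ) (hf : Measurable f) (h0 : ∀ x, 0 ≤ f x)
    (hC : ∀ x, f x ≤ C) (σ : CountMeas) :
    IntegrableOn (fun s => pairing σ (meanPath G k f s)) (Set.Ioi (0 : ℝ)) := by
  have hsol := meanPath_isSol hk hf h0 hC
  have h1 : ∫⁻ ν, ν.toMeas Set.univ ∂(Measure.dirac σ) < ∞ := by
    have hm : Measurable (fun ν : CountMeas => ν.toMeas Set.univ) :=
      (Measure.measurable_coe MeasurableSet.univ).comp measurable_toMeas
    rw [lintegral_dirac' _ hm]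
    exact measure_lt_top _ _
  have h2 : ∫⁻ ν, (∫⁻ x, ENNReal.ofReal (x : ℝ) ∂ν.toMeas) ∂(Measure.dirac σ) < ∞ := by
    have hm : Measurable (fun ν : CountMeas => ∫⁻ x, ENNReal.ofReal (x : ℝ) ∂ν.toMeas) :=
      (Measure.measurable_lintegral measurable_subtype_coe.ennreal_ofReal).comp measurable_toMeas
    rw [lintegral_dirac' _ hm]
    exact ((lintegral_ofReal_ne_top_iff_integrable measurable_subtype_coe.aestronglyMeasurable
      (ae_of_all _ fun x => le_of_lt x.2)).2 σ.integrable_coe).lt_top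
  refine (integral_pairing_integrableOn hk h1 h2 hf h0 hC).1.congr_fun (fun s _ => ?_)
    measurableSet_Ioi
  exact integral_dirac' _ _ (measurable_pairing (hsol.path.slice s)).stronglyMeasurable

/-- Cutting `[0, J+1]` into unit intervals and moving each onto `[0,1]` shows that the superposition
of `J+1` shifted mean paths integrates to the truncated integral of `∫ ⟨ν, π_s f⟩ L(dν)`. -/
lemma tendsto_integral_meanTrain (hk : Subcrit G k κ)
    (hL : ∫⁻ ν, ν.toMeas Set.univ ∂L < ∞)
    (hLx : ∫⁻ ν, (∫⁻ x, ENNReal.ofReal (x : ℝ) ∂ν.toMeas) ∂L < ∞)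
    (hf : Measurable f) (h0 : ∀ x, 0 ≤ f x) (hC : ∀ x, f x ≤ C) :
    Tendsto (fun J : ℕ => ∫ s in (0 : ℝ)..1, ∫ ν, pairing ν (meanTrain G k f J s) ∂L) atTop
      (𝓝 (∫ ν, pairing ν (totalPath G k f) ∂L)) := by
  have hsol := meanPath_isSol hk hf h0 hC
  obtain ⟨hi, he⟩ := integral_pairing_integrableOn hk hL hLx hf h0 hC
  set Q : ℝ → ℝ := fun s => ∫ ν, pairing ν (meanPath G k f s) ∂L with hQ
  have hQi : ∀ a b, IntervalIntegrable Q volume a b :=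
    hsol.path.intervalIntegrable_integral_pairing hL
  have hlim : Tendsto (fun J : ℕ => ∫ s in (0 : ℝ)..((J + 1 : ℕ) : ℝ), Q s) atTop
      (𝓝 (∫ s in Set.Ioi (0 : ℝ), Q s)) :=
    intervalIntegral_tendsto_integral_Ioi 0 hi
      (tendsto_natCast_atTop_atTop.comp (tendsto_add_atTop_nat 1))
  rw [he] at hlim
  refine hlim.congr fun J => ?_
  have h1 := intervalIntegral.sum_integral_adjacent_intervals (f := Q) (μ := volume)
    (a := fun i : ℕ => (i : ℝ)) (n := J + 1) fun i _ => hQi _ _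
  rw [Nat.cast_zero] at h1
  rw [← h1]
  have h2 : ∀ i : ℕ, ∫ s in (i : ℝ)..((i + 1 : ℕ) : ℝ), Q s = ∫ s in (0 : ℝ)..1, Q (s + i) := by
    intro i
    rw [intervalIntegral.integral_comp_add_right]
    congr 1
    · ring
    · push_cast; ring
  simp_rw [h2]
  rw [← intervalIntegral.integral_finsetSum]
  · refine intervalIntegral.integral_congr fun s hs => ?_
    rw [Set.uIcc_of_le zero_le_one] at hs
    have h3 : meanTrain G k f J s = fun x => ∑ i ∈ Finset.range (J + 1), meanPath G k f (s + i) x := by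
      funext x
      rw [meanTrain, if_pos hs.1]
    simp only [h3, hQ]
    rw [← integral_finsetSum]
    · refine integral_congr_ae (ae_of_all _ fun ν => ?_)
      exact (integral_finsetSum _ fun i _ => hsol.path.integrable _ _).symm
    · intro i _
      obtain ⟨B, hB⟩ := hsol.path.locBdd (s + i)
      exact integrable_pairing hL (hsol.path.slice _) (hB _ le_rfl)
  · intro i _
    have := (hQi (0 + i) (1 + i)).comp_add_right (c := (i : ℝ))
    simpa using this

end TotalMean

/-! ### Quantitative assumptions -/

/-- The rate `k = α g'(·,1-)` is bounded by `κ = a₀ C₁`. -/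
lemma exists_branchingData {α : PosReal → ℝ} (hα : IsBirthRate α) {p : PosReal → ℕ → ℝ}
    (hp : IsOffspringLaw p) {G : Measure PosReal} [IsProbabilityMeasure G] {α₁ : ℝ}
    (hα₁ : SubcriticalMalthusian α p G α₁)
    (hGexp : ∫⁻ x, ENNReal.ofReal (Real.exp (2 * α₁ * (x : ℝ))) ∂G < ∞)
    (hg : SecondDerivBdd p) : ∃ κ a₀ C₂ : ℝ, BranchingData α p G κ a₀ C₂ := by
  obtain ⟨a₀, ha₀⟩ := hα.1.2.1
  obtain ⟨C₁, hC₁⟩ := hp.mean_bdd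
  obtain ⟨C₂, hC₂⟩ := hg
  have hαle : ∀ x, α x ≤ a₀ := fun x => (le_abs_self _).trans (ha₀ x)
  have hαm := hα.1.measurable
  have hkm : Measurable (fun y => α y * genFunDeriv p y) := hαm.mul hp.measurable_genFunDeriv
  refine ⟨a₀ * C₁, a₀, |C₂|, hαm, hα.2, hαle, hp, ⟨hkm, fun x => mul_nonneg (hα.2 x)
    (hp.genFunDeriv_nonneg x), fun x => ?_, ?_, ?_⟩, abs_nonneg _, fun x => ⟨(hC₂ x).1,
    (hC₂ x).2.trans (le_abs_self _)⟩⟩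
  · exact mul_le_mul (hαle x) (hC₁ x).2 (hp.genFunDeriv_nonneg x) ((hα.2 x).trans (hαle x))
  -- Tonelli rewrites the subcriticality integral as the mean `⟨G,K⟩`.
  · have h := hα₁.subcritical
    simp only [renewalDensity] at h
    rwa [lintegral_lintegral_swap] at h
    exact ((measurable_zeroExt hkm).comp ((measurable_subtype_coe.comp measurable_snd).sub
      measurable_fst)).ennreal_ofReal.aemeasurable
  · have ha : 0 < α₁ := hα₁.pos
    have hi : Integrable (fun x : PosReal => Real.exp (2 * α₁ * (x : ℝ))) G :=
      (lintegral_ofReal_ne_top_iff_integrable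
        (measurable_subtype_coe.const_mul _).exp.aestronglyMeasurable
        (ae_of_all _ fun x => (Real.exp_pos _).le)).1 hGexp.ne
    refine Integrable.mono' (hi.const_mul (1 / (2 * α₁ ^ 2)))
      (measurable_subtype_coe.pow_const 2).aestronglyMeasurable (ae_of_all _ fun x => ?_)
    have hx : (0 : ℝ) < x := x.2
    -- The quadratic term of the exponential gives `2 α₁² x² ≤ exp(2 α₁ x)`, hence the second moment
    -- of `G`.
    have h1 := Real.quadratic_le_exp_of_nonneg (x := 2 * α₁ * x) (by positivity)
    rw [Real.norm_of_nonneg (sq_nonneg _), div_mul_eq_mul_div, one_mul, le_div_iff₀ (by positivity)]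
    nlinarith [mul_pos ha hx]

lemma lintegral_mass_lt_top {L : Measure CountMeas} {α₁ : ℝ} (hα₁ : 0 < α₁)
    (hLexp : ∫⁻ ν, (∫⁻ x, ENNReal.ofReal (Real.exp (α₁ * (x : ℝ))) ∂ν.toMeas) ∂L < ∞) :
    ∫⁻ ν, ν.toMeas Set.univ ∂L < ∞ := by
  refine lt_of_le_of_lt (lintegral_mono fun ν => ?_) hLexp
  rw [← lintegral_one]
  refine lintegral_mono fun x => ?_
  rw [← ENNReal.ofReal_one]
  exact ENNReal.ofReal_le_ofReal (Real.one_le_exp (mul_nonneg hα₁.le (le_of_lt x.2)))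

lemma lintegral_coe_lt_top {L : Measure CountMeas} {α₁ : ℝ} (hα₁ : 0 < α₁)
    (hLexp : ∫⁻ ν, (∫⁻ x, ENNReal.ofReal (Real.exp (α₁ * (x : ℝ))) ∂ν.toMeas) ∂L < ∞) :
    ∫⁻ ν, (∫⁻ x, ENNReal.ofReal (x : ℝ) ∂ν.toMeas) ∂L < ∞ := by
  have hm : Measurable (fun x : PosReal => ENNReal.ofReal (Real.exp (α₁ * (x : ℝ)))) :=
    (measurable_subtype_coe.const_mul _).exp.ennreal_ofReal
  calc ∫⁻ ν, (∫⁻ x, ENNReal.ofReal (x : ℝ) ∂ν.toMeas) ∂L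
      ≤ ∫⁻ ν, ENNReal.ofReal α₁⁻¹ *
          (∫⁻ x, ENNReal.ofReal (Real.exp (α₁ * (x : ℝ))) ∂ν.toMeas) ∂L := by
        refine lintegral_mono fun ν => ?_
        rw [← lintegral_const_mul _ hm]
        refine lintegral_mono fun x => ?_
        rw [← ENNReal.ofReal_mul (inv_nonneg.2 hα₁.le)]
        refine ENNReal.ofReal_le_ofReal ?_
        rw [inv_mul_eq_div, le_div_iff₀ hα₁]
        linarith [Real.add_one_le_exp (α₁ * (x : ℝ))]
    _ = ENNReal.ofReal α₁⁻¹ *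
          ∫⁻ ν, (∫⁻ x, ENNReal.ofReal (Real.exp (α₁ * (x : ℝ))) ∂ν.toMeas) ∂L :=
        lintegral_const_mul _ ((Measure.measurable_lintegral hm).comp measurable_toMeas)
    _ < ∞ := ENNReal.mul_lt_top ENNReal.ofReal_lt_top hLexp

/-! ### Time averages of nonnegative processes -/

section TimeAverage

variable {Ω : Type*} [MeasurableSpace Ω] {μ : Measure Ω} [IsProbabilityMeasure μ]
  {X : ℝ → Ω → ℝ} {S : ℝ → ℝ} {c : ℝ}

/-- In the application `S` is the transient contribution of the initial population, with finite
total integral, and `c` is the stationary rate due to immigration. Only the latter grows with `T`.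
-/
lemma lintegral_lintegral_time_le (hX : Measurable (Function.uncurry X))
    (hS0 : ∀ s, 0 ≤ S s) (hS : IntegrableOn S (Set.Ioi 0)) (hc : 0 ≤ c)
    (h : ∀ s, 0 ≤ s → ∫⁻ ω, ENNReal.ofReal (X s ω) ∂μ ≤ ENNReal.ofReal (S s + c))
    {T : ℝ} (hT : 0 ≤ T) :
    ∫⁻ ω, (∫⁻ s in Set.Ioc 0 T, ENNReal.ofReal (X s ω)) ∂μ ≤
      ENNReal.ofReal ((∫ s in Set.Ioi 0, S s) + T * c) := by
  have hm : Measurable (Function.uncurry fun (ω : Ω) (s : ℝ) => ENNReal.ofReal (X s ω)) :=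
    (hX.comp measurable_swap).ennreal_ofReal
  have hSi : IntegrableOn S (Set.Ioc 0 T) := hS.mono_set Set.Ioc_subset_Ioi_self
  have hci : IntegrableOn (fun _ : ℝ => c) (Set.Ioc 0 T) := integrable_const c
  rw [lintegral_lintegral_swap hm.aemeasurable]
  calc ∫⁻ s in Set.Ioc 0 T, (∫⁻ ω, ENNReal.ofReal (X s ω) ∂μ)
      ≤ ∫⁻ s in Set.Ioc 0 T, ENNReal.ofReal (S s + c) :=
        setLIntegral_mono' measurableSet_Ioc fun s hs => h s hs.1.le
    _ = ENNReal.ofReal (∫ s in Set.Ioc 0 T, (S s + c)) :=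
        (ofReal_integral_eq_lintegral_ofReal (hSi.add hci)
          (ae_of_all _ fun s => add_nonneg (hS0 s) hc)).symm
    _ ≤ _ := by
        refine ENNReal.ofReal_le_ofReal ?_
        rw [integral_add hSi hci]
        refine add_le_add (setIntegral_mono_set hS (ae_of_all _ hS0)
          Set.Ioc_subset_Ioi_self.eventuallyLE) (le_of_eq ?_)
        simp [hT]

lemma ae_intervalIntegrable_time (hX : Measurable (Function.uncurry X)) (h0 : ∀ s ω, 0 ≤ X s ω)
    (hS0 : ∀ s, 0 ≤ S s) (hS : IntegrableOn S (Set.Ioi 0)) (hc : 0 ≤ c)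
    (h : ∀ s, 0 ≤ s → ∫⁻ ω, ENNReal.ofReal (X s ω) ∂μ ≤ ENNReal.ofReal (S s + c)) :
    ∀ᵐ ω ∂μ, ∀ t : ℝ, 0 ≤ t → IntervalIntegrable (fun s => X s ω) volume 0 t := by
  have hm : Measurable (Function.uncurry fun (ω : Ω) (s : ℝ) => ENNReal.ofReal (X s ω)) :=
    (hX.comp measurable_swap).ennreal_ofReal
  -- Integer horizons are enough and yield one null set valid for all `t` simultaneously.
  have h1 : ∀ᵐ ω ∂μ, ∀ n : ℕ, ∫⁻ s in Set.Ioc 0 (n : ℝ), ENNReal.ofReal (X s ω) < ∞ := by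
    rw [ae_all_iff]
    exact fun n => ae_lt_top hm.lintegral_prod_right'
      ((lintegral_lintegral_time_le hX hS0 hS hc h n.cast_nonneg).trans_lt
        ENNReal.ofReal_lt_top).ne
  filter_upwards [h1] with ω hω t ht
  obtain ⟨n, hn⟩ := exists_nat_ge t
  rw [intervalIntegrable_iff_integrableOn_Ioc_of_le ht]
  have h2 : IntegrableOn (fun s => X s ω) (Set.Ioc 0 (n : ℝ)) :=
    (lintegral_ofReal_ne_top_iff_integrable
      (hX.comp (measurable_id.prodMk measurable_const)).aestronglyMeasurable
      (ae_of_all _ fun s => h0 s ω)).1 (hω n).ne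
  exact h2.mono_set (Set.Ioc_subset_Ioc_right hn)

lemma integrable_time_average (hX : Measurable (Function.uncurry X)) (h0 : ∀ s ω, 0 ≤ X s ω)
    (hS0 : ∀ s, 0 ≤ S s) (hS : IntegrableOn S (Set.Ioi 0)) (hc : 0 ≤ c)
    (h : ∀ s, 0 ≤ s → ∫⁻ ω, ENNReal.ofReal (X s ω) ∂μ ≤ ENNReal.ofReal (S s + c))
    {t : ℝ} (ht : 0 < t) :
    Integrable (fun ω => t⁻¹ * ∫ s in (0 : ℝ)..t, X s ω) μ ∧
      ∫ ω, t⁻¹ * (∫ s in (0 : ℝ)..t, X s ω) ∂μ ≤ c + t⁻¹ * ∫ s in Set.Ioi 0, S s := by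
  have hX' : Measurable (Function.uncurry fun (ω : Ω) (s : ℝ) => X s ω) := hX.comp measurable_swap
  have hm : Measurable (fun ω => ∫ s in (0 : ℝ)..t, X s ω) := by
    simp_rw [intervalIntegral.integral_of_le ht.le]
    exact (hX'.stronglyMeasurable.integral_prod_right).measurable
  have hn : ∀ ω, 0 ≤ ∫ s in (0 : ℝ)..t, X s ω := fun ω =>
    intervalIntegral.integral_nonneg ht.le fun s _ => h0 s ω
  have hb : ∫⁻ ω, ENNReal.ofReal (∫ s in (0 : ℝ)..t, X s ω) ∂μ ≤
      ENNReal.ofReal ((∫ s in Set.Ioi 0, S s) + t * c) := by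
    refine (lintegral_mono_ae ?_).trans (lintegral_lintegral_time_le hX hS0 hS hc h ht.le)
    filter_upwards [ae_intervalIntegrable_time hX h0 hS0 hS hc h] with ω hω
    rw [intervalIntegral.integral_of_le ht.le, ofReal_integral_eq_lintegral_ofReal
      ((intervalIntegrable_iff_integrableOn_Ioc_of_le ht.le).1 (hω t ht.le))
      (ae_of_all _ fun s => h0 s ω)]
  have hi : Integrable (fun ω => ∫ s in (0 : ℝ)..t, X s ω) μ :=
    (lintegral_ofReal_ne_top_iff_integrable hm.aestronglyMeasurable (ae_of_all _ hn)).1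
      (hb.trans_lt ENNReal.ofReal_lt_top).ne
  refine ⟨hi.const_mul _, ?_⟩
  have hr : 0 ≤ (∫ s in Set.Ioi 0, S s) + t * c :=
    add_nonneg (integral_nonneg hS0) (mul_nonneg ht.le hc)
  have h2 : ∫ ω, (∫ s in (0 : ℝ)..t, X s ω) ∂μ ≤ (∫ s in Set.Ioi 0, S s) + t * c := by
    rw [integral_eq_lintegral_of_nonneg_ae (ae_of_all _ hn) hm.aestronglyMeasurable]
    exact ENNReal.toReal_le_of_le_ofReal hr hb
  rw [integral_const_mul]
  calc t⁻¹ * ∫ ω, (∫ s in (0 : ℝ)..t, X s ω) ∂μ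
      ≤ t⁻¹ * ((∫ s in Set.Ioi 0, S s) + t * c) :=
        mul_le_mul_of_nonneg_left h2 (inv_nonneg.2 ht.le)
    _ = _ := by field_simp; ring

/-- Jensen's inequality for `exp` on the unit interval. -/
lemma exp_neg_integral_le {A : ℝ → ℝ} (hA : IntegrableOn A (Set.Ioc 0 1)) (hA0 : ∀ s, 0 ≤ A s) :
    Real.exp (-∫ s in Set.Ioc (0 : ℝ) 1, A s) ≤ ∫ s in Set.Ioc (0 : ℝ) 1, Real.exp (-A s) := by
  set a := ∫ s in Set.Ioc (0 : ℝ) 1, A s with ha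
  have hi : IntegrableOn (fun s => Real.exp (-A s)) (Set.Ioc 0 1) :=
    Integrable.of_bound (Real.measurable_exp.comp_aemeasurable
      hA.aemeasurable.neg).aestronglyMeasurable 1 (ae_of_all _ fun s => exp_neg_mem (hA0 s))
  have hci : IntegrableOn (fun _ : ℝ => 1 + a) (Set.Ioc 0 1) := integrable_const _
  -- The tangent line of `exp(-·)` at the mean `a` integrates to `exp(-a)` over an interval of
  -- length `1`.
  have h1 : ∫ s in Set.Ioc (0 : ℝ) 1, Real.exp (-a) * ((1 + a) - A s) = Real.exp (-a) := by
    rw [integral_const_mul, integral_sub hci hA, ← ha]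
    simp
  rw [← h1]
  refine integral_mono ((hci.sub hA).const_mul _) hi fun s => ?_
  have h2 : Real.exp (-A s) = Real.exp (-a) * Real.exp (a - A s) := by
    rw [← Real.exp_add]; congr 1; ring
  simp only
  rw [h2]
  refine mul_le_mul_of_nonneg_left ?_ (Real.exp_nonneg _)
  have := Real.add_one_le_exp (a - A s)
  linarith

/-- The integral over `[0,n]` is the average over the phase `θ ∈ (0,1]` of the grid sums, and the
piece over `[n,t]` is dropped by positivity. Jensen's inequality in `θ` and Fubini then transfer any
bound that is uniform in the phase. -/
lemma integral_exp_time_average_le (hX : Measurable (Function.uncurry X))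
    (h0 : ∀ s ω, 0 ≤ X s ω)
    (hI : ∀ᵐ ω ∂μ, ∀ t : ℝ, 0 ≤ t → IntervalIntegrable (fun s => X s ω) volume 0 t)
    {t : ℝ} (ht : 0 < t) {n : ℕ} (hn : (n : ℝ) ≤ t) {b : ℝ}
    (hb : ∀ θ, 0 ≤ θ → ∫ ω, Real.exp (-∑ k ∈ Finset.range n, t⁻¹ * X (θ + k) ω) ∂μ ≤ b) :
    ∫ ω, Real.exp (-(t⁻¹ * ∫ s in (0 : ℝ)..t, X s ω)) ∂μ ≤ b := by
  set A : ℝ → Ω → ℝ := fun θ ω => ∑ k ∈ Finset.range n, t⁻¹ * X (θ + k) ω with hA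
  have htn : 0 ≤ t⁻¹ := inv_nonneg.2 ht.le
  have hA0 : ∀ θ ω, 0 ≤ A θ ω := fun θ ω =>
    Finset.sum_nonneg fun k _ => mul_nonneg htn (h0 _ _)
  have hAm : Measurable (Function.uncurry A) := by
    refine Finset.measurable_sum (Finset.range n) fun k _ => Measurable.const_mul ?_ _
    exact hX.comp ((measurable_fst.add measurable_const).prodMk measurable_snd)
  have hEm : Measurable (Function.uncurry fun ω θ => Real.exp (-A θ ω)) :=
    Real.measurable_exp.comp (hAm.comp measurable_swap).neg
  have hE : Integrable (Function.uncurry fun ω θ => Real.exp (-A θ ω))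
      (μ.prod (volume.restrict (Set.Ioc (0 : ℝ) 1))) :=
    Integrable.of_bound hEm.aestronglyMeasurable 1 (ae_of_all _ fun q => exp_neg_mem (hA0 _ _))
  have key : ∀ᵐ ω ∂μ, Real.exp (-(t⁻¹ * ∫ s in (0 : ℝ)..t, X s ω)) ≤
      ∫ θ in Set.Ioc (0 : ℝ) 1, Real.exp (-A θ ω) := by
    filter_upwards [hI] with ω hω
    have hab : ∀ a b : ℝ, 0 ≤ a → 0 ≤ b → IntervalIntegrable (fun s => X s ω) volume a b :=
      fun a b ha hb' => (hω a ha).symm.trans (hω b hb')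
    have hk : ∀ k : ℕ, IntervalIntegrable (fun θ => X (θ + k) ω) volume 0 1 := by
      intro k
      have := (hab k (k + 1) k.cast_nonneg (by positivity)).comp_add_right (k : ℝ)
      simpa using this
    have hkc : ∀ k : ℕ, IntegrableOn (fun θ => t⁻¹ * X (θ + k) ω) (Set.Ioc 0 1) := fun k =>
      ((intervalIntegrable_iff_integrableOn_Ioc_of_le zero_le_one).1 (hk k)).const_mul _
    have hAi : IntegrableOn (fun θ => A θ ω) (Set.Ioc 0 1) :=
      integrable_finsetSum _ fun k _ => hkc k
    refine le_trans (Real.exp_le_exp.2 (neg_le_neg ?_)) (exp_neg_integral_le hAi fun θ => hA0 θ ω)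
    have h1 : ∫ θ in Set.Ioc (0 : ℝ) 1, A θ ω = t⁻¹ * ∫ s in (0 : ℝ)..n, X s ω := by
      have h2 := intervalIntegral.sum_integral_adjacent_intervals (f := fun s => X s ω)
        (μ := volume) (a := fun i : ℕ => (i : ℝ)) (n := n)
        fun i _ => hab _ _ i.cast_nonneg (i + 1).cast_nonneg
      rw [Nat.cast_zero] at h2
      rw [← h2, hA, integral_finsetSum _ fun k _ => hkc k, Finset.mul_sum]
      refine Finset.sum_congr rfl fun k _ => ?_
      rw [integral_const_mul, ← intervalIntegral.integral_of_le zero_le_one,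
        intervalIntegral.integral_comp_add_right (fun s => X s ω) (k : ℝ)]
      congr 2
      · ring
      · push_cast; ring
    rw [h1]
    refine mul_le_mul_of_nonneg_left ?_ htn
    rw [← intervalIntegral.integral_add_adjacent_intervals (hab 0 n le_rfl n.cast_nonneg)
      (hab n t n.cast_nonneg ht.le)]
    exact le_add_of_nonneg_right (intervalIntegral.integral_nonneg hn fun s _ => h0 s ω)
  calc ∫ ω, Real.exp (-(t⁻¹ * ∫ s in (0 : ℝ)..t, X s ω)) ∂μ
      ≤ ∫ ω, (∫ θ in Set.Ioc (0 : ℝ) 1, Real.exp (-A θ ω)) ∂μ :=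
        integral_mono_of_nonneg (ae_of_all _ fun ω => Real.exp_nonneg _)
          hE.integral_prod_left key
    _ = ∫ θ in Set.Ioc (0 : ℝ) 1, (∫ ω, Real.exp (-A θ ω) ∂μ) := integral_integral_swap hE
    _ ≤ ∫ _ in Set.Ioc (0 : ℝ) 1, b :=
        setIntegral_mono_on hE.integral_prod_right (integrable_const b)
          measurableSet_Ioc fun θ hθ => hb θ hθ.1.le
    _ = b := by simp

end TimeAverage

/-! ### Concentration from Laplace transforms -/

/-- The Bernstein-type rate `e⁻ᶻ - 1 + z`. -/
noncomputable def expRate (z : ℝ) : ℝ := Real.exp (-z) - 1 + z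

lemma expRate_nonneg (z : ℝ) : 0 ≤ expRate z := by
  have := Real.add_one_le_exp (-z)
  unfold expRate
  linarith

lemma expRate_pos {z : ℝ} (hz : z ≠ 0) : 0 < expRate z := by
  have := Real.add_one_lt_exp (neg_ne_zero.2 hz)
  unfold expRate
  linarith

/-- The rate is convex with minimum at `0`, hence monotone on each side; away from `(-η, η)` it is
at least the smaller of its two boundary values. -/
lemma expRate_lower {η z : ℝ} (hη : 0 < η) (hz : η ≤ |z|) :
    min (expRate η) (expRate (-η)) ≤ expRate z := by
  unfold expRate
  rcases le_abs.1 hz with h | h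
  · refine (min_le_left _ _).trans ?_
    have h1 := Real.add_one_le_exp (-(z - η))
    have h2 : Real.exp (-z) = Real.exp (-η) * Real.exp (-(z - η)) := by
      rw [← Real.exp_add]; congr 1; ring
    have h3 : Real.exp (-η) ≤ 1 := Real.exp_le_one_iff.2 (by linarith)
    have h4 := Real.exp_pos (-η)
    rw [h2]
    nlinarith
  · refine (min_le_right _ _).trans ?_
    have h1 := Real.add_one_le_exp (-z - η)
    have h2 : Real.exp (-z) = Real.exp η * Real.exp (-z - η) := by
      rw [← Real.exp_add]; congr 1; ring
    have h3 : 1 ≤ Real.exp η := Real.one_le_exp hη.le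
    rw [h2, neg_neg]
    nlinarith

/-- The mean of `e^{-z} - 1 + z` at `z = W_t - c` involves only `E exp(-W_t)` and `E W_t`, both
bounded from above. It becomes small, and Markov's inequality for this nonnegative function gives
concentration on both sides of `c`. -/
lemma tendstoInMeasure_of_laplace_le {Ω : Type*} [MeasurableSpace Ω] {μ : Measure Ω}
    [IsProbabilityMeasure μ] {W : ℝ → Ω → ℝ} {c s : ℝ} {cJ : ℕ → ℝ} {r : ℕ → ℝ → ℝ}
    (hi : ∀ᶠ t in atTop, Integrable (W t) μ) (h0 : ∀ᶠ t in atTop, ∀ ω, 0 ≤ W t ω)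
    (hW : ∀ᶠ t in atTop, ∫ ω, W t ω ∂μ ≤ c + t⁻¹ * s)
    (hr : ∀ J, ∀ᶠ t in atTop, ∫ ω, Real.exp (-W t ω) ∂μ ≤ r J t)
    (hrlim : ∀ J, Tendsto (r J) atTop (𝓝 (Real.exp (-cJ J))))
    (hc : Tendsto cJ atTop (𝓝 c)) :
    TendstoInMeasure μ W atTop (fun _ => c) := by
  rw [tendstoInMeasure_iff_measureReal_norm]
  intro η hη
  set δ := min (expRate η) (expRate (-η)) with hδ
  have hδ0 : 0 < δ := lt_min (expRate_pos hη.ne') (expRate_pos (neg_ne_zero.2 hη.ne'))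
  refine Metric.tendsto_nhds.2 fun ε hε => ?_
  -- The truncation level `J` is fixed first, so that `exp(c - c_J) - 1` is small; only then does
  -- `t` tend to infinity.
  have hJ : ∀ᶠ J in atTop, Real.exp c * Real.exp (-cJ J) - 1 < ε * δ := by
    have h1 : Tendsto (fun J => Real.exp c * Real.exp (-cJ J) - 1) atTop
        (𝓝 (Real.exp c * Real.exp (-c) - 1)) :=
      (((Real.continuous_exp.tendsto _).comp hc.neg).const_mul _).sub_const _
    rw [← Real.exp_add, add_neg_cancel, Real.exp_zero, sub_self] at h1
    exact h1.eventually_lt_const (mul_pos hε hδ0)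
  obtain ⟨J, hJ⟩ := hJ.exists
  have ht : Tendsto (fun t : ℝ => Real.exp c * r J t - 1 + t⁻¹ * s) atTop
      (𝓝 (Real.exp c * Real.exp (-cJ J) - 1 + 0 * s)) :=
    (((hrlim J).const_mul _).sub_const _).add (tendsto_inv_atTop_zero.mul_const s)
  rw [zero_mul, add_zero] at ht
  filter_upwards [hi, h0, hW, hr J, ht.eventually_lt_const hJ] with t hi h0 hW hr hlt
  have hEi : Integrable (fun ω => Real.exp (-W t ω)) μ :=
    Integrable.of_bound (Real.measurable_exp.comp_aemeasurable
      hi.aemeasurable.neg).aestronglyMeasurable 1 (ae_of_all _ fun ω => exp_neg_mem (h0 ω))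
  have he : ∀ ω, expRate (W t ω - c) = Real.exp c * Real.exp (-W t ω) + (W t ω - (1 + c)) := by
    intro ω
    unfold expRate
    rw [← Real.exp_add, show -(W t ω - c) = c + -W t ω by ring]
    ring
  have hWi : Integrable (fun ω => W t ω - (1 + c)) μ := hi.sub (integrable_const _)
  have hRi : Integrable (fun ω => expRate (W t ω - c)) μ := by
    simp_rw [he]
    exact (hEi.const_mul _).add hWi
  have hRe : ∫ ω, expRate (W t ω - c) ∂μ ≤ Real.exp c * r J t - 1 + t⁻¹ * s := by
    simp_rw [he]
    rw [integral_add (hEi.const_mul _) hWi, integral_const_mul, integral_sub hi (integrable_const _)]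
    have := mul_le_mul_of_nonneg_left hr (Real.exp_nonneg c)
    simp only [integral_const, probReal_univ, smul_eq_mul, one_mul]
    linarith
  have hmk := mul_meas_ge_le_integral_of_nonneg (ae_of_all μ fun ω => expRate_nonneg (W t ω - c))
    hRi δ
  have hsub : μ.real {ω | η ≤ ‖W t ω - c‖} ≤ μ.real {ω | δ ≤ expRate (W t ω - c)} :=
    measureReal_mono fun ω (hω : η ≤ ‖W t ω - c‖) => expRate_lower hη hω
  rw [Real.dist_eq, sub_zero, abs_of_nonneg measureReal_nonneg]
  refine lt_of_le_of_lt hsub (lt_of_mul_lt_mul_left ?_ hδ0.le)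
  calc _ ≤ _ := hmk.trans hRe
    _ < ε * δ := hlt
    _ = δ * ε := mul_comm _ _

/-! ### Nonnegative test functions -/

section MarkovProcess

variable {G : Measure PosReal} [IsProbabilityMeasure G] {α : PosReal → ℝ} {p : PosReal → ℕ → ℝ}
  {κ a₀ C₂ : ℝ} {L : Measure CountMeas} [IsFiniteMeasure L] {P : ℝ≥0 → Kernel CountMeas CountMeas}
  {Ω : Type*} [mΩ : MeasurableSpace Ω] {μ : Measure Ω} [IsProbabilityMeasure μ]
  {𝓕 : Filtration ℝ≥0 mΩ} {σ : CountMeas} {Y : ℝ≥0 → Ω → CountMeas} {f : PosReal → ℝ} {C : ℝ}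

lemma IsRightContMarkov.measurable_pairing (hY : IsRightContMarkov μ 𝓕 P σ Y)
    (hf : Measurable f) :
    Measurable (Function.uncurry fun (s : ℝ) (ω : Ω) => pairing (Y s.toNNReal ω) f) :=
  (AgeBranching.measurable_pairing hf).comp ((measurable_path hY.measurable hY.rightCont).comp
    ((measurable_real_toNNReal.comp measurable_fst).prodMk measurable_snd))

/-- Extending the immigration integral from `[0,s]` to `(0,∞)` gives a bound whose stationary part
no longer depends on `s`. -/
lemma lintegral_pairing_time_le (D : BranchingData α p G κ a₀ C₂)
    (hP : IsImmigrationSemigroup α p G L P) (hY : IsRightContMarkov μ 𝓕 P σ Y)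
    (hL : ∫⁻ ν, ν.toMeas Set.univ ∂L < ∞)
    (hLx : ∫⁻ ν, (∫⁻ x, ENNReal.ofReal (x : ℝ) ∂ν.toMeas) ∂L < ∞)
    (hf : Measurable f) (h0 : ∀ x, 0 ≤ f x) (hC : ∀ x, f x ≤ C) {s : ℝ} (hs : 0 ≤ s) :
    ∫⁻ ω, ENNReal.ofReal (pairing (Y s.toNNReal ω) f) ∂μ ≤ ENNReal.ofReal
      (pairing σ (meanPath G (fun y => α y * genFunDeriv p y) f s) +
        ∫ ν, pairing ν (totalPath G (fun y => α y * genFunDeriv p y) f) ∂L) := by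
  refine (lintegral_pairing_le D hP hY hL hf h0 hC s.toNNReal).trans
    (ENNReal.ofReal_le_ofReal ?_)
  obtain ⟨hi, he⟩ := integral_pairing_integrableOn D.subcrit hL hLx hf h0 hC
  rw [Real.coe_toNNReal s hs, ← he, intervalIntegral.integral_of_le hs]
  refine add_le_add le_rfl (setIntegral_mono_set hi (ae_of_all _ fun q => ?_)
    Set.Ioc_subset_Ioi_self.eventuallyLE)
  exact integral_nonneg fun ν => pairing_nonneg ν ((meanPath_isSol D.subcrit hf h0 hC).nonneg q)

lemma ae_intervalIntegrable_pairing (D : BranchingData α p G κ a₀ C₂)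
    (hP : IsImmigrationSemigroup α p G L P) (hY : IsRightContMarkov μ 𝓕 P σ Y)
    (hL : ∫⁻ ν, ν.toMeas Set.univ ∂L < ∞)
    (hLx : ∫⁻ ν, (∫⁻ x, ENNReal.ofReal (x : ℝ) ∂ν.toMeas) ∂L < ∞)
    (hf : Measurable f) (h0 : ∀ x, 0 ≤ f x) (hC : ∀ x, f x ≤ C) :
    ∀ᵐ ω ∂μ, ∀ t : ℝ, 0 ≤ t →
      IntervalIntegrable (fun s : ℝ => pairing (Y s.toNNReal ω) f) volume 0 t :=
  ae_intervalIntegrable_time (hY.measurable_pairing hf) (fun _ _ => pairing_nonneg _ h0)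
    (fun s => pairing_nonneg σ ((meanPath_isSol D.subcrit hf h0 hC).nonneg s))
    (pairing_integrableOn D.subcrit hf h0 hC σ)
    (integral_nonneg fun ν => pairing_nonneg ν (totalPath_nonneg D.subcrit hf h0 hC))
    fun _ => lintegral_pairing_time_le D hP hY hL hLx hf h0 hC

lemma tendstoInMeasure_occupation_of_nonneg (D : BranchingData α p G κ a₀ C₂)
    (hP : IsImmigrationSemigroup α p G L P) (hY : IsRightContMarkov μ 𝓕 P σ Y)
    (hL : ∫⁻ ν, ν.toMeas Set.univ ∂L < ∞)
    (hLx : ∫⁻ ν, (∫⁻ x, ENNReal.ofReal (x : ℝ) ∂ν.toMeas) ∂L < ∞)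
    (hf : Measurable f) (h0 : ∀ x, 0 ≤ f x) (hC : ∀ x, f x ≤ C) :
    TendstoInMeasure μ (fun (t : ℝ) ω => t⁻¹ * occupation Y f t ω) atTop
      (fun _ => ∫ ν, pairing ν (totalPath G (fun y => α y * genFunDeriv p y) f) ∂L) := by
  set k := fun y => α y * genFunDeriv p y with hk
  have hX := hY.measurable_pairing hf
  have hX0 : ∀ (s : ℝ) ω, 0 ≤ pairing (Y s.toNNReal ω) f := fun _ _ => pairing_nonneg _ h0
  have hS0 : ∀ s, 0 ≤ pairing σ (meanPath G k f s) := fun s =>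
    pairing_nonneg σ ((meanPath_isSol D.subcrit hf h0 hC).nonneg s)
  have hS := pairing_integrableOn D.subcrit hf h0 hC σ
  have hc : 0 ≤ ∫ ν, pairing ν (totalPath G k f) ∂L :=
    integral_nonneg fun ν => pairing_nonneg ν (totalPath_nonneg D.subcrit hf h0 hC)
  have hE : ∀ s : ℝ, 0 ≤ s → ∫⁻ ω, ENNReal.ofReal (pairing (Y s.toNNReal ω) f) ∂μ ≤
      ENNReal.ofReal (pairing σ (meanPath G k f s) + ∫ ν, pairing ν (totalPath G k f) ∂L) :=
    fun s => lintegral_pairing_time_le D hP hY hL hLx hf h0 hC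
  have hI := ae_intervalIntegrable_pairing D hP hY hL hLx hf h0 hC
  have havg := fun (t : ℝ) (ht : 0 < t) => integrable_time_average hX hX0 hS0 hS hc hE ht
  obtain ⟨B, hB0, hB⟩ := exists_integral_exp_sum_le D hP hY hf h0 hC
  refine tendstoInMeasure_of_laplace_le (s := ∫ s in Set.Ioi (0 : ℝ), pairing σ (meanPath G k f s))
    (cJ := fun J => ∫ s in (0 : ℝ)..1, ∫ ν, pairing ν (meanTrain G k f J s) ∂L)
    -- The grid has `⌊t⌋` points per phase, and a grid of `q+1` points corresponds to `q = ⌊t⌋ - 1`.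
    (r := fun J t => Real.exp (-((((⌊t⌋₊ - 1 : ℕ) : ℝ) - J) * ∫ s in (0 : ℝ)..1, immExponent L
      (lowerPath (meanTrain G k f J) B t⁻¹ s))))
    ?_ ?_ ?_ ?_ ?_ (tendsto_integral_meanTrain D.subcrit hL hLx hf h0 hC)
  · filter_upwards [eventually_gt_atTop 0] with t ht using (havg t ht).1
  · filter_upwards [eventually_gt_atTop 0] with t ht ω
    exact mul_nonneg (inv_nonneg.2 ht.le)
      (intervalIntegral.integral_nonneg ht.le fun s _ => hX0 s ω)
  · filter_upwards [eventually_gt_atTop 0] with t ht using (havg t ht).2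
  · intro J
    filter_upwards [eventually_ge_atTop 1] with t ht
    have ht0 : 0 < t := one_pos.trans_le ht
    have hfl : ⌊t⌋₊ - 1 + 1 = ⌊t⌋₊ := Nat.sub_add_cancel ((Nat.one_le_floor_iff t).2 ht)
    refine integral_exp_time_average_le hX hX0 hI ht0 (Nat.floor_le ht0.le) fun θ hθ => ?_
    have h1 := hB J (⌊t⌋₊ - 1) t⁻¹ θ.toNNReal (inv_nonneg.2 ht0.le)
    rw [hfl] at h1
    refine le_of_eq_of_le ?_ h1
    refine integral_congr_ae (ae_of_all _ fun ω => ?_)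
    simp only
    congr 2
    refine Finset.sum_congr rfl fun i _ => ?_
    rw [Real.toNNReal_add hθ i.cast_nonneg, Real.toNNReal_natCast]
    exact (integral_const_mul _ _).symm
  · intro J
    have h1 := tendsto_immExponent_lowerPath hL (meanTrain_isPath D.subcrit hf h0 hC J)
      (meanTrain_nonneg D.subcrit hf h0 hC J) hB0
    -- The number `⌊t⌋ - 1 - J` of usable unit steps is asymptotic to `t`, while `t` times the
    -- immigration integral of each step converges.
    have h2 : Tendsto (fun t : ℝ => (((⌊t⌋₊ - 1 : ℕ) : ℝ) - J) * t⁻¹) atTop (𝓝 1) := by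
      have h3 : Tendsto (fun t : ℝ => (⌊t⌋₊ : ℝ) / t - (1 + J) * t⁻¹) atTop
          (𝓝 (1 - (1 + J) * 0)) :=
        tendsto_nat_floor_div_atTop.sub (tendsto_inv_atTop_zero.const_mul _)
      rw [mul_zero, sub_zero] at h3
      refine h3.congr' ?_
      filter_upwards [eventually_ge_atTop 1] with t ht
      rw [Nat.cast_sub ((Nat.one_le_floor_iff t).2 ht), Nat.cast_one]
      ring
    have h4 := (h2.mul h1).neg
    rw [one_mul] at h4
    refine ((Real.continuous_exp.tendsto _).comp h4).congr' ?_
    filter_upwards [eventually_gt_atTop 0] with t ht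
    simp only [Function.comp_apply]
    rw [mul_assoc, inv_mul_cancel_left₀ ht.ne']

end MarkovProcess

/-! ### Signed test functions -/

lemma tendstoInMeasure_sub_const {Ω : Type*} [MeasurableSpace Ω] {μ : Measure Ω}
    [IsFiniteMeasure μ] {V W : ℝ → Ω → ℝ} {a b : ℝ}
    (hV : TendstoInMeasure μ V atTop (fun _ => a)) (hW : TendstoInMeasure μ W atTop (fun _ => b)) :
    TendstoInMeasure μ (fun t ω => V t ω - W t ω) atTop (fun _ => a - b) := by
  rw [tendstoInMeasure_iff_measureReal_norm] at hV hW ⊢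
  intro ε hε
  have h := (hV (ε / 2) (half_pos hε)).add (hW (ε / 2) (half_pos hε))
  rw [add_zero] at h
  refine squeeze_zero (fun _ => measureReal_nonneg) (fun t => ?_) h
  refine (measureReal_mono ?_).trans (measureReal_union_le _ _)
  intro ω (hω : ε ≤ ‖V t ω - W t ω - (a - b)‖)
  by_contra hcon
  simp only [Set.mem_union, Set.mem_ofPred_eq, not_or, not_le] at hcon
  have h1 := norm_sub_le (V t ω - a) (W t ω - b)
  rw [show V t ω - a - (W t ω - b) = V t ω - W t ω - (a - b) by ring] at h1
  linarith [hcon.1, hcon.2]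

lemma pairing_sub {ν : CountMeas} {f g : PosReal → ℝ} (hf : Integrable f ν.toMeas)
    (hg : Integrable g ν.toMeas) :
    pairing ν (fun x => f x - g x) = pairing ν f - pairing ν g := integral_sub hf hg

end AgeBranching

/-- All conclusions are linear in `f`, so they are proved for the positive and negative parts and
subtracted; uniqueness is the comparison principle for the linear equation. -/
theorem mainTheorem6
    (α : PosReal → ℝ) (hα : IsBirthRate α)
    (p : PosReal → ℕ → ℝ) (hp : IsOffspringLaw p)
    (G : Measure PosReal) [IsProbabilityMeasure G] (hG : ∀ x, G {x} = 0)
    (L : Measure CountMeas) [IsFiniteMeasure L] (hL : L {ν | ν.toMeas = 0} = 0)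
    (α₁ : ℝ) (hα₁ : SubcriticalMalthusian α p G α₁)
    (hLexp : ∫⁻ ν, ∫⁻ x, ENNReal.ofReal (Real.exp (α₁ * (x : ℝ))) ∂ν.toMeas ∂L < ∞)
    (hGexp : ∫⁻ x, ENNReal.ofReal (Real.exp (2 * α₁ * (x : ℝ))) ∂G < ∞)
    (hg : SecondDerivBdd p)
    (P : ℝ≥0 → Kernel CountMeas CountMeas) (hP : IsImmigrationSemigroup α p G L P)
    {Ω : Type*} [mΩ : MeasurableSpace Ω] (μ : Measure Ω) [IsProbabilityMeasure μ]
    (𝓕 : Filtration ℝ≥0 mΩ) (σ : CountMeas) (Y : ℝ≥0 → Ω → CountMeas)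
    (hY : IsRightContMarkov μ 𝓕 P σ Y)
    (f : PosReal → ℝ) (hf : IsBddBorel f) :
    ∃ π : ℝ≥0 → PosReal → ℝ,
      IsMeanSolution α p G f π ∧
      (∀ π', IsMeanSolution α p G f π' → π' = π) ∧
      (∀ x, IntegrableOn (fun s : ℝ => π s.toNNReal x) (Set.Ioi 0)) ∧
      (∀ᵐ ν ∂L, Integrable (totalMean π) ν.toMeas) ∧
      Integrable (fun ν => pairing ν (totalMean π)) L ∧
      (∀ᵐ ω ∂μ, ∀ t : ℝ, 0 ≤ t →
        IntervalIntegrable (fun s : ℝ => pairing (Y s.toNNReal ω) f) volume 0 t) ∧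
      TendstoInMeasure μ (fun (t : ℝ) ω => t⁻¹ * occupation Y f t ω) atTop
        (fun _ => ∫ ν, pairing ν (totalMean π) ∂L) := by
  obtain ⟨κ, a₀, C₂, D⟩ := exists_branchingData hα hp hα₁ hGexp hg
  have hLm := lintegral_mass_lt_top hα₁.pos hLexp
  have hLx := lintegral_coe_lt_top hα₁.pos hLexp
  obtain ⟨hfm, C, hC⟩ := hf
  set k : PosReal → ℝ := fun y => α y * genFunDeriv p y with hkdef
  have hk : Subcrit G k κ := D.subcrit
  have hC0 : 0 ≤ C := (abs_nonneg _).trans (hC ⟨1, Set.mem_Ioi.2 one_pos⟩)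
  let f₁ : PosReal → ℝ := fun x => max (f x) 0
  let f₂ : PosReal → ℝ := fun x => max (-f x) 0
  have hm₁ : Measurable f₁ := hfm.max measurable_const
  have hm₂ : Measurable f₂ := hfm.neg.max measurable_const
  have h0₁ : ∀ x, 0 ≤ f₁ x := fun x => le_max_right _ _
  have h0₂ : ∀ x, 0 ≤ f₂ x := fun x => le_max_right _ _
  have hC₁ : ∀ x, f₁ x ≤ C := fun x => max_le ((le_abs_self _).trans (hC x)) hC0
  have hC₂ : ∀ x, f₂ x ≤ C := fun x => max_le ((neg_le_abs _).trans (hC x)) hC0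
  have hff : f = fun x => f₁ x - f₂ x := by
    funext x
    have := max_zero_sub_eq_self (f x)
    exact this.symm
  set π : ℝ → PosReal → ℝ := fun t x => meanPath G k f₁ t x - meanPath G k f₂ t x with hπ
  have hpath : IsMeanPath G k f π := by
    rw [hff]
    exact (meanPath_isMeanPath hk hm₁ h0₁ hC₁).sub hk (meanPath_isMeanPath hk hm₂ h0₂ hC₂)
  have hI₁ := meanPath_integrableOn hk hm₁ h0₁ hC₁
  have hI₂ := meanPath_integrableOn hk hm₂ h0₂ hC₂
  have htot : totalMean (fun t : ℝ≥0 => π t) = fun x => totalPath G k f₁ x - totalPath G k f₂ x := by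
    funext x
    rw [totalMean_restrict]
    exact integral_sub (hI₁ x) (hI₂ x)
  have hT₁ := integrable_totalPath hk hm₁ h0₁ hC₁
  have hT₂ := integrable_totalPath hk hm₂ h0₂ hC₂
  have hpair : (fun ν => pairing ν (totalMean fun t : ℝ≥0 => π t)) =
      fun ν => pairing ν (totalPath G k f₁) - pairing ν (totalPath G k f₂) := by
    funext ν
    rw [htot]
    exact pairing_sub (hT₁ ν) (hT₂ ν)
  have hP₁ := integrable_pairing_totalPath hk hLx hm₁ h0₁ hC₁
  have hP₂ := integrable_pairing_totalPath hk hLx hm₂ h0₂ hC₂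
  have hY₁ := ae_intervalIntegrable_pairing D hP hY hLm hLx hm₁ h0₁ hC₁
  have hY₂ := ae_intervalIntegrable_pairing D hP hY hLm hLx hm₂ h0₂ hC₂
  have hYf : ∀ ω (s : ℝ), pairing (Y s.toNNReal ω) f =
      pairing (Y s.toNNReal ω) f₁ - pairing (Y s.toNNReal ω) f₂ := by
    intro ω s
    conv_lhs => rw [hff]
    exact pairing_sub
      (integrable_toMeas _ hm₁ fun x => (abs_of_nonneg (h0₁ x)).trans_le (hC₁ x))
      (integrable_toMeas _ hm₂ fun x => (abs_of_nonneg (h0₂ x)).trans_le (hC₂ x))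
  refine ⟨fun t => π t, hpath.isMeanSolution hk, fun π' hπ' => ?_, fun x => ?_, ?_, ?_, ?_, ?_⟩
  · funext t x
    have h := (hπ'.isMeanPath hk).unique hk hpath t x
    rwa [extendTime, if_pos t.coe_nonneg, Real.toNNReal_coe] at h
  · refine IntegrableOn.congr_fun ((hI₁ x).sub (hI₂ x)) (fun s hs => ?_) measurableSet_Ioi
    simp only [hπ, Real.coe_toNNReal _ (le_of_lt hs), Pi.sub_apply]
  · rw [htot]
    exact ae_of_all _ fun ν => (hT₁ ν).sub (hT₂ ν)
  · rw [hpair]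
    exact hP₁.sub hP₂
  · filter_upwards [hY₁, hY₂] with ω h₁ h₂ t ht
    simp_rw [hYf]
    exact (h₁ t ht).sub (h₂ t ht)
  · rw [hpair, integral_sub hP₁ hP₂]
    refine (tendstoInMeasure_sub_const
      (tendstoInMeasure_occupation_of_nonneg D hP hY hLm hLx hm₁ h0₁ hC₁)
      (tendstoInMeasure_occupation_of_nonneg D hP hY hLm hLx hm₂ h0₂ hC₂)).congr' ?_
      (ae_of_all _ fun _ => rfl)
    -- The occupation integral splits only where both parts are integrable in time, hence almost
    -- surely, so the two processes are identified up to a null set.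
    filter_upwards [eventually_ge_atTop 0] with t ht
    filter_upwards [hY₁, hY₂] with ω h₁ h₂
    simp only [occupation]
    simp_rw [hYf]
    rw [intervalIntegral.integral_sub (h₁ t ht) (h₂ t ht), mul_sub]
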